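/- Let $B_n$ be the unit ball of $\mathbb{R}^n$, let $B_{n-1}$ be the unit ball of the hyperplane $\{x_n=0\}$, and let $B=B_n+B_{n-1}\subset\mathbb{R}^n$ (Lonke's barrel). A star body is an origin-symmetric compact set, star-shaped with respect to the origin, with the origin in its interior and with continuous radial function $\rho_K(\xi)=\max\{a: a\xi\in K\}$, $\xi\in S^{n-1}$. A star body $K$ is the intersection body of a star body $L$ if $\rho_K(\xi)=\mathrm{Vol}_{n-1}(L\cap\xi^\perp)$ for all $\xi\in S^{n-1}$. Let $Rg(\xi)=\int_{S^{n-1}\cap\xi^\perp}g$ be the spherical Radon transform (with respect to surface measure). A star body $K$ is an intersection body if there is a finite non-negative even Borel measure $\mu$ on $S^{n-1}$ with $\int_{S^{n-1}}\rho_K(\xi)g(\xi)\,d\xi=\int_{S^{n-1}}Rg\,d\mu$ for every continuous $g$ on $S^{n-1}$. A zonoid is a (compact) Hausdorff limit of finite Minkowski sums of segments. Then: 1. In $\mathbb{R}^4$, $B$ is the intersection body of the star body $L$ whose radial function at angle $\psi\in[0,\pi/2]$ from the $x_4$-axis (extended symmetrically) is $\rho_L(\psi)=\left(\frac{3\cos\psi}{\pi}\right)^{1/3}$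 for $0\le\psi\le\pi/4$ and $\rho_L(\psi)=\left(\frac{3}{4\pi}\right)^{1/3}\csc\psi$ for $\pi/4<\psi\le\pi/2$. 2. In $\mathbb{R}^6$, $B$ is an intersection body; indeed $\rho_B$ is the spherical Radon transform of a non-negative function of $|\theta_6|$ that is piecewise continuous: it agrees on $\{|\theta_6|<1/\sqrt2\}$ and on $\{|\theta_6|\ge 1/\sqrt2\}$ with $h_1(|\theta_6|)$ and $h_2(|\theta_6|)$, where $h_1\ge0$ is continuous on $[0,1/\sqrt2]$ and $h_2\ge0$ is continuous on $[1/\sqrt2,1]$. 3. For every $n\ge 6$, $B\subset\mathbb{R}^n$ is not the intersection body of any star body. 4. In $\mathbb{R}^8$, the inverse Radon transform of $\rho_B$ contains a negative Dirac mass: there is a constant $c>0$ such that for every continuous $g$ on $S^7$ $$\int_{S^7}\rho_B\,g\,d\xi=c\left(\int_{S^7}Rg(\theta)\,f(|\theta_8|)\,d\theta-\frac{4}{15}\int_{S^7}Rg\,d\delta\right),$$ where $f(t)=(1-t^2)^{-7/2}$ for $0\le t<1/\sqrt2$, $f(t)=\frac{96}{15}t$ for $1/\sqrt2\le t\le1$,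 and $\delta$ is the measure $\delta_{1/\sqrt2}(|\theta_8|)\,d\theta$, that is, $\int_{S^7} G\,d\delta=2^{-5/2}\sum_{\pm}\int_{S^6}G\!\left(\tfrac{\eta}{\sqrt2},\pm\tfrac1{\sqrt2}\right)d\eta$. 5. For every $n\ge 8$, $B\subset\mathbb{R}^n$ is not an intersection body. 6. For every $n\ge 8$, the polar $B^\circ=\{y:\langle x,y\rangle\le1\ \text{for all}\ x\in B\}$ of $B\subset\mathbb{R}^n$ is not a zonoid. -/

import Mathlib

open MeasureTheory Set Filter Topology
open scoped Pointwise

/-- Euclidean space `ℝⁿ`. -/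
abbrev Euc (n : ℕ) : Type := EuclideanSpace ℝ (Fin n)

/-- The unit sphere `S^{n-1}` of `ℝⁿ`. -/
abbrev USphere (n : ℕ) : Type := Metric.sphere (0 : Euc n) 1

/-- The (unnormalized) surface measure on `S^{n-1}`. -/
noncomputable def surfaceMeasure (n : ℕ) : Measure (USphere n) :=
  (volume : Measure (Euc n)).toSphere

/-- The hyperplane `ξ^⊥`, an `(n-1)`-dimensional Euclidean space for `ξ ≠ 0`. -/
noncomputable abbrev perpHyperplane {n : ℕ} (ξ : Euc n) : Submodule ℝ (Euc n) :=
  (Submodule.span ℝ {ξ})ᗮ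

/-- A unit vector of `ξ^⊥`, seen as a point of `S^{n-1}`. -/
noncomputable def perpSphereIncl {n : ℕ} (ξ : Euc n)
    (θ : Metric.sphere (0 : perpHyperplane ξ) 1) : USphere n :=
  ⟨((θ : perpHyperplane ξ) : Euc n), by
    have h : ‖(θ : perpHyperplane ξ)‖ = 1 := mem_sphere_zero_iff_norm.1 θ.2
    rw [mem_sphere_zero_iff_norm]
    exact h⟩

/-- The spherical Radon transform: `Rg(ξ)` is the integral of `g` over `S^{n-1} ∩ ξ^⊥`
with respect to the (unnormalized) `(n-2)`-dimensional surface measure. -/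
noncomputable def sphericalRadon {n : ℕ} (g : USphere n → ℝ) (ξ : USphere n) : ℝ :=
  ∫ θ : Metric.sphere (0 : perpHyperplane (ξ : Euc n)) 1, g (perpSphereIncl (ξ : Euc n) θ)
    ∂(volume : Measure (perpHyperplane (ξ : Euc n))).toSphere

/-- The radial function `ρ_K(ξ) = max {a : aξ ∈ K}`. -/
noncomputable def radialFn {n : ℕ} (K : Set (Euc n)) (ξ : USphere n) : ℝ :=
  sSup {a : ℝ | a • (ξ : Euc n) ∈ K}

/-- Origin-symmetric star bodies (with continuous, positive radial function). -/
structure IsStarBody {n : ℕ} (K : Set (Euc n)) : Prop where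
  isCompact : IsCompact K
  neg_eq : -K = K
  starConvex : StarConvex ℝ 0 K
  zero_mem_interior : (0 : Euc n) ∈ interior K
  continuous_radialFn : Continuous (radialFn K)

/-- `K` is the intersection body of `L`: both are origin-symmetric star bodies and
`ρ_K(ξ) = Vol_{n-1}(L ∩ ξ^⊥)` for every `ξ ∈ S^{n-1}`. -/
def IsIntersectionBodyOf {n : ℕ} (K L : Set (Euc n)) : Prop :=
  IsStarBody K ∧ IsStarBody L ∧ ∀ ξ : USphere n,
    radialFn K ξ = (volume : Measure (perpHyperplane (ξ : Euc n))).real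
      {x : perpHyperplane (ξ : Euc n) | (x : Euc n) ∈ L}

/-- `K` is an intersection body: its radial function is the spherical Radon transform of an
even non-negative (finite Borel) measure on the sphere. -/
def IsIntersectionBody {n : ℕ} (K : Set (Euc n)) : Prop :=
  IsStarBody K ∧ ∃ μ : Measure (USphere n), IsFiniteMeasure μ ∧
    μ.map (fun θ => -θ) = μ ∧
    ∀ g : C(USphere n, ℝ),
      ∫ ξ, radialFn K ξ * g ξ ∂(surfaceMeasure n) = ∫ ξ, sphericalRadon g ξ ∂μ

/-- The barrel `B_n + B_{n-1}` in `ℝⁿ`, where `B_n` is the unit ball and `B_{n-1}` is the unit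
ball of the coordinate hyperplane `x_n = 0` (the last coordinate has index `n - 1`). -/
def barrel (n : ℕ) : Set (Euc n) :=
  Metric.closedBall (0 : Euc n) 1 +
    {x : Euc n | x ∈ Metric.closedBall (0 : Euc n) 1 ∧ ∀ i : Fin n, (i : ℕ) + 1 = n → x i = 0}

/-- The polar body `K° = {y : ⟨x, y⟩ ≤ 1 for all x ∈ K}`. -/
def polarBody {n : ℕ} (K : Set (Euc n)) : Set (Euc n) :=
  {y : Euc n | ∀ x ∈ K, inner ℝ x y ≤ 1}

/-- Zonotopes: finite Minkowski sums of segments. -/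
def IsZonotope {n : ℕ} (Z : Set (Euc n)) : Prop :=
  ∃ (N : ℕ) (a b : Fin N → Euc n), Z = ∑ i, segment ℝ (a i) (b i)

/-- Zonoids: Hausdorff limits of zonotopes. -/
def IsZonoid {n : ℕ} (K : Set (Euc n)) : Prop :=
  IsCompact K ∧ ∃ Z : ℕ → Set (Euc n), (∀ k, IsZonotope (Z k)) ∧
    Tendsto (fun k => Metric.hausdorffEDist (Z k) K) atTop (𝓝 0)

/-- The point `(√(1 - t²) η, t)` of `S^m ⊂ ℝ^{m+1}`, for `η ∈ S^{m-1}`. -/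
noncomputable def latitudePoint {m : ℕ} (t : ℝ) (ht : |t| ≤ 1) (η : USphere m) :
    USphere (m + 1) :=
  ⟨WithLp.toLp 2 (Fin.snoc (α := fun _ => ℝ) (fun i => √(1 - t ^ 2) * (η : Euc m) i) t), by
    have h1 : ∑ i, ((η : Euc m) i) ^ 2 = 1 := by
      have h := EuclideanSpace.norm_sq_eq (η : Euc m)
      have h2 : ‖(η : Euc m)‖ = 1 := mem_sphere_zero_iff_norm.1 η.2
      rw [h2] at h
      simpa using h.symm
    have h3 : 0 ≤ 1 - t ^ 2 := by
      have := (sq_le_one_iff_abs_le_one t).2 ht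
      linarith
    rw [mem_sphere_zero_iff_norm, EuclideanSpace.norm_eq, Real.sqrt_eq_one,
      Fin.sum_univ_castSucc]
    simp only [Fin.snoc_castSucc, Fin.snoc_last, Real.norm_eq_abs, sq_abs, mul_pow,
      Real.sq_sqrt h3, ← Finset.mul_sum, h1]
    ring⟩

/-- The measure on `S^m ⊂ ℝ^{m+1}` (here `n = m + 1`) which, in the variable `t = |θ_n|`, is the
Dirac measure at `t₀`, that is `δ_{t₀}(|θ_n|) dθ`. Since
`dθ = (1 - t²)^{(n-3)/2} dt dη` in the coordinates `θ = (√(1 - t²) η, t)`, it is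
`(1 - t₀²)^{(n-3)/2} dη` on each of the two latitudes `θ_n = ± t₀`. -/
noncomputable def latitudeDirac (m : ℕ) (t₀ : ℝ) (ht : |t₀| ≤ 1) : Measure (USphere (m + 1)) :=
  ENNReal.ofReal ((1 - t₀ ^ 2) ^ (((m : ℝ) - 2) / 2)) •
    ((surfaceMeasure m).map (latitudePoint t₀ ht) +
      (surfaceMeasure m).map (latitudePoint (-t₀) (by rwa [abs_neg])))

/-- The radial function, in terms of `t = cos ψ ∈ [0, 1]` (`ψ` the angle from the `x_4`-axis), of
the body in `ℝ⁴` with `ρ(ψ) = (3 cos ψ / π)^{1/3}` for `ψ ≤ π/4` and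
`ρ(ψ) = (3 / (4π))^{1/3} csc ψ` for `π/4 < ψ ≤ π/2`. -/
noncomputable def barrelSource (t : ℝ) : ℝ :=
  if t < 1 / √2 then (3 / (4 * Real.pi)) ^ (1 / 3 : ℝ) * (1 / √(1 - t ^ 2))
  else (3 * t / Real.pi) ^ (1 / 3 : ℝ)

/-- The absolutely continuous part, in terms of `t = |θ_8|`, of the inverse Radon transform of
the radial function of the barrel in `ℝ⁸` (up to a positive constant). -/
noncomputable def barrelDensity (t : ℝ) : ℝ :=
  if t < 1 / √2 then 1 / (1 - t ^ 2) ^ (7 / 2 : ℝ) else 96 / 15 * t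

theorem abs_one_div_sqrt_two_le : |1 / √2| ≤ 1 := by
  rw [abs_of_nonneg (by positivity), div_le_one (by positivity)]
  exact Real.one_le_sqrt.2 (by norm_num)

/-!
All sets involved are rotation invariant about the last axis. With `t = |ξ_n|`, the radial function
of the barrel is `2 √(1 - t²)` for `t < 1/√2` and `1/t` for `t ≥ 1/√2` (`radialFn_barrel`), and the
Radon transform of a zonal function `H(θ_n)` is a multiple of `∫ (1 - u²)^{(n-4)/2} H(w u) du`, where
`w = √(1 - t²)` (`sphericalRadon_zonal`). The volume of a central section of a star body `L` is the
Radon transform of `ρ_L^{n-1} / (n-1)` (`IsStarBody.volume_section`).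

*Dimensions four, six and eight.* For `n = 2j + 4` the kernel is a polynomial, and the Radon transform
of the function which is `(1 - v²)^{-(2j+3)/2}` for `|v| < 1/√2` and `κ |v|` beyond is elementary, by
the substitution `y = u / √(1 - w² u²)` (`integral_profile_of_le`, `integral_profile_of_lt`). For
`j = 0, 1` a suitable `κ` gives a multiple of `ρ_B`. For `j = 2` the best choice leaves a multiple of
`(w² - 1/2)₊² / w⁵`, which is the Radon transform of the Dirac measure on the parallels
`|θ_n| = 1/√2` (`integral_latitudeDirac`). Passing between functions and measures is possible since
the integral of `Rg` over a parallel has an explicit kernel (`integral_latitude_sphericalRadon`); it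
is computed by writing `Rg` as a limit of averages over thin bands.

*Non-existence.* Let `P(x) = ρ_B (1 - x)^{(n-3)/2}` with `x = t²`. At `x = 1/2`, `P` is continuously
differentiable, but its second derivative jumps up, so that its third differences around `1/2` are of
order `h²`, with a definite sign (`tendsto_thirdDiff_barrelProfile`).
If the barrel is the intersection body of a star body, then averaging over parallels shows that `P` is
a multiple of `∫ G(u) (1 - x - u²)₊^{(n-4)/2} du` with `G` continuous (`barrelProfile_eq_abelTransform`).
For polynomial `G` this is smooth near `1/2`, and in general a Weierstrass approximation makes the third
differences `o(h²)`, because `t₊^{(n-4)/2}` is convex for `n ≥ 6` (`tendsto_thirdDiff_abelTransform`).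
If the barrel is an intersection body, then `P` is, against test functions, a superposition of the
functions `(y - x)₊^{(n-4)/2}`, whose third differences have the opposite sign for `n ≥ 8`
(`thirdDiff_sqrt_sub_pow_nonneg`).

*The polar.* The support function of the polar is the gauge of the barrel, which at the point `(η, z)`
with `|η| = 1` is `(1 + z²)/2` for `|z| < 1` and `|z|` for `|z| ≥ 1` (`polarBody_barrel_support`). Its
second derivative in `z` is the indicator of `|z| < 1`, which is not a convex function of `z²`. For a
zonotope the second derivative of the average over `η` of the support function is a combination of
the functions `(1 - (b z / r)²)₊^{(n-4)/2}`, which are non-increasing and convex in `z²`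
(`integral_nodeFunctional_nonneg`). A finite difference version of this property survives in the limit.
-/

set_option linter.unusedSectionVars false

/-! ### Slicing the sphere into parallels -/

section Slicing

variable {V W : Type*}
  [NormedAddCommGroup V] [InnerProductSpace ℝ V] [FiniteDimensional ℝ V]
  [MeasurableSpace V] [BorelSpace V]
  [NormedAddCommGroup W] [InnerProductSpace ℝ W] [FiniteDimensional ℝ W]
  [MeasurableSpace W] [BorelSpace W]

/-- Polar coordinates for the Lebesgue integral. -/
theorem lintegral_eq_lintegral_sphere_lintegral_Ioi [Nontrivial W] {f : W → ENNReal}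
    (hf : Measurable f) :
    ∫⁻ x, f x = ∫⁻ η : Metric.sphere (0 : W) 1, ∫⁻ r in Ioi (0 : ℝ),
      ENNReal.ofReal (r ^ (Module.finrank ℝ W - 1)) * f (r • (η : W))
        ∂volume ∂(volume : Measure W).toSphere := by
  have h := (volume : Measure W).measurePreserving_homeomorphUnitSphereProd
  have h1 := h.symm (homeomorphUnitSphereProd W).toMeasurableEquiv
  have h2 : ∫⁻ x, f x = ∫⁻ x in ({0}ᶜ : Set W), f x := by rw [restrict_compl_singleton]
  rw [h2, ← lintegral_subtype_comap (measurableSet_singleton _).compl,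
    ← h1.lintegral_comp_emb (MeasurableEquiv.measurableEmbedding _)]
  rw [lintegral_prod _ (by
    refine Measurable.aemeasurable ?_
    exact hf.comp (measurable_subtype_coe.comp (MeasurableEquiv.measurable _)))]
  refine lintegral_congr fun η => ?_
  rw [Measure.volumeIoiPow, lintegral_withDensity_eq_lintegral_mul]
  · rw [← lintegral_subtype_comap measurableSet_Ioi]
    refine lintegral_congr fun r => ?_
    simp only [Pi.mul_apply]
    congr 1
  · fun_prop
  · exact hf.comp (measurable_subtype_coe.comp ((MeasurableEquiv.measurable _).comp (by fun_prop)))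

/-- The point of the unit sphere of `V` at angle `α` above the equator `ι '' S(W)`, in the
direction of the pole `e`. -/
noncomputable def sphereSlice (ι : W →ₗᵢ[ℝ] V) {e : V} (he : ‖e‖ = 1)
    (hι : ∀ w, inner ℝ (ι w) e = 0) (α : ℝ) (η : Metric.sphere (0 : W) 1) :
    Metric.sphere (0 : V) 1 :=
  ⟨Real.cos α • ι η + Real.sin α • e, by
    have h1 : ‖(η : W)‖ = 1 := mem_sphere_zero_iff_norm.1 η.2
    have h : ‖Real.cos α • ι η + Real.sin α • e‖ ^ 2 = 1 := by
      rw [norm_add_sq_real, inner_smul_left, inner_smul_right, hι, norm_smul, norm_smul,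
        ι.norm_map, h1, he]
      simp
    rw [mem_sphere_zero_iff_norm]
    exact (pow_eq_one_iff_of_nonneg (norm_nonneg _) two_ne_zero).1 h⟩

variable (ι : W →ₗᵢ[ℝ] V) {e : V} (he : ‖e‖ = 1) (hι : ∀ w, inner ℝ (ι w) e = 0)

theorem coe_sphereSlice (α : ℝ) (η : Metric.sphere (0 : W) 1) :
    (sphereSlice ι he hι α η : V) = Real.cos α • ι η + Real.sin α • e := rfl

theorem continuous_sphereSlice_left (η : Metric.sphere (0 : W) 1) :
    Continuous fun α : ℝ => sphereSlice ι he hι α η := by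
  refine Continuous.subtype_mk ?_ _
  fun_prop

theorem continuous_sphereSlice :
    Continuous fun p : ℝ × Metric.sphere (0 : W) 1 => sphereSlice ι he hι p.1 p.2 := by
  refine Continuous.subtype_mk ?_ _
  have := ι.continuous
  fun_prop

/-- Fubini for the orthogonal decomposition `V = ι W ⊕ ℝ e`. -/
theorem lintegral_eq_lintegral_lintegral_add_smul (ι : W →ₗᵢ[ℝ] V) {e : V}
    (he : ‖e‖ = 1) (hι : ∀ w, inner ℝ (ι w) e = 0)
    (hd : Module.finrank ℝ V = Module.finrank ℝ W + 1)
    {f : V → ENNReal} (hf : Measurable f) :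
    ∫⁻ x, f x = ∫⁻ w : W, ∫⁻ t : ℝ, f (ι w + t • e) := by
  let j₀ : WithLp 2 (W × ℝ) →ₗ[ℝ] V :=
    { toFun := fun p => ι p.fst + p.snd • e
      map_add' := fun p q => by simp [add_smul]; abel
      map_smul' := fun c p => by simp [smul_smul] }
  let j : WithLp 2 (W × ℝ) →ₗᵢ[ℝ] V :=
    { toLinearMap := j₀
      norm_map' := fun p => by
        have h : ‖ι p.fst + p.snd • e‖ ^ 2 = ‖p‖ ^ 2 := by
          rw [norm_add_sq_real, inner_smul_right, hι, norm_smul, ι.norm_map, he,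
            WithLp.prod_norm_sq_eq_of_L2]
          simp
        exact (pow_left_inj₀ (norm_nonneg _) (norm_nonneg _) two_ne_zero).1 h }
  have hfr : Module.finrank ℝ (WithLp 2 (W × ℝ)) = Module.finrank ℝ V := by
    rw [hd, (WithLp.linearEquiv 2 ℝ (W × ℝ)).finrank_eq, Module.finrank_prod]
    simp
  let J := j.toLinearIsometryEquiv hfr
  rw [← J.measurePreserving.lintegral_comp hf,
    ← (WithLp.volume_preserving_toLp W ℝ).lintegral_comp
      (show Measurable fun a => f (J a) from hf.comp J.continuous.measurable), Measure.volume_eq_prod,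
    lintegral_prod _ (Measurable.aemeasurable ?_)]
  · rfl
  · exact (hf.comp J.continuous.measurable).comp (WithLp.volume_preserving_toLp W ℝ).measurable

/-- The weight `cos^d α dα` on `(-π/2, π/2)`. -/
noncomputable def cosPowMeasure (d : ℕ) : Measure ℝ :=
  (volume.restrict (Ioo (-(Real.pi / 2)) (Real.pi / 2))).withDensity
    fun α => ENNReal.ofReal (Real.cos α ^ d)

instance (d : ℕ) : SFinite (cosPowMeasure d) := by
  unfold cosPowMeasure; infer_instance

theorem lintegral_cosPowMeasure (d : ℕ) {f : ℝ → ENNReal} (hf : Measurable f) :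
    ∫⁻ α, f α ∂(cosPowMeasure d) = ∫⁻ α in Ioo (-(Real.pi / 2)) (Real.pi / 2),
      ENNReal.ofReal (Real.cos α ^ d) * f α := by
  rw [cosPowMeasure, lintegral_withDensity_eq_lintegral_mul _ (by fun_prop) hf]
  rfl

theorem integral_cosPowMeasure (d : ℕ) (f : ℝ → ℝ) :
    ∫ α, f α ∂(cosPowMeasure d) = ∫ α in Ioo (-(Real.pi / 2)) (Real.pi / 2),
      Real.cos α ^ d * f α := by
  rw [cosPowMeasure, integral_withDensity_eq_integral_toReal_smul (by fun_prop) (by simp)]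
  refine setIntegral_congr_fun measurableSet_Ioo fun α hα => ?_
  rw [ENNReal.toReal_ofReal (pow_nonneg (Real.cos_nonneg_of_mem_Icc (Ioo_subset_Icc_self hα)) _),
    smul_eq_mul]

/-- Polar coordinates in the right half-plane. -/
theorem lintegral_Ioi_lintegral_polar {f : ℝ → ℝ → ENNReal}
    (hf : Measurable fun p : ℝ × ℝ => f p.1 p.2) :
    ∫⁻ q in Ioi (0 : ℝ), ∫⁻ t, f q t = ∫⁻ α in Ioo (-(Real.pi / 2)) (Real.pi / 2),
      ∫⁻ r in Ioi (0 : ℝ), ENNReal.ofReal r * f (r * Real.cos α) (r * Real.sin α) := by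
  have h := lintegral_comp_polarCoord_symm
    (fun p : ℝ × ℝ => (Ioi (0 : ℝ)).indicator (fun q => f q p.2) p.1)
  have hm : Measurable fun p : ℝ × ℝ => (Ioi (0 : ℝ)).indicator (fun q => f q p.2) p.1 := by
    have : (fun p : ℝ × ℝ => (Ioi (0 : ℝ)).indicator (fun q => f q p.2) p.1) =
        {p : ℝ × ℝ | 0 < p.1}.indicator (fun p => f p.1 p.2) := by
      ext p; simp [indicator]
    rw [this]
    exact hf.indicator (measurableSet_lt measurable_const measurable_fst)
  have e1 : ∫⁻ p : ℝ × ℝ, (Ioi (0 : ℝ)).indicator (fun q => f q p.2) p.1 =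
      ∫⁻ q in Ioi (0 : ℝ), ∫⁻ t, f q t := by
    rw [Measure.volume_eq_prod, lintegral_prod _ hm.aemeasurable,
      ← lintegral_indicator measurableSet_Ioi]
    refine lintegral_congr fun q => ?_
    by_cases hq : 0 < q <;> simp [indicator, hq]
  rw [← e1, ← h]
  have ht : polarCoord.target = Ioi (0 : ℝ) ×ˢ Ioo (-Real.pi) Real.pi := rfl
  have hs : ∀ p : ℝ × ℝ, polarCoord.symm p = (p.1 * Real.cos p.2, p.1 * Real.sin p.2) :=
    fun p => rfl
  simp only [hs]
  have hm2 : Measurable fun p : ℝ × ℝ => ENNReal.ofReal p.1 • (Ioi (0 : ℝ)).indicator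
      (fun q => f q (p.1 * Real.sin p.2)) (p.1 * Real.cos p.2) := by
    refine Measurable.smul (f := fun p : ℝ × ℝ => ENNReal.ofReal p.1) (by fun_prop) ?_
    exact hm.comp (show Measurable fun p : ℝ × ℝ => (p.1 * Real.cos p.2, p.1 * Real.sin p.2) by
      fun_prop)
  have hms : ∀ α : ℝ, Measurable fun r : ℝ => ENNReal.ofReal r • (Ioi (0 : ℝ)).indicator
      (fun q => f q (r * Real.sin α)) (r * Real.cos α) := fun α =>
    hm2.comp (measurable_id.prodMk measurable_const)
  rw [ht, Measure.volume_eq_prod, ← Measure.prod_restrict, lintegral_prod_symm _ hm2.aemeasurable,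
    ← lintegral_indicator measurableSet_Ioo, ← lintegral_indicator measurableSet_Ioo]
  refine lintegral_congr fun α => ?_
  have hpi := Real.pi_pos
  by_cases h1 : α ∈ Ioo (-Real.pi) Real.pi
  · by_cases h2 : α ∈ Ioo (-(Real.pi / 2)) (Real.pi / 2)
    · rw [indicator_of_mem h1, indicator_of_mem h2]
      refine setLIntegral_congr_fun measurableSet_Ioi fun r hr => ?_
      have : r * Real.cos α ∈ Ioi (0 : ℝ) := mul_pos hr (Real.cos_pos_of_mem_Ioo h2)
      simp only [indicator_of_mem this, smul_eq_mul]
    · rw [indicator_of_mem h1, indicator_of_notMem h2]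
      have hc : Real.cos α ≤ 0 := by
        rw [mem_Ioo, not_and_or, not_lt, not_lt] at h2
        rcases h2 with h2 | h2
        · rw [← Real.cos_neg]
          exact Real.cos_nonpos_of_pi_div_two_le_of_le (by linarith) (by linarith [h1.1])
        · exact Real.cos_nonpos_of_pi_div_two_le_of_le h2 (by linarith [h1.2])
      rw [lintegral_eq_zero_iff (hms α)]
      filter_upwards [ae_restrict_mem measurableSet_Ioi] with r hr
      have : r * Real.cos α ∉ Ioi (0 : ℝ) := by
        simpa using mul_nonpos_of_nonneg_of_nonpos (le_of_lt hr) hc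
      simp [indicator_of_notMem this]
  · have h2 : α ∉ Ioo (-(Real.pi / 2)) (Real.pi / 2) := fun h => h1
      ⟨by linarith [h.1], by linarith [h.2]⟩
    rw [indicator_of_notMem h1, indicator_of_notMem h2]

/-- The open cone `(0, 1) • A`, whose volume defines the surface measure of `A`. -/
theorem measurableSet_Ioo_smul {A : Set (Metric.sphere (0 : V) 1)} (hA : MeasurableSet A) :
    MeasurableSet (Ioo (0 : ℝ) 1 • ((↑) '' A) : Set V) := by
  have h : (Ioo (0 : ℝ) 1 • ((↑) '' A) : Set V) =
      (fun p => ((homeomorphUnitSphereProd V).symm p : V)) ''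
        (A ×ˢ Iio (⟨1, mem_Ioi.2 one_pos⟩ : Ioi (0 : ℝ))) := by
    ext x
    constructor
    · rintro ⟨c, hc, _, ⟨a, ha, rfl⟩, rfl⟩
      exact ⟨(a, ⟨c, hc.1⟩), ⟨ha, hc.2⟩, rfl⟩
    · rintro ⟨⟨a, c⟩, ⟨ha, hc⟩, rfl⟩
      exact ⟨c, ⟨c.2, hc⟩, a, ⟨a, ha, rfl⟩, rfl⟩
  rw [h]
  exact ((MeasurableEmbedding.subtype_coe (measurableSet_singleton _).compl).comp
    (Homeomorph.measurableEmbedding _)).measurableSet_image.2 (hA.prod measurableSet_Iio)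

theorem smul_mem_Ioo_smul {A : Set (Metric.sphere (0 : V) 1)} {r : ℝ} (hr : 0 < r)
    (θ : Metric.sphere (0 : V) 1) :
    r • (θ : V) ∈ (Ioo (0 : ℝ) 1 • ((↑) '' A) : Set V) ↔ r < 1 ∧ θ ∈ A := by
  have hn : ∀ θ : Metric.sphere (0 : V) 1, ‖(θ : V)‖ = 1 := fun θ => mem_sphere_zero_iff_norm.1 θ.2
  constructor
  · rintro ⟨c, hc, _, ⟨a, ha, rfl⟩, h⟩
    simp only at h
    have h1 : c = r := by
      have := congrArg norm h
      rwa [norm_smul, norm_smul, hn, hn, mul_one, mul_one, Real.norm_of_nonneg hc.1.le,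
        Real.norm_of_nonneg hr.le] at this
    subst h1
    have h2 : a = θ := Subtype.ext (smul_right_injective V hr.ne' h)
    exact ⟨hc.2, h2 ▸ ha⟩
  · rintro ⟨h1, h2⟩
    exact ⟨r, ⟨hr, h1⟩, θ, ⟨θ, h2, rfl⟩, rfl⟩

/-- The radial part of the volume of a cone, in polar coordinates of a half-plane. -/
theorem lintegral_Ioi_radial {d : ℕ} (hd : 0 < d) (c : ℝ) (K : ENNReal) :
    ∫⁻ r in Ioi (0 : ℝ), ENNReal.ofReal r * (ENNReal.ofReal ((r * c) ^ (d - 1)) *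
        (Iio (1 : ℝ)).indicator (fun _ => K) r) =
      ENNReal.ofReal (1 / (d + 1)) * (ENNReal.ofReal (c ^ (d - 1)) * K) := by
  have h2 : ∀ r ∈ Ioi (0 : ℝ), ENNReal.ofReal r * (ENNReal.ofReal ((r * c) ^ (d - 1)) *
      (Iio (1 : ℝ)).indicator (fun _ => K) r) =
      (Iio (1 : ℝ)).indicator (fun r => ENNReal.ofReal (r ^ d) *
        (ENNReal.ofReal (c ^ (d - 1)) * K)) r := by
    intro r hr
    have hr' : 0 < r := hr
    by_cases h5 : r < 1
    · rw [indicator_of_mem (show r ∈ Iio 1 from h5), indicator_of_mem (show r ∈ Iio 1 from h5),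
        mul_pow, ENNReal.ofReal_mul (by positivity), ← mul_assoc, ← mul_assoc,
        ← ENNReal.ofReal_mul hr'.le, ← pow_succ', Nat.sub_add_cancel hd, mul_assoc]
    · rw [indicator_of_notMem (show r ∉ Iio 1 from h5),
        indicator_of_notMem (show r ∉ Iio 1 from h5)]
      simp
  rw [setLIntegral_congr_fun measurableSet_Ioi h2, setLIntegral_indicator measurableSet_Iio,
    lintegral_mul_const _ (by fun_prop)]
  congr 1
  rw [Iio_inter_Ioi, Measure.restrict_congr_set Ioo_ae_eq_Ioc,
    ← ofReal_integral_eq_lintegral_ofReal (intervalIntegral.intervalIntegrable_pow _).1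
      ((ae_restrict_mem measurableSet_Ioc).mono fun r hr => pow_nonneg hr.1.le _),
    ← intervalIntegral.integral_of_le zero_le_one]
  simp

/-- The mass of a cone over the half great circle through `η ∈ S(W)` and `± e`. -/
theorem lintegral_cone_halfPlane {d : ℕ} (hd : 0 < d) {f : V → ENNReal} (hf : Measurable f)
    {φ : Metric.sphere (0 : V) 1 → ENNReal} (hφ : Measurable φ)
    (hfφ : ∀ r : ℝ, 0 < r → ∀ θ : Metric.sphere (0 : V) 1,
      f (r • (θ : V)) = (Iio (1 : ℝ)).indicator (fun _ => φ θ) r)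
    (η : Metric.sphere (0 : W) 1) :
    ∫⁻ r in Ioi (0 : ℝ),
      ENNReal.ofReal (r ^ (d - 1)) * ∫⁻ t : ℝ, f (ι (r • (η : W)) + t • e) =
    ENNReal.ofReal (1 / (d + 1)) * ∫⁻ α, φ (sphereSlice ι he hι α η) ∂(cosPowMeasure (d - 1)) := by
  have hι' := ι.continuous
  have hφ1 : Measurable fun α : ℝ => φ (sphereSlice ι he hι α η) :=
    hφ.comp (continuous_sphereSlice_left ι he hι η).measurable
  have hm2 : Measurable fun α : ℝ =>
      ENNReal.ofReal (Real.cos α ^ (d - 1)) * φ (sphereSlice ι he hι α η) :=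
    Measurable.mul (by fun_prop) hφ1
  have hm1 : Measurable fun p : ℝ × ℝ =>
      ENNReal.ofReal (p.1 ^ (d - 1)) * f (ι (p.1 • (η : W)) + p.2 • e) :=
    Measurable.mul (by fun_prop) (hf.comp (by fun_prop))
  have : ∀ r : ℝ, ENNReal.ofReal (r ^ (d - 1)) * ∫⁻ t : ℝ, f (ι (r • (η : W)) + t • e) =
      ∫⁻ t : ℝ, ENNReal.ofReal (r ^ (d - 1)) * f (ι (r • (η : W)) + t • e) := fun r =>
    (lintegral_const_mul _ (hf.comp (by fun_prop))).symm
  simp_rw [this]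
  rw [lintegral_Ioi_lintegral_polar hm1, lintegral_cosPowMeasure _ hφ1,
    ← lintegral_const_mul _ hm2]
  refine setLIntegral_congr_fun measurableSet_Ioo fun α hα => ?_
  rw [← lintegral_Ioi_radial hd (Real.cos α)]
  refine setLIntegral_congr_fun measurableSet_Ioi fun r hr => ?_
  have h3 : ι ((r * Real.cos α) • (η : W)) + (r * Real.sin α) • e =
      r • (sphereSlice ι he hι α η : V) := by
    rw [coe_sphereSlice, smul_add, smul_smul, smul_smul, map_smul]
  simp only [h3, hfφ r hr]

/-- Slicing of the sphere into latitudes: the surface measure of `S(V)` is the image of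
`cos^{d-1} α dα ⊗ dη`, where `d = dim W = dim V - 1`. -/
theorem toSphere_eq_map_sphereSlice [Nontrivial W]
    (hd : Module.finrank ℝ V = Module.finrank ℝ W + 1) :
    (volume : Measure V).toSphere =
      ((cosPowMeasure (Module.finrank ℝ W - 1)).prod (volume : Measure W).toSphere).map
        fun p => sphereSlice ι he hι p.1 p.2 := by
  have hP := (continuous_sphereSlice ι he hι).measurable
  have hd0 : 0 < Module.finrank ℝ W := Module.finrank_pos
  ext A hA
  rw [Measure.map_apply hP hA, Measure.toSphere_apply' _ hA,
    ← lintegral_indicator_one (measurableSet_Ioo_smul hA), hd]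
  have hfm : Measurable ((Ioo (0 : ℝ) 1 • ((↑) '' A) : Set V).indicator (1 : V → ENNReal)) :=
    measurable_one.indicator (measurableSet_Ioo_smul hA)
  have hfc : ∀ r : ℝ, 0 < r → ∀ θ : Metric.sphere (0 : V) 1,
      (Ioo (0 : ℝ) 1 • ((↑) '' A) : Set V).indicator (1 : V → ENNReal) (r • (θ : V)) =
        (Iio (1 : ℝ)).indicator (fun _ => A.indicator 1 θ) r := by
    intro r hr θ
    by_cases h5 : r < 1 <;> by_cases h6 : θ ∈ A <;>
      simp [indicator, smul_mem_Ioo_smul hr, h5, h6]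
  generalize (Ioo (0 : ℝ) 1 • ((↑) '' A) : Set V).indicator (1 : V → ENNReal) = f at hfm hfc ⊢
  have hA1 : Measurable (A.indicator (1 : Metric.sphere (0 : V) 1 → ENNReal)) :=
    measurable_one.indicator hA
  have hι' := ι.continuous
  have hm : Measurable fun w : W => ∫⁻ t : ℝ, f (ι w + t • e) :=
    Measurable.lintegral_prod_right' (f := fun p : W × ℝ => f (ι p.1 + p.2 • e))
        (hfm.comp (by fun_prop))
  rw [lintegral_eq_lintegral_lintegral_add_smul ι he hι hd hfm,
    lintegral_eq_lintegral_sphere_lintegral_Ioi hm]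
  rw [lintegral_congr (fun η => lintegral_cone_halfPlane ι he hι hd0 hfm hA1 hfc η),
    lintegral_const_mul, ← mul_assoc]
  · have : ((Module.finrank ℝ W + 1 : ℕ) : ENNReal) *
        ENNReal.ofReal (1 / (Module.finrank ℝ W + 1)) = 1 := by
      rw [← ENNReal.ofReal_natCast, ← ENNReal.ofReal_mul (by positivity)]
      push_cast
      rw [mul_one_div_cancel (by positivity), ENNReal.ofReal_one]
    rw [this, one_mul, ← lintegral_indicator_one (hP hA), lintegral_prod_symm _
      (measurable_one.indicator (hP hA)).aemeasurable]
    rfl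
  · exact Measurable.lintegral_prod_left' (hA1.comp hP)

theorem integral_sphere_eq_integral_cosPowMeasure [Nontrivial W]
    (hd : Module.finrank ℝ V = Module.finrank ℝ W + 1) {g : Metric.sphere (0 : V) 1 → ℝ}
    (hg : Integrable g (volume : Measure V).toSphere) :
    ∫ θ, g θ ∂(volume : Measure V).toSphere = ∫ α, ∫ η, g (sphereSlice ι he hι α η)
      ∂(volume : Measure W).toSphere ∂(cosPowMeasure (Module.finrank ℝ W - 1)) := by
  have hP := (continuous_sphereSlice ι he hι).measurable
  rw [toSphere_eq_map_sphereSlice ι he hι hd] at hg ⊢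
  rw [integral_map hP.aemeasurable hg.aestronglyMeasurable, integral_prod]
  exact hg.comp_measurable hP

instance (d : ℕ) : IsFiniteMeasure (cosPowMeasure d) := by
  refine ⟨?_⟩
  have h := lintegral_cosPowMeasure d (f := fun _ => 1) measurable_const
  rw [lintegral_one] at h
  rw [h]
  refine lt_of_le_of_lt (lintegral_mono (g := fun _ => 1) fun α => ?_) (by simp)
  rw [mul_one, ENNReal.ofReal_le_one]
  exact (le_abs_self _).trans ((abs_pow _ _).trans_le
    (pow_le_one₀ (abs_nonneg _) (Real.abs_cos_le_one α)))

/-- The surface area of `S^{d-1} ⊂ ℝ^d`. -/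
noncomputable def sphereArea (d : ℕ) : ℝ := (surfaceMeasure d).real univ

theorem sphereArea_pos {d : ℕ} (hd : 0 < d) : 0 < sphereArea d := by
  have : Nonempty (Fin d) := ⟨⟨0, hd⟩⟩
  rw [sphereArea, surfaceMeasure, Measure.toSphere_real_apply_univ, finrank_euclideanSpace_fin]
  refine mul_pos (by exact_mod_cast hd) ?_
  rw [measureReal_def]
  exact ENNReal.toReal_pos (Metric.measure_ball_pos _ _ one_pos).ne' measure_ball_lt_top.ne

theorem exists_linearIsometry_perp {d : ℕ} (hd : Module.finrank ℝ V = d + 1) {e : V}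
    (he : ‖e‖ = 1) : ∃ ι : Euc d →ₗᵢ[ℝ] V, ∀ w, inner ℝ (ι w) e = 0 := by
  have : Fact (Module.finrank ℝ V = d + 1) := ⟨hd⟩
  have he0 : e ≠ 0 := by
    rintro rfl
    simp at he
  have hf : Module.finrank ℝ (ℝ ∙ e)ᗮ = d := Submodule.finrank_orthogonal_span_singleton he0
  let b := (stdOrthonormalBasis ℝ (ℝ ∙ e)ᗮ).reindex (finCongr hf)
  refine ⟨(ℝ ∙ e)ᗮ.subtypeₗᵢ.comp b.repr.symm.toLinearIsometry, fun w => ?_⟩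
  exact (Submodule.mem_orthogonal_singleton_iff_inner_left).1 (b.repr.symm w).2

/-- The integral of a function of one coordinate over the sphere (Archimedes' hat-box theorem in
arbitrary dimension). -/
theorem integral_sphere_inner {d : ℕ} (hd0 : 0 < d) (hd : Module.finrank ℝ V = d + 1) (v : V)
    {ψ : ℝ → ℝ} (hψ : Measurable ψ) {C : ℝ} (hC : ∀ u, |ψ u| ≤ C) :
    ∫ θ : Metric.sphere (0 : V) 1, ψ (inner ℝ (θ : V) v) ∂(volume : Measure V).toSphere =
      sphereArea d * ∫ α, ψ (‖v‖ * Real.sin α) ∂(cosPowMeasure (d - 1)) := by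
  have : Nonempty (Fin d) := ⟨⟨0, hd0⟩⟩
  have : Nontrivial V := Module.nontrivial_of_finrank_pos (R := ℝ) (by omega)
  obtain ⟨e, he, hv⟩ : ∃ e : V, ‖e‖ = 1 ∧ v = ‖v‖ • e := by
    by_cases h0 : v = 0
    · obtain ⟨e, he⟩ := exists_norm_eq V zero_le_one
      exact ⟨e, he, by simp [h0]⟩
    · refine ⟨‖v‖⁻¹ • v, norm_smul_inv_norm (𝕜 := ℝ) h0, ?_⟩
      rw [smul_smul, mul_inv_cancel₀ (norm_ne_zero_iff.2 h0), one_smul]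
  obtain ⟨ι, hι⟩ := exists_linearIsometry_perp hd he
  have hm : Measurable fun θ : Metric.sphere (0 : V) 1 => ψ (inner ℝ (θ : V) v) :=
    hψ.comp (by fun_prop)
  rw [integral_sphere_eq_integral_cosPowMeasure ι he hι (by simp [hd]), finrank_euclideanSpace_fin,
    ← integral_const_mul]
  · refine integral_congr_ae (.of_forall fun α => ?_)
    have h : ∀ η : Metric.sphere (0 : Euc d) 1,
        inner ℝ (sphereSlice ι he hι α η : V) v = ‖v‖ * Real.sin α := by
      intro η
      rw [coe_sphereSlice, hv, inner_smul_right, inner_add_left, inner_smul_left, inner_smul_left,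
        hι, real_inner_self_eq_norm_sq, he, ← hv]
      simp
    simp only [h, integral_const, smul_eq_mul]
    rfl
  · exact Integrable.of_bound hm.aestronglyMeasurable C (.of_forall fun θ => hC _)

end Slicing

/-! ### Functions of the last coordinate -/

section Zonal

theorem sin_image_Ioo :
    Real.sin '' Ioo (-(Real.pi / 2)) (Real.pi / 2) = Ioo (-1) 1 := by
  ext u
  constructor
  · rintro ⟨α, hα, rfl⟩
    have h := Real.cos_pos_of_mem_Ioo hα
    have h2 := Real.sin_sq_add_cos_sq α
    exact abs_lt.1 ((sq_lt_one_iff_abs_lt_one _).1 (by nlinarith))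
  · intro hu
    exact ⟨Real.arcsin u, ⟨Real.neg_pi_div_two_lt_arcsin.2 hu.1, Real.arcsin_lt_pi_div_two.2 hu.2⟩,
      Real.sin_arcsin hu.1.le hu.2.le⟩

/-- The substitution `u = sin α`. -/
theorem integral_cosPowMeasure_succ (m : ℕ) (f : ℝ → ℝ) :
    ∫ α, f (Real.sin α) ∂(cosPowMeasure (m + 1)) =
      ∫ u in Ioo (-1 : ℝ) 1, √(1 - u ^ 2) ^ m * f u := by
  rw [integral_cosPowMeasure, ← sin_image_Ioo, integral_image_eq_integral_abs_deriv_smul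
    measurableSet_Ioo (fun α _ => (Real.hasDerivAt_sin α).hasDerivWithinAt)
    (Real.injOn_sin.mono Ioo_subset_Icc_self)]
  refine setIntegral_congr_fun measurableSet_Ioo fun α hα => ?_
  have hc := Real.cos_pos_of_mem_Ioo hα
  simp only [smul_eq_mul]
  rw [← Real.abs_cos_eq_sqrt_one_sub_sin_sq, abs_of_pos hc]
  ring

theorem sqrt_one_sub_sq_pow_eq_zero {m : ℕ} (hm : m ≠ 0) {u : ℝ} (hu : u ∉ Ioo (-1 : ℝ) 1) :
    √(1 - u ^ 2) ^ m = 0 := by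
  have : 1 ≤ u ^ 2 := by
    rw [one_le_sq_iff_one_le_abs]
    by_contra h
    exact hu (abs_lt.1 (not_le.1 h))
  rw [Real.sqrt_eq_zero_of_nonpos (by linarith), zero_pow hm]

theorem setIntegral_Ioo_sqrt_one_sub_sq_pow {m : ℕ} (hm : m ≠ 0) (f : ℝ → ℝ) :
    ∫ u in Ioo (-1 : ℝ) 1, √(1 - u ^ 2) ^ m * f u = ∫ u, √(1 - u ^ 2) ^ m * f u := by
  refine setIntegral_eq_integral_of_forall_compl_eq_zero fun u hu => ?_
  rw [sqrt_one_sub_sq_pow_eq_zero hm hu, zero_mul]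

/-- The last coordinate of a point of the sphere. -/
noncomputable def height {m : ℕ} (θ : USphere (m + 1)) : ℝ := (θ : Euc (m + 1)) (Fin.last m)

/-- The north pole. -/
noncomputable def pole (m : ℕ) : Euc (m + 1) := EuclideanSpace.single (Fin.last m) 1

theorem norm_pole (m : ℕ) : ‖pole m‖ = 1 := by simp [pole]

theorem inner_pole {m : ℕ} (x : Euc (m + 1)) : inner ℝ x (pole m) = x (Fin.last m) := by
  simp [pole, EuclideanSpace.inner_single_right]

theorem height_eq_inner {m : ℕ} (θ : USphere (m + 1)) :
    height θ = inner ℝ (θ : Euc (m + 1)) (pole m) := (inner_pole _).symm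

theorem continuous_height {m : ℕ} : Continuous (height (m := m)) := by
  unfold height; fun_prop

theorem abs_height_le_one {m : ℕ} (θ : USphere (m + 1)) : |height θ| ≤ 1 := by
  rw [height_eq_inner]
  have := abs_real_inner_le_norm (θ : Euc (m + 1)) (pole m)
  rwa [norm_pole, mem_sphere_zero_iff_norm.1 θ.2, one_mul] at this

theorem height_sq_le_one {m : ℕ} (θ : USphere (m + 1)) : height θ ^ 2 ≤ 1 :=
  (sq_le_one_iff_abs_le_one _).2 (abs_height_le_one θ)

theorem finrank_perpHyperplane {m : ℕ} (ξ : USphere (m + 1)) :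
    Module.finrank ℝ (perpHyperplane (ξ : Euc (m + 1))) = m := by
  have : Fact (Module.finrank ℝ (Euc (m + 1)) = m + 1) := ⟨finrank_euclideanSpace_fin⟩
  have h0 : (ξ : Euc (m + 1)) ≠ 0 := Metric.ne_of_mem_sphere ξ.2 one_ne_zero
  exact Submodule.finrank_orthogonal_span_singleton h0

/-- The Radon transform of a function of the last coordinate. -/
theorem sphericalRadon_zonal {d : ℕ} (hd : 0 < d) (ξ : USphere (d + 2)) {ψ : ℝ → ℝ}
    (hψ : Measurable ψ) {C : ℝ} (hC : ∀ u, |ψ u| ≤ C) :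
    sphericalRadon (fun θ => ψ (height θ)) ξ =
      sphereArea d * ∫ α, ψ (√(1 - height ξ ^ 2) * Real.sin α) ∂(cosPowMeasure (d - 1)) := by
  have hξ : ‖(ξ : Euc (d + 2))‖ = 1 := mem_sphere_zero_iff_norm.1 ξ.2
  have hξp : inner ℝ (ξ : Euc (d + 2)) (pole (d + 1)) = height ξ := (height_eq_inner ξ).symm
  -- on `ξ^⊥` the last coordinate is the inner product with the projection `v` of the pole
  let v : perpHyperplane (ξ : Euc (d + 2)) := ⟨pole (d + 1) - height ξ • (ξ : Euc (d + 2)), by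
    rw [Submodule.mem_orthogonal_singleton_iff_inner_right, inner_sub_right, inner_smul_right,
      real_inner_self_eq_norm_sq, hξ, hξp]
    ring⟩
  have h1 : ∀ θ : Metric.sphere (0 : perpHyperplane (ξ : Euc (d + 2))) 1,
      height (perpSphereIncl (ξ : Euc (d + 2)) θ) = inner ℝ (θ : perpHyperplane _) v := by
    intro θ
    have h : inner ℝ ((θ : perpHyperplane (ξ : Euc (d + 2))) : Euc (d + 2)) (ξ : Euc (d + 2)) = 0 :=
      Submodule.mem_orthogonal_singleton_iff_inner_left.1
        (θ : perpHyperplane (ξ : Euc (d + 2))).2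
    rw [height_eq_inner, Submodule.coe_inner]
    simp only [v, perpSphereIncl, inner_sub_right, inner_smul_right, h, mul_zero, sub_zero]
  have h2 : ‖v‖ = √(1 - height ξ ^ 2) := by
    rw [← Real.sqrt_sq (norm_nonneg v)]
    congr 1
    rw [Submodule.coe_norm, norm_sub_sq_real, norm_pole, inner_smul_right, norm_smul, hξ,
      real_inner_comm, hξp, mul_pow, Real.norm_eq_abs, sq_abs]
    ring
  rw [← h2, ← integral_sphere_inner hd (finrank_perpHyperplane ξ) v hψ hC, sphericalRadon]
  simp only [h1]

theorem integral_surfaceMeasure_zonal {d : ℕ} (hd : 0 < d) {ψ : ℝ → ℝ}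
    (hψ : Measurable ψ) {C : ℝ} (hC : ∀ u, |ψ u| ≤ C) :
    ∫ θ : USphere (d + 1), ψ (height θ) ∂(surfaceMeasure (d + 1)) =
      sphereArea d * ∫ α, ψ (Real.sin α) ∂(cosPowMeasure (d - 1)) := by
  have h := integral_sphere_inner (V := Euc (d + 1)) hd finrank_euclideanSpace_fin (pole d) hψ hC
  simp only [norm_pole, one_mul] at h
  simp only [height_eq_inner]
  exact h

instance (n : ℕ) : IsFiniteMeasure (surfaceMeasure n) := by
  unfold surfaceMeasure; infer_instance

end Zonal

/-! ### A rectangular approximate identity -/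

section ApproximateIdentity

/-- The rectangular approximate identity of mass one and width `1 / (j + 1)`. -/
noncomputable def band (j : ℕ) (u : ℝ) : ℝ :=
  (j + 1) * (Ioo (-(1 / 2)) (1 / 2) : Set ℝ).indicator 1 ((j + 1) * u)

theorem measurable_band (j : ℕ) : Measurable (band j) := by
  unfold band
  exact measurable_const.mul ((measurable_one.indicator measurableSet_Ioo).comp (by fun_prop))

theorem band_nonneg (j : ℕ) (u : ℝ) : 0 ≤ band j u :=
  mul_nonneg (by positivity) (indicator_nonneg (fun _ _ => zero_le_one) _)

theorem abs_band_le (j : ℕ) (u : ℝ) : |band j u| ≤ j + 1 := by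
  rw [abs_of_nonneg (band_nonneg j u)]
  exact mul_le_of_le_one_right (by positivity)
    (indicator_le' (fun _ _ => le_rfl) (fun _ _ => zero_le_one) _)

/-- After rescaling, the average against a band is an average over a fixed interval. -/
theorem integral_band_comp_mul_add (j : ℕ) {a : ℝ} (ha : 0 < a) (b : ℝ) (F : ℝ → ℝ) :
    ∫ u, band j (a * u + b) * F u =
      a⁻¹ * ∫ y in Ioo (-(1 / 2) : ℝ) (1 / 2), F ((y / (j + 1) - b) / a) := by
  have hN : (0 : ℝ) < j + 1 := by positivity
  set H : ℝ → ℝ := fun y => (j + 1) * ((Ioo (-(1 / 2)) (1 / 2) : Set ℝ).indicator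
    (fun y => F ((y / (j + 1) - b) / a)) y) with hH
  have h1 : ∀ u, band j (a * u + b) * F u = H ((j + 1) * a * (u + b / a)) := by
    intro u
    have e1 : (j + 1) * a * (u + b / a) = (j + 1) * (a * u + b) := by field_simp
    rw [e1, hH, band]
    by_cases h : ((j : ℝ) + 1) * (a * u + b) ∈ (Ioo (-(1 / 2)) (1 / 2) : Set ℝ)
    · have e2 : ((j + 1) * (a * u + b) / (j + 1) - b) / a = u := by field_simp; ring
      simp only [indicator_of_mem h, Pi.one_apply, mul_one, e2]
    · simp only [indicator_of_notMem h, mul_zero, zero_mul]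
  simp_rw [h1]
  rw [integral_add_right_eq_self (fun u => H ((j + 1) * a * u)), Measure.integral_comp_mul_left,
    hH, integral_const_mul, integral_indicator measurableSet_Ioo, abs_of_pos (by positivity),
    smul_eq_mul, ← mul_assoc]
  congr 1
  field_simp

theorem abs_integral_band_le (j : ℕ) {a : ℝ} (ha : 0 < a) (b : ℝ) {F : ℝ → ℝ} {C : ℝ}
    (hC : ∀ u, |F u| ≤ C) : |∫ u, band j (a * u + b) * F u| ≤ C / a := by
  rw [integral_band_comp_mul_add j ha, abs_mul, abs_of_pos (inv_pos.2 ha),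
    div_eq_inv_mul C]
  refine mul_le_mul_of_nonneg_left ?_ (inv_nonneg.2 ha.le)
  have := norm_setIntegral_le_of_norm_le_const (μ := (volume : Measure ℝ))
    (s := Ioo (-(1 / 2) : ℝ) (1 / 2)) (f := fun y => F ((y / (j + 1) - b) / a)) (C := C)
    (by simp) (fun y _ => hC _)
  refine this.trans_eq ?_
  rw [measureReal_def, Real.volume_Ioo]
  norm_num

theorem tendsto_integral_band {a : ℝ} (ha : 0 < a) (b : ℝ) {F : ℝ → ℝ} (hF : Continuous F)
    {C : ℝ} (hC : ∀ u, |F u| ≤ C) :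
    Tendsto (fun j : ℕ => ∫ u, band j (a * u + b) * F u) atTop (𝓝 (F (-b / a) / a)) := by
  simp_rw [fun j => integral_band_comp_mul_add j ha b F, div_eq_inv_mul (F (-b / a))]
  refine Tendsto.const_mul _ ?_
  have h : ∫ y in Ioo (-(1 / 2) : ℝ) (1 / 2), F (-b / a) = F (-b / a) := by
    rw [setIntegral_const, measureReal_def, Real.volume_Ioo]
    norm_num
  rw [← h]
  refine tendsto_integral_of_dominated_convergence (fun _ => C) (fun j => ?_) (by simp)
    (fun j => .of_forall fun y => hC _) (.of_forall fun y => ?_)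
  · exact (hF.comp (by fun_prop)).aestronglyMeasurable
  · refine (hF.tendsto _).comp ?_
    refine Tendsto.div_const ?_ _
    have : Tendsto (fun j : ℕ => y / ((j : ℝ) + 1) - b) atTop (𝓝 (0 - b)) :=
      ((tendsto_const_nhds.div_atTop
        (tendsto_atTop_add_const_right _ _ tendsto_natCast_atTop_atTop))).sub_const _
    simpa using this

end ApproximateIdentity

/-! ### The Radon transform as a limit of averages over bands -/

section RadonBand

variable {d : ℕ}

theorem integrable_surfaceMeasure {n : ℕ} {g : USphere n → ℝ} (hg : Continuous g) :
    Integrable g (surfaceMeasure n) := by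
  obtain ⟨C, hC⟩ := isCompact_univ.exists_bound_of_continuousOn hg.continuousOn
  exact Integrable.of_bound hg.aestronglyMeasurable C (.of_forall fun θ => hC θ (mem_univ _))

/-- The spherical Radon transform is the limit of the averages over thin bands around `ξ^⊥`. -/
theorem tendsto_integral_band_sphericalRadon (hd : 2 ≤ d) {g : USphere (d + 2) → ℝ}
    (hg : Continuous g) (ξ : USphere (d + 2)) :
    Tendsto (fun j : ℕ => ∫ θ, g θ * band j (inner ℝ (θ : Euc (d + 2)) (ξ : Euc (d + 2)))
      ∂(surfaceMeasure (d + 2))) atTop (𝓝 (sphericalRadon g ξ)) := by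
  have hξ : ‖(ξ : Euc (d + 2))‖ = 1 := mem_sphere_zero_iff_norm.1 ξ.2
  obtain ⟨C, hC⟩ := isCompact_univ.exists_bound_of_continuousOn hg.continuousOn
  have hι : ∀ w : perpHyperplane (ξ : Euc (d + 2)),
      inner ℝ ((perpHyperplane (ξ : Euc (d + 2))).subtypeₗᵢ w) (ξ : Euc (d + 2)) = 0 :=
    fun w => Submodule.mem_orthogonal_singleton_iff_inner_left.1 w.2
  set ι := (perpHyperplane (ξ : Euc (d + 2))).subtypeₗᵢ with hιdef
  have hfr := finrank_perpHyperplane ξ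
  have : Nontrivial (perpHyperplane (ξ : Euc (d + 2))) :=
    Module.nontrivial_of_finrank_pos (R := ℝ) (hfr ▸ Nat.succ_pos _)
  set σ := (volume : Measure (perpHyperplane (ξ : Euc (d + 2)))).toSphere with hσ
  set M : ℝ → ℝ := fun u => ∫ η, g (sphereSlice ι hξ hι (Real.arcsin u) η) ∂σ with hM
  have hcs := continuous_sphereSlice ι hξ hι
  have hMc : Continuous M := by
    refine continuous_of_dominated (bound := fun _ => C) (fun u => ?_)
      (fun u => .of_forall fun η => hC _ (mem_univ _)) (integrable_const _)
      (.of_forall fun η => ?_)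
    · exact (hg.comp (hcs.comp (by fun_prop : Continuous fun η : Metric.sphere
        (0 : perpHyperplane (ξ : Euc (d + 2))) 1 =>
          (Real.arcsin u, η)))).aestronglyMeasurable
    · exact hg.comp ((continuous_sphereSlice_left ι hξ hι η).comp Real.continuous_arcsin)
  have hMb : ∀ u, |M u| ≤ C * σ.real univ := fun u =>
    norm_integral_le_of_norm_le_const (.of_forall fun η => hC _ (mem_univ _))
  have key : ∀ j : ℕ, ∫ θ, g θ * band j (inner ℝ (θ : Euc (d + 2)) (ξ : Euc (d + 2)))
      ∂(surfaceMeasure (d + 2)) = ∫ u, band j (1 * u + 0) * (√(1 - u ^ 2) ^ (d - 1) * M u) := by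
    intro j
    obtain ⟨m, rfl⟩ : ∃ m, d = m + 1 := ⟨d - 1, by omega⟩
    have hb : Measurable fun θ : USphere (m + 1 + 2) =>
        band j (inner ℝ (θ : Euc (m + 1 + 2)) (ξ : Euc (m + 1 + 2))) :=
      (measurable_band j).comp (by fun_prop)
    have hint : Integrable (fun θ : USphere (m + 1 + 2) =>
        g θ * band j (inner ℝ (θ : Euc (m + 1 + 2)) (ξ : Euc (m + 1 + 2))))
        (volume : Measure (Euc (m + 1 + 2))).toSphere := by
      refine Integrable.of_bound (hg.measurable.mul hb).aestronglyMeasurable (C * (j + 1))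
        (.of_forall fun θ => ?_)
      rw [norm_mul]
      exact mul_le_mul (hC θ (mem_univ _)) (abs_band_le _ _) (norm_nonneg _)
        ((norm_nonneg _).trans (hC θ (mem_univ _)))
    have hin : ∀ α (η : Metric.sphere (0 : perpHyperplane (ξ : Euc (m + 1 + 2))) 1),
        inner ℝ (sphereSlice ι hξ hι α η : Euc (m + 1 + 2)) (ξ : Euc (m + 1 + 2)) =
          Real.sin α := by
      intro α η
      rw [coe_sphereSlice, inner_add_left, inner_smul_left, inner_smul_left, hι,
        real_inner_self_eq_norm_sq, hξ]
      simp
    have hsub : Module.finrank ℝ (perpHyperplane (ξ : Euc (m + 1 + 2))) - 1 = m + 1 := by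
      rw [hfr]; rfl
    rw [surfaceMeasure, integral_sphere_eq_integral_cosPowMeasure ι hξ hι (by
      rw [hfr, finrank_euclideanSpace_fin]) hint, hsub]
    have h2 := integral_cosPowMeasure_succ m fun u => band j u * M u
    rw [setIntegral_Ioo_sqrt_one_sub_sq_pow (by omega)] at h2
    simp only [one_mul, add_zero, Nat.add_sub_cancel]
    rw [integral_congr_ae (.of_forall fun u => mul_left_comm _ _ _)] at h2
    rw [← h2, integral_cosPowMeasure, integral_cosPowMeasure]
    refine setIntegral_congr_fun measurableSet_Ioo fun α hα => ?_
    simp only [hin, hM, Real.arcsin_sin hα.1.le hα.2.le]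
    rw [integral_mul_const, mul_comm (band _ _)]
  simp_rw [key]
  have hw : ∀ u : ℝ, |√(1 - u ^ 2) ^ (d - 1)| ≤ 1 := fun u => by
    rw [abs_of_nonneg (by positivity)]
    exact pow_le_one₀ (by positivity) (Real.sqrt_le_one.2 (by nlinarith [sq_nonneg u]))
  have hlim := tendsto_integral_band one_pos 0
    (F := fun u => √(1 - u ^ 2) ^ (d - 1) * M u) (by fun_prop) (C := 1 * (C * σ.real univ))
    (fun u => by rw [abs_mul]; exact mul_le_mul (hw u) (hMb u) (abs_nonneg _) zero_le_one)
  have hval : (√(1 - (-0 / 1 : ℝ) ^ 2) ^ (d - 1) * M (-0 / 1)) / 1 = sphericalRadon g ξ := by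
    have : ∀ η, sphereSlice ι hξ hι 0 η = perpSphereIncl (ξ : Euc (d + 2)) η := fun η =>
      Subtype.ext (by rw [coe_sphereSlice]; simp [hιdef, perpSphereIncl])
    simp [hM, this, sphericalRadon, hσ]
  rwa [hval] at hlim

theorem measurable_sphericalRadon (hd : 2 ≤ d) {g : USphere (d + 2) → ℝ} (hg : Continuous g) :
    Measurable (sphericalRadon g) := by
  refine measurable_of_tendsto_metrizable (fun j => ?_) (tendsto_pi_nhds.2 fun ξ =>
    tendsto_integral_band_sphericalRadon hd hg ξ)
  refine (StronglyMeasurable.integral_prod_right' (f := fun p : USphere (d + 2) × USphere (d + 2) =>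
    g p.2 * band j (inner ℝ (p.2 : Euc (d + 2)) (p.1 : Euc (d + 2)))) ?_).measurable
  refine Measurable.stronglyMeasurable (Measurable.mul ?_ ?_)
  · exact hg.measurable.comp measurable_snd
  · exact (measurable_band j).comp (by fun_prop)

/-- A bounded function has a bounded Radon transform: the total mass of `S^{n-1} ∩ ξ^⊥` is the
Radon transform of the constant function `1`. -/
theorem abs_sphericalRadon_le (hd : 0 < d) {g : USphere (d + 2) → ℝ} {C : ℝ}
    (hC : ∀ θ, |g θ| ≤ C) (ξ : USphere (d + 2)) :
    |sphericalRadon g ξ| ≤ C * (sphereArea d * ∫ _, 1 ∂(cosPowMeasure (d - 1))) := by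
  have h := sphericalRadon_zonal hd ξ (ψ := fun _ => 1) measurable_const (C := 1) (by simp)
  rw [← h, sphericalRadon, sphericalRadon, ← integral_const_mul]
  refine norm_integral_le_of_norm_le
    (μ := (volume : Measure (perpHyperplane (ξ : Euc (d + 2)))).toSphere)
    (f := fun θ => g (perpSphereIncl (ξ : Euc (d + 2)) θ))
    (integrable_const (C * 1)) (.of_forall fun θ => ?_)
  rw [mul_one]
  exact hC _

end RadonBand

/-! ### Latitude and longitude -/

section Latitude

/-- The inclusion of the equatorial hyperplane `ℝ^m ⊂ ℝ^{m+1}`. -/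
noncomputable def equatorIncl (m : ℕ) : Euc m →ₗᵢ[ℝ] Euc (m + 1) where
  toFun x := WithLp.toLp 2 (Fin.snoc (α := fun _ => ℝ) (fun i => x i) 0)
  map_add' x y := by
    ext i
    refine Fin.lastCases ?_ (fun i => ?_) i <;> simp
  map_smul' c x := by
    ext i
    refine Fin.lastCases ?_ (fun i => ?_) i <;> simp
  norm_map' x := by
    simp only [LinearMap.coe_mk, AddHom.coe_mk]
    rw [EuclideanSpace.norm_eq, EuclideanSpace.norm_eq, Fin.sum_univ_castSucc]
    simp

theorem equatorIncl_castSucc {m : ℕ} (x : Euc m) (i : Fin m) :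
    equatorIncl m x i.castSucc = x i := by simp [equatorIncl]

theorem equatorIncl_last {m : ℕ} (x : Euc m) : equatorIncl m x (Fin.last m) = 0 := by
  simp [equatorIncl]

theorem inner_equatorIncl_pole {m : ℕ} (x : Euc m) :
    inner ℝ (equatorIncl m x) (pole m) = 0 := by
  rw [inner_pole, equatorIncl_last]

/-- The point of the sphere with latitude `α` and longitude `η`. -/
noncomputable def latitude {m : ℕ} (α : ℝ) (η : USphere m) : USphere (m + 1) :=
  sphereSlice (equatorIncl m) (norm_pole m) inner_equatorIncl_pole α η

theorem coe_latitude {m : ℕ} (α : ℝ) (η : USphere m) : (latitude α η : Euc (m + 1)) =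
    Real.cos α • equatorIncl m η + Real.sin α • pole m := rfl

theorem height_latitude {m : ℕ} (α : ℝ) (η : USphere m) : height (latitude α η) = Real.sin α := by
  rw [height, coe_latitude]
  simp [equatorIncl_last, pole]

theorem continuous_latitude {m : ℕ} :
    Continuous fun p : ℝ × USphere m => latitude p.1 p.2 :=
  continuous_sphereSlice (equatorIncl m) (norm_pole m) inner_equatorIncl_pole

theorem continuous_latitude_left {m : ℕ} (η : USphere m) : Continuous fun α => latitude α η :=
  continuous_sphereSlice_left _ _ _ η

theorem continuous_latitude_right {m : ℕ} (α : ℝ) :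
    Continuous fun η : USphere m => latitude α η := by
  have := (equatorIncl m).continuous
  refine Continuous.subtype_mk ?_ _
  fun_prop

theorem latitude_eq_latitudePoint {m : ℕ} {α : ℝ} (hα : α ∈ Icc (-(Real.pi / 2)) (Real.pi / 2))
    {t : ℝ} (ht : |t| ≤ 1) (h : Real.sin α = t) (η : USphere m) :
    latitude α η = latitudePoint t ht η := by
  refine Subtype.ext ?_
  have hc : Real.cos α = √(1 - t ^ 2) := by
    rw [← h, ← Real.abs_cos_eq_sqrt_one_sub_sin_sq, abs_of_nonneg (Real.cos_nonneg_of_mem_Icc hα)]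
  rw [coe_latitude, h, hc]
  ext i
  refine Fin.lastCases ?_ (fun i => ?_) i
  · simp [latitudePoint, pole, equatorIncl_last]
  · simp [latitudePoint, pole, equatorIncl_castSucc, (Fin.castSucc_lt_last i).ne]

theorem surfaceMeasure_succ_eq_map {m : ℕ} (hm : 0 < m) : surfaceMeasure (m + 1) =
    ((cosPowMeasure (m - 1)).prod (surfaceMeasure m)).map fun p => latitude p.1 p.2 := by
  have : Nonempty (Fin m) := ⟨⟨0, hm⟩⟩
  have h := toSphere_eq_map_sphereSlice (equatorIncl m) (norm_pole m) inner_equatorIncl_pole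
    (by simp)
  rw [finrank_euclideanSpace_fin] at h
  exact h

theorem integral_surfaceMeasure_succ {m : ℕ} (hm : 0 < m) {g : USphere (m + 1) → ℝ}
    (hg : Integrable g (surfaceMeasure (m + 1))) :
    ∫ θ, g θ ∂(surfaceMeasure (m + 1)) =
      ∫ α, ∫ η, g (latitude α η) ∂(surfaceMeasure m) ∂(cosPowMeasure (m - 1)) := by
  have : Nonempty (Fin m) := ⟨⟨0, hm⟩⟩
  have h := integral_sphere_eq_integral_cosPowMeasure (equatorIncl m) (norm_pole m)
    inner_equatorIncl_pole (by simp) hg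
  rw [finrank_euclideanSpace_fin] at h
  exact h

/-- The length `√(1 - θ_n²)` of the horizontal part of `θ`. -/
noncomputable def width {m : ℕ} (θ : USphere (m + 1)) : ℝ := √(1 - height θ ^ 2)

theorem continuous_width {m : ℕ} : Continuous (width (m := m)) := by
  unfold width
  have := continuous_height (m := m)
  fun_prop

theorem width_nonneg {m : ℕ} (θ : USphere (m + 1)) : 0 ≤ width θ := Real.sqrt_nonneg _

theorem width_sq {m : ℕ} (θ : USphere (m + 1)) : width θ ^ 2 = 1 - height θ ^ 2 :=
  Real.sq_sqrt (by linarith [height_sq_le_one θ])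

theorem width_le_one {m : ℕ} (θ : USphere (m + 1)) : width θ ≤ 1 :=
  Real.sqrt_le_one.2 (by linarith [sq_nonneg (height θ)])

/-- The orthogonal projection to the equatorial hyperplane. -/
noncomputable def horizontal {m : ℕ} (x : Euc (m + 1)) : Euc m :=
  WithLp.toLp 2 fun i => x i.castSucc

theorem equatorIncl_horizontal {m : ℕ} (x : Euc (m + 1)) :
    equatorIncl m (horizontal x) + x (Fin.last m) • pole m = x := by
  ext i
  refine Fin.lastCases ?_ (fun i => ?_) i
  · simp [equatorIncl_last, pole]
  · simp [equatorIncl_castSucc, pole, horizontal, (Fin.castSucc_lt_last i).ne]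

theorem norm_sq_eq_horizontal {m : ℕ} (x : Euc (m + 1)) :
    ‖x‖ ^ 2 = ‖horizontal x‖ ^ 2 + x (Fin.last m) ^ 2 := by
  rw [EuclideanSpace.norm_sq_eq, EuclideanSpace.norm_sq_eq, Fin.sum_univ_castSucc]
  simp [horizontal]

theorem norm_horizontal {m : ℕ} (θ : USphere (m + 1)) :
    ‖horizontal (θ : Euc (m + 1))‖ = width θ := by
  have h := norm_sq_eq_horizontal (θ : Euc (m + 1))
  rw [mem_sphere_zero_iff_norm.1 θ.2] at h
  rw [← Real.sqrt_sq (norm_nonneg _), width]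
  congr 1
  rw [height]
  linarith

theorem inner_equatorIncl {m : ℕ} (y : Euc m) (x : Euc (m + 1)) :
    inner ℝ (equatorIncl m y) x = inner ℝ y (horizontal x) := by
  conv_lhs => rw [← equatorIncl_horizontal x]
  rw [inner_add_right, inner_smul_right, inner_equatorIncl_pole, LinearIsometry.inner_map_map]
  simp

theorem inner_latitude {m : ℕ} (α : ℝ) (η : USphere m) (x : Euc (m + 1)) :
    inner ℝ (latitude α η : Euc (m + 1)) x =
      inner ℝ (η : Euc m) (Real.cos α • horizontal x) + Real.sin α * x (Fin.last m) := by
  rw [coe_latitude, inner_add_left, inner_smul_left, inner_smul_left, inner_equatorIncl,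
    inner_smul_right, real_inner_comm x, inner_pole]
  simp

end Latitude

/-! ### The average of a Radon transform over a parallel -/

section Duality

variable {d : ℕ}

/-- The singularity at the poles is integrable; it dominates the kernels below. -/
theorem integrable_inv_width (hd : 0 < d) :
    Integrable (fun θ : USphere (d + 2) => (width θ)⁻¹) (surfaceMeasure (d + 2)) := by
  refine ⟨(continuous_width.measurable.inv).aestronglyMeasurable, ?_⟩
  rw [hasFiniteIntegral_iff_norm, surfaceMeasure_succ_eq_map (Nat.succ_pos _),
    lintegral_map (by exact (continuous_width.measurable.inv.norm).ennreal_ofReal)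
      continuous_latitude.measurable, lintegral_prod _ (by
        exact ((continuous_width.measurable.inv.norm).ennreal_ofReal.comp
          continuous_latitude.measurable).aemeasurable)]
  have h : ∀ α (η : USphere (d + 1)), width (latitude α η) = |Real.cos α| := fun α η => by
    rw [width, height_latitude, Real.abs_cos_eq_sqrt_one_sub_sin_sq]
  simp only [h, lintegral_const]
  rw [lintegral_mul_const _ (by fun_prop)]
  refine ENNReal.mul_lt_top ?_ (measure_lt_top _ _)
  rw [lintegral_cosPowMeasure _ (by fun_prop)]
  refine lt_of_le_of_lt (setLIntegral_mono (g := fun _ => 1) measurable_const fun α hα => ?_)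
    (by simp)
  have hc := Real.cos_pos_of_mem_Ioo hα
  rw [← ENNReal.ofReal_mul (by positivity), ENNReal.ofReal_le_one, norm_inv, norm_abs_eq_norm,
    Real.norm_of_nonneg hc.le]
  obtain ⟨m, rfl⟩ : ∃ m, d = m + 1 := ⟨d - 1, by omega⟩
  have : Real.cos α ^ (m + 1 + 1 - 1) * (Real.cos α)⁻¹ = Real.cos α ^ m := by
    rw [Nat.add_sub_cancel, pow_succ, mul_assoc, mul_inv_cancel₀ hc.ne', mul_one]
  rw [this]
  exact pow_le_one₀ hc.le (Real.cos_le_one α)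

theorem ae_width_pos : ∀ᵐ θ : USphere (d + 2) ∂(surfaceMeasure (d + 2)),
    0 < width θ := by
  have hset : MeasurableSet {θ : USphere (d + 2) | 0 < width θ} :=
    measurableSet_lt measurable_const continuous_width.measurable
  rw [surfaceMeasure_succ_eq_map (Nat.succ_pos _), ae_map_iff
    continuous_latitude.measurable.aemeasurable hset]
  have h2 : ∀ᵐ α ∂(cosPowMeasure (d + 1 - 1)), 0 < |Real.cos α| := by
    refine (withDensity_absolutelyContinuous _ _).ae_le ?_
    filter_upwards [ae_restrict_mem measurableSet_Ioo] with α hα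
    exact abs_pos_of_pos (Real.cos_pos_of_mem_Ioo hα)
  have h3 := (Measure.quasiMeasurePreserving_fst (μ := cosPowMeasure (d + 1 - 1))
    (ν := surfaceMeasure (d + 1))).ae h2
  filter_upwards [h3] with p hp
  rwa [width, height_latitude, ← Real.abs_cos_eq_sqrt_one_sub_sin_sq]

theorem integral_band_inner_le (hd : 2 ≤ d) (j : ℕ) (ξ : USphere (d + 2)) :
    ∫ θ, band j (inner ℝ (θ : Euc (d + 2)) (ξ : Euc (d + 2))) ∂(surfaceMeasure (d + 2)) ≤
      sphereArea (d + 1) := by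
  obtain ⟨m, rfl⟩ : ∃ m, d = m + 2 := ⟨d - 2, by omega⟩
  have h := integral_sphere_inner (V := Euc (m + 2 + 2)) (d := m + 2 + 1) (Nat.succ_pos _)
    finrank_euclideanSpace_fin (ξ : Euc (m + 2 + 2)) (measurable_band j) (abs_band_le j)
  rw [mem_sphere_zero_iff_norm.1 ξ.2] at h
  rw [surfaceMeasure, h]
  refine mul_le_of_le_one_right (sphereArea_pos (Nat.succ_pos _)).le ?_
  have h2 := integral_cosPowMeasure_succ (m + 1) fun u => band j (1 * u)
  rw [setIntegral_Ioo_sqrt_one_sub_sq_pow (by omega)] at h2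
  refine h2.le.trans ?_
  have h3 := abs_integral_band_le j one_pos 0 (F := fun u => √(1 - u ^ 2) ^ (m + 1)) (C := 1)
    fun u => by
      rw [abs_of_nonneg (by positivity)]
      exact pow_le_one₀ (by positivity) (Real.sqrt_le_one.2 (by nlinarith [sq_nonneg u]))
  refine (le_abs_self _).trans (le_trans (le_of_eq ?_) (h3.trans_eq (div_one 1)))
  simp only [add_zero, mul_comm]

/-- Averaging over the parallel first: the band average seen from a fixed point `θ`. -/
theorem integral_band_latitude (hd : 3 ≤ d) (j : ℕ) (α : ℝ) (hα : 0 ≤ Real.cos α)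
    (θ : USphere (d + 2)) :
    ∫ η, band j (inner ℝ (θ : Euc (d + 2)) (latitude α η : Euc (d + 2)))
      ∂(surfaceMeasure (d + 1)) = sphereArea d * ∫ u, band j
        (Real.cos α * width θ * u + Real.sin α * height θ) * √(1 - u ^ 2) ^ (d - 2) := by
  obtain ⟨m, rfl⟩ : ∃ m, d = m + 2 := ⟨d - 2, by omega⟩
  have h := integral_sphere_inner (V := Euc (m + 2 + 1)) (d := m + 2) (Nat.succ_pos _)
    finrank_euclideanSpace_fin (Real.cos α • horizontal (θ : Euc (m + 2 + 2)))
    (ψ := fun x => band j (x + Real.sin α * height θ))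
    ((measurable_band j).comp (by fun_prop)) (fun u => abs_band_le j _)
  have h1 : ∀ η : USphere (m + 2 + 1),
      inner ℝ (θ : Euc (m + 2 + 2)) (latitude α η : Euc (m + 2 + 2)) =
        inner ℝ (η : Euc (m + 2 + 1)) (Real.cos α • horizontal (θ : Euc (m + 2 + 2))) +
          Real.sin α * height θ := fun η => by
    rw [real_inner_comm, inner_latitude]; rfl
  simp only [h1]
  rw [surfaceMeasure, h, norm_smul, norm_horizontal, Real.norm_of_nonneg hα]
  have h2 := integral_cosPowMeasure_succ m fun u => band j
    (Real.cos α * width θ * u + Real.sin α * height θ)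
  rw [setIntegral_Ioo_sqrt_one_sub_sq_pow (by omega)] at h2
  rw [show m + 2 - 1 = m + 1 from rfl, h2]
  simp only [mul_comm, Nat.add_sub_cancel]

/-- The two forms of the kernel: `1 - (s h / (c w))²` is `(w² - s²) / (c w)²` when `s² + c² = 1` and
`w² + h² = 1`. -/
theorem latitude_kernel_identity (m : ℕ) {c s w h : ℝ} (hc : 0 < c) (hw : 0 < w)
    (hcs : s ^ 2 + c ^ 2 = 1) (hwh : w ^ 2 = 1 - h ^ 2) :
    c ^ (m + 1) * (√(1 - (-(s * h) / (c * w)) ^ 2) ^ m / (c * w)) =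
      √(w ^ 2 - s ^ 2) ^ m / w ^ (m + 1) := by
  have h1 : c * √(1 - (-(s * h) / (c * w)) ^ 2) = √(w ^ 2 - s ^ 2) / w := by
    have e : 1 - (-(s * h) / (c * w)) ^ 2 = (w ^ 2 - s ^ 2) / (c * w) ^ 2 := by
      field_simp
      have : h ^ 2 = 1 - w ^ 2 := by linarith
      rw [this, show c ^ 2 = 1 - s ^ 2 by linarith]
      ring
    rw [e, Real.sqrt_div' _ (by positivity), Real.sqrt_sq (by positivity)]
    field_simp
  calc _ = (c * √(1 - (-(s * h) / (c * w)) ^ 2)) ^ m / w := by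
        rw [mul_pow]; field_simp; ring
    _ = _ := by rw [h1, div_pow]; field_simp; ring

/-- The Radon transform of the uniform measure on the latitude `α` of the sphere `S^{d+1}`,
as a function of `θ`. -/
theorem integral_latitude_sphericalRadon (hd : 3 ≤ d) {g : USphere (d + 2) → ℝ}
    (hg : Continuous g) {α : ℝ} (hα : α ∈ Ioo (-(Real.pi / 2)) (Real.pi / 2)) :
    Real.cos α ^ (d - 1) * ∫ η, sphericalRadon g (latitude α η) ∂(surfaceMeasure (d + 1)) =
      sphereArea d * ∫ θ, g θ * (√(width θ ^ 2 - Real.sin α ^ 2) ^ (d - 2) / width θ ^ (d - 1))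
        ∂(surfaceMeasure (d + 2)) := by
  obtain ⟨C, hC⟩ := isCompact_univ.exists_bound_of_continuousOn hg.continuousOn
  have hC' : ∀ θ, |g θ| ≤ C := fun θ => hC θ (mem_univ _)
  have hC0 : 0 ≤ C := (abs_nonneg _).trans (hC' ⟨pole _, mem_sphere_zero_iff_norm.2 (norm_pole _)⟩)
  have hc := Real.cos_pos_of_mem_Ioo hα
  have hbm : ∀ j, Measurable fun p : USphere (d + 1) × USphere (d + 2) =>
      g p.2 * band j (inner ℝ (p.2 : Euc (d + 2)) (latitude α p.1 : Euc (d + 2))) := fun j => by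
    have := (continuous_latitude_right (m := d + 1) α)
    refine Measurable.mul (hg.measurable.comp measurable_snd) ((measurable_band j).comp ?_)
    fun_prop
  have hbd : ∀ j (η : USphere (d + 1)) (θ : USphere (d + 2)),
      ‖g θ * band j (inner ℝ (θ : Euc (d + 2)) (latitude α η : Euc (d + 2)))‖ ≤
        C * (j + 1) := fun j η θ => by
    rw [norm_mul]
    exact mul_le_mul (hC' θ) (abs_band_le _ _) (norm_nonneg _) hC0
  have lim1 : Tendsto (fun j : ℕ => ∫ η, ∫ θ,
      g θ * band j (inner ℝ (θ : Euc (d + 2)) (latitude α η : Euc (d + 2)))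
        ∂(surfaceMeasure (d + 2)) ∂(surfaceMeasure (d + 1))) atTop
      (𝓝 (∫ η, sphericalRadon g (latitude α η) ∂(surfaceMeasure (d + 1)))) := by
    refine tendsto_integral_of_dominated_convergence (fun _ => C * sphereArea (d + 1))
      (fun j => ?_) (integrable_const _) (fun j => .of_forall fun η => ?_)
      (.of_forall fun η => tendsto_integral_band_sphericalRadon (by omega) hg _)
    · exact (StronglyMeasurable.integral_prod_right' (hbm j).stronglyMeasurable).aestronglyMeasurable
    · refine (norm_integral_le_of_norm_le (μ := surfaceMeasure (d + 2))
        (f := fun θ => g θ * band j (inner ℝ (θ : Euc (d + 2)) (latitude α η : Euc (d + 2))))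
        (g := fun θ : USphere (d + 2) =>
        C * band j (inner ℝ (θ : Euc (d + 2)) (latitude α η : Euc (d + 2)))) ?_
        (.of_forall fun θ => ?_)).trans ?_
      · refine Integrable.const_mul (Integrable.of_bound (C := (j : ℝ) + 1) ?_
          (.of_forall fun θ => abs_band_le _ _)) _
        exact ((measurable_band j).comp (by fun_prop)).aestronglyMeasurable
      · rw [norm_mul, Real.norm_of_nonneg (band_nonneg _ _)]
        exact mul_le_mul_of_nonneg_right (hC' θ) (band_nonneg _ _)
      · rw [integral_const_mul]
        exact mul_le_mul_of_nonneg_left (integral_band_inner_le (by omega) j _) hC0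
  have swap : ∀ j : ℕ, ∫ η, ∫ θ,
      g θ * band j (inner ℝ (θ : Euc (d + 2)) (latitude α η : Euc (d + 2)))
        ∂(surfaceMeasure (d + 2)) ∂(surfaceMeasure (d + 1)) =
      ∫ θ, g θ * (sphereArea d * ∫ u, band j
        (Real.cos α * width θ * u + Real.sin α * height θ) * √(1 - u ^ 2) ^ (d - 2))
        ∂(surfaceMeasure (d + 2)) := fun j => by
    rw [integral_integral_swap]
    · refine integral_congr_ae (.of_forall fun θ => ?_)
      simp only
      rw [integral_const_mul, integral_band_latitude hd j α hc.le]
    · exact Integrable.of_bound (hbm j).aestronglyMeasurable _ (.of_forall fun p => hbd j p.1 p.2)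
  have hw1 : ∀ u : ℝ, |√(1 - u ^ 2) ^ (d - 2)| ≤ 1 := fun u => by
    rw [abs_of_nonneg (by positivity)]
    exact pow_le_one₀ (by positivity) (Real.sqrt_le_one.2 (by nlinarith [sq_nonneg u]))
  have lim2 : Tendsto (fun j : ℕ => ∫ θ, g θ * (sphereArea d * ∫ u, band j
        (Real.cos α * width θ * u + Real.sin α * height θ) * √(1 - u ^ 2) ^ (d - 2))
        ∂(surfaceMeasure (d + 2))) atTop (𝓝 (∫ θ, g θ * (sphereArea d *
          (√(1 - (-(Real.sin α * height θ) / (Real.cos α * width θ)) ^ 2) ^ (d - 2) /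
            (Real.cos α * width θ))) ∂(surfaceMeasure (d + 2)))) := by
    refine tendsto_integral_of_dominated_convergence
      (fun θ => C * (sphereArea d * ((Real.cos α)⁻¹ * (width θ)⁻¹)))
      (fun j => ?_) ?_ (fun j => ?_) ?_
    · refine (hg.measurable.mul (measurable_const.mul ?_)).aestronglyMeasurable
      refine (StronglyMeasurable.integral_prod_right' (f := fun p : USphere (d + 2) × ℝ =>
        band j (Real.cos α * width p.1 * p.2 + Real.sin α * height p.1) *
          √(1 - p.2 ^ 2) ^ (d - 2)) (Measurable.stronglyMeasurable
          (Measurable.mul ((measurable_band j).comp ?_) (by fun_prop)))).measurable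
      have h1 := (continuous_width (m := d + 1)).measurable
      have h2 := (continuous_height (m := d + 1)).measurable
      fun_prop
    · exact (((integrable_inv_width (by omega)).const_mul _).const_mul _).const_mul _
    · filter_upwards [ae_width_pos (d := d)] with θ hθ
      rw [norm_mul, norm_mul, Real.norm_of_nonneg (sphereArea_pos (by omega : 0 < d)).le]
      refine mul_le_mul (hC' θ) (mul_le_mul_of_nonneg_left ?_
        (sphereArea_pos (by omega : 0 < d)).le) (by
          have := (sphereArea_pos (by omega : 0 < d)).le
          positivity) hC0
      refine (abs_integral_band_le j (mul_pos hc hθ) _ hw1).trans_eq ?_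
      rw [one_div, mul_inv]
    · filter_upwards [ae_width_pos (d := d)] with θ hθ
      refine Tendsto.const_mul _ (Tendsto.const_mul _ ?_)
      exact tendsto_integral_band (mul_pos hc hθ) _
        (F := fun u => √(1 - u ^ 2) ^ (d - 2)) (by fun_prop) hw1
  simp_rw [swap] at lim1
  rw [tendsto_nhds_unique lim1 lim2, ← integral_const_mul, ← integral_const_mul]
  refine integral_congr_ae ?_
  filter_upwards [ae_width_pos (d := d)] with θ hθ
  obtain ⟨m, rfl⟩ : ∃ m, d = m + 2 := ⟨d - 2, by omega⟩
  have := latitude_kernel_identity m hc hθ (Real.sin_sq_add_cos_sq α) (width_sq θ)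
  simp only [show m + 2 - 2 = m from rfl, show m + 2 - 1 = m + 1 from rfl]
  rw [← this]
  ring

end Duality

/-! ### Duality between the Radon transform and zonal measures -/

section Adjoint

variable {d : ℕ}

theorem sqrt_sub_sq_pow_div_le {w : ℝ} (hw : 0 ≤ w) (hd : 2 ≤ d) (t : ℝ) :
    √(w ^ 2 - t ^ 2) ^ (d - 2) / w ^ (d - 1) ≤ w⁻¹ := by
  obtain ⟨m, rfl⟩ : ∃ m, d = m + 2 := ⟨d - 2, by omega⟩
  simp only [show m + 2 - 2 = m from rfl, show m + 2 - 1 = m + 1 from rfl]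
  rcases hw.eq_or_lt with rfl | hw
  · simp
  · have h : √(w ^ 2 - t ^ 2) ≤ w := Real.sqrt_le_iff.2 ⟨hw.le, by linarith [sq_nonneg t]⟩
    rw [div_le_iff₀ (by positivity), pow_succ' w m, ← mul_assoc, inv_mul_cancel₀ hw.ne', one_mul]
    exact pow_le_pow_left₀ (Real.sqrt_nonneg _) h _

/-- The Radon transform of a zonal function as an integral over the heights `t`. -/
theorem sphericalRadon_zonal_eq_setIntegral (hd : 3 ≤ d) {H : ℝ → ℝ} (hH : Measurable H) {D : ℝ}
    (hD : ∀ t, |H t| ≤ D) {θ : USphere (d + 2)} (hθ : 0 < width θ) :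
    sphericalRadon (fun ζ => H (height ζ)) θ = sphereArea d * ∫ t in Ioo (-1 : ℝ) 1,
      √(width θ ^ 2 - t ^ 2) ^ (d - 2) / width θ ^ (d - 1) * H t := by
  obtain ⟨m, rfl⟩ : ∃ m, d = m + 2 := ⟨d - 2, by omega⟩
  have hm : m ≠ 0 := by omega
  rw [sphericalRadon_zonal (by omega) θ hH hD]
  change _ * ∫ α, H (width θ * Real.sin α) ∂(cosPowMeasure (m + 1)) = _
  rw [integral_cosPowMeasure_succ m fun u => H (width θ * u),
    setIntegral_Ioo_sqrt_one_sub_sq_pow hm]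
  congr 1
  simp only [show m + 2 - 2 = m from rfl, show m + 2 - 1 = m + 1 from rfl]
  set w := width θ with hw
  rw [setIntegral_eq_integral_of_forall_compl_eq_zero fun t ht => ?_]
  · have h := Measure.integral_comp_mul_left
      (fun t => √(w ^ 2 - t ^ 2) ^ m / w ^ (m + 1) * H t) w
    rw [abs_of_pos (inv_pos.2 hθ), smul_eq_mul, ← div_eq_inv_mul, eq_div_iff hθ.ne'] at h
    rw [← h, ← integral_mul_const]
    refine integral_congr_ae (.of_forall fun u => ?_)
    have e : √(w ^ 2 - (w * u) ^ 2) = w * √(1 - u ^ 2) := by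
      rw [← Real.sqrt_sq hθ.le, ← Real.sqrt_mul (sq_nonneg _), Real.sq_sqrt (sq_nonneg _)]
      congr 1
      rw [Real.sqrt_sq hθ.le]
      ring
    simp only [e, mul_pow w (√(1 - u ^ 2))]
    field_simp
    ring
  · have h1 : 1 ≤ t ^ 2 := by
      rw [one_le_sq_iff_one_le_abs]
      by_contra h
      exact ht (abs_lt.1 (not_le.1 h))
    have h2 : w ^ 2 - t ^ 2 ≤ 0 := by
      have := width_le_one θ
      nlinarith
    rw [Real.sqrt_eq_zero_of_nonpos h2, zero_pow hm, zero_div, zero_mul]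

/-- The Radon transform is self-adjoint against zonal functions. No continuity of the zonal function
is needed, since Fubini is applied to the parallels of its argument. -/
theorem integral_sphericalRadon_mul_zonal (hd : 3 ≤ d) {g : USphere (d + 2) → ℝ}
    (hg : Continuous g) {H : ℝ → ℝ} (hH : Measurable H) {D : ℝ} (hD : ∀ t, |H t| ≤ D) :
    ∫ θ, sphericalRadon g θ * H (height θ) ∂(surfaceMeasure (d + 2)) =
      ∫ θ, g θ * sphericalRadon (fun ζ => H (height ζ)) θ ∂(surfaceMeasure (d + 2)) := by
  obtain ⟨C, hC⟩ := isCompact_univ.exists_bound_of_continuousOn hg.continuousOn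
  have hC' : ∀ θ, |g θ| ≤ C := fun θ => hC θ (mem_univ _)
  have hC0 : 0 ≤ C := (abs_nonneg _).trans (hC' ⟨pole _, mem_sphere_zero_iff_norm.2 (norm_pole _)⟩)
  have hRm := measurable_sphericalRadon (by omega) hg
  have hHm : Measurable fun θ : USphere (d + 2) => H (height θ) :=
    hH.comp continuous_height.measurable
  rw [integral_surfaceMeasure_succ (Nat.succ_pos _), integral_cosPowMeasure]
  swap
  · refine Integrable.of_bound (hRm.mul hHm).aestronglyMeasurable
      (C * (sphereArea d * ∫ _, 1 ∂(cosPowMeasure (d - 1))) * D) (.of_forall fun θ => ?_)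
    rw [norm_mul]
    have := abs_sphericalRadon_le (by omega) hC' θ
    exact mul_le_mul this (hD _) (norm_nonneg _) ((abs_nonneg _).trans this)
  let k : USphere (d + 2) → ℝ → ℝ := fun θ t =>
    √(width θ ^ 2 - t ^ 2) ^ (d - 2) / width θ ^ (d - 1)
  have h1 : ∀ α ∈ Ioo (-(Real.pi / 2)) (Real.pi / 2), Real.cos α ^ (d + 1 - 1) *
      ∫ η, sphericalRadon g (latitude α η) * H (height (latitude α η)) ∂(surfaceMeasure (d + 1)) =
      Real.cos α ^ 1 * (H (Real.sin α) * (sphereArea d *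
        ∫ θ, g θ * k θ (Real.sin α) ∂(surfaceMeasure (d + 2)))) := by
    intro α hα
    rw [← integral_latitude_sphericalRadon hd hg hα]
    simp only [height_latitude]
    rw [integral_mul_const]
    obtain ⟨m, rfl⟩ : ∃ m, d = m + 1 := ⟨d - 1, by omega⟩
    simp only [Nat.add_sub_cancel]
    ring
  rw [setIntegral_congr_fun measurableSet_Ioo h1, ← integral_cosPowMeasure 1 fun α =>
    H (Real.sin α) * (sphereArea d * ∫ θ, g θ * k θ (Real.sin α) ∂(surfaceMeasure (d + 2))),
    integral_cosPowMeasure_succ 0 fun t => H t * (sphereArea d *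
      ∫ θ, g θ * k θ t ∂(surfaceMeasure (d + 2)))]
  simp only [pow_zero, one_mul]
  have h2 : ∀ t, H t * (sphereArea d * ∫ θ, g θ * k θ t ∂(surfaceMeasure (d + 2))) =
      ∫ θ, sphereArea d * (g θ * (k θ t * H t)) ∂(surfaceMeasure (d + 2)) := fun t => by
    rw [integral_const_mul, mul_left_comm]
    congr 1
    rw [← integral_const_mul]
    refine integral_congr_ae (.of_forall fun θ => ?_)
    simp only
    ring
  simp_rw [h2]
  have hkm : Measurable fun p : ℝ × USphere (d + 2) => k p.2 p.1 := by
    have h1 := (continuous_width (m := d + 1)).measurable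
    simp only [k]
    fun_prop
  rw [integral_integral_swap]
  · refine integral_congr_ae ?_
    filter_upwards [ae_width_pos (d := d)] with θ hθ
    rw [sphericalRadon_zonal_eq_setIntegral hd hH hD hθ, integral_const_mul, integral_const_mul]
    ring
  · have hb : Integrable (fun p : ℝ × USphere (d + 2) => sphereArea d * (C * D) * (width p.2)⁻¹)
        ((volume.restrict (Ioo (-1 : ℝ) 1)).prod (surfaceMeasure (d + 2))) :=
      ((integrable_inv_width (by omega)).comp_snd _).const_mul _
    refine hb.mono' ?_ (.of_forall fun p => ?_)
    · refine (Measurable.const_mul (Measurable.mul (hg.measurable.comp measurable_snd)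
        (hkm.mul (hH.comp measurable_fst))) _).aestronglyMeasurable
    · have hs := (sphereArea_pos (by omega : 0 < d)).le
      have hk0 : 0 ≤ k p.2 p.1 := div_nonneg (by positivity) (pow_nonneg (width_nonneg _) _)
      simp only [Function.uncurry]
      rw [norm_mul, norm_mul, norm_mul, Real.norm_of_nonneg hs, Real.norm_of_nonneg hk0, mul_assoc]
      refine mul_le_mul_of_nonneg_left ?_ hs
      rw [mul_assoc]
      refine mul_le_mul (hC' _) ?_ (by positivity) hC0
      rw [mul_comm D]
      exact mul_le_mul (sqrt_sub_sq_pow_div_le (width_nonneg _) (by omega) _) (hD _) (norm_nonneg _)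
        (inv_nonneg.2 (width_nonneg _))

/-- The Radon transform of the Dirac measure on two opposite parallels is a zonal function. -/
theorem integral_latitudeDirac (hd : 3 ≤ d) {g : USphere (d + 2) → ℝ} (hg : Continuous g)
    {α : ℝ} (hα : α ∈ Ioo (-(Real.pi / 2)) (Real.pi / 2)) {t : ℝ} (ht : |t| ≤ 1)
    (hαt : Real.sin α = t) :
    ∫ θ, sphericalRadon g θ ∂(latitudeDirac (d + 1) t ht) =
      ∫ θ, g θ * (2 * sphereArea d * (√(width θ ^ 2 - t ^ 2) ^ (d - 2) / width θ ^ (d - 1)))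
        ∂(surfaceMeasure (d + 2)) := by
  have hRm := measurable_sphericalRadon (by omega) hg
  obtain ⟨C, hC⟩ := isCompact_univ.exists_bound_of_continuousOn hg.continuousOn
  have hRb : ∀ θ, ‖sphericalRadon g θ‖ ≤ _ := fun θ =>
    abs_sphericalRadon_le (by omega) (fun θ => hC θ (mem_univ _)) θ
  have hc := Real.cos_pos_of_mem_Ioo hα
  have hα' : -α ∈ Ioo (-(Real.pi / 2)) (Real.pi / 2) := ⟨by linarith [hα.2], by linarith [hα.1]⟩
  have hcont : ∀ (β s : ℝ) (hs : |s| ≤ 1), β ∈ Ioo (-(Real.pi / 2)) (Real.pi / 2) →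
      Real.sin β = s → Measurable (latitudePoint (m := d + 1) s hs) := by
    intro β s hs hβ h
    have e : latitudePoint (m := d + 1) s hs = fun η => latitude β η :=
      funext fun η => (latitude_eq_latitudePoint (Ioo_subset_Icc_self hβ) hs h η).symm
    rw [e]
    exact (continuous_latitude_right β).measurable
  have hpart : ∀ (β s : ℝ) (hs : |s| ≤ 1), β ∈ Ioo (-(Real.pi / 2)) (Real.pi / 2) →
      Real.sin β = s → ∫ θ, sphericalRadon g θ
        ∂((surfaceMeasure (d + 1)).map (latitudePoint s hs)) =
      ∫ η, sphericalRadon g (latitude β η) ∂(surfaceMeasure (d + 1)) := by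
    intro β s hs hβ h
    rw [integral_map (hcont β s hs hβ h).aemeasurable hRm.aestronglyMeasurable]
    simp only [latitude_eq_latitudePoint (Ioo_subset_Icc_self hβ) hs h]
  have hint : ∀ μ : Measure (USphere (d + 2)), IsFiniteMeasure μ →
      Integrable (sphericalRadon g) μ := fun μ _ =>
    Integrable.of_bound hRm.aestronglyMeasurable _ (.of_forall hRb)
  have hpow : (1 - t ^ 2) ^ ((((d + 1 : ℕ) : ℝ) - 2) / 2) = Real.cos α ^ (d - 1) := by
    have : 1 - t ^ 2 = Real.cos α ^ 2 := by
      rw [← hαt]; linarith [Real.sin_sq_add_cos_sq α]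
    rw [this, ← Real.rpow_natCast, ← Real.rpow_natCast, ← Real.rpow_mul hc.le]
    congr 1
    push_cast [Nat.cast_sub (by omega : 1 ≤ d)]
    ring
  rw [latitudeDirac, integral_smul_measure, integral_add_measure (hint _ inferInstance)
    (hint _ inferInstance), hpart α t ht hα hαt, hpart (-α) (-t) _ hα' (by rw [Real.sin_neg, hαt]),
    hpow, ENNReal.toReal_ofReal (by positivity), smul_eq_mul, mul_add,
    integral_latitude_sphericalRadon hd hg hα]
  have h2 := integral_latitude_sphericalRadon hd hg hα'
  rw [Real.cos_neg] at h2
  rw [h2, Real.sin_neg, hαt, neg_sq, ← two_mul, ← mul_assoc, ← integral_const_mul]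
  refine integral_congr_ae (.of_forall fun θ => ?_)
  simp only
  ring

end Adjoint

/-! ### Star bodies -/

section StarBodies

variable {n : ℕ}

theorem norm_coe_uSphere (θ : USphere n) : ‖(θ : Euc n)‖ = 1 := mem_sphere_zero_iff_norm.1 θ.2

/-- The set with radial function `ρ`. -/
def starRegion (ρ : USphere n → ℝ) : Set (Euc n) :=
  (fun p : ℝ × USphere n => p.1 • (p.2 : Euc n)) '' {p | 0 ≤ p.1 ∧ p.1 ≤ ρ p.2}

theorem smul_mem_starRegion {ρ : USphere n → ℝ} {a : ℝ} (ha : 0 < a) (θ : USphere n) :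
    a • (θ : Euc n) ∈ starRegion ρ ↔ a ≤ ρ θ := by
  constructor
  · rintro ⟨⟨r, η⟩, ⟨hr, hrρ⟩, h⟩
    simp only at h hr hrρ
    have h1 : r = a := by
      have := congrArg norm h
      rwa [norm_smul, norm_smul, norm_coe_uSphere, norm_coe_uSphere, mul_one, mul_one,
        Real.norm_of_nonneg hr, Real.norm_of_nonneg ha.le] at this
    subst h1
    have h2 : η = θ := Subtype.ext (smul_right_injective (Euc n) ha.ne' h)
    exact h2 ▸ hrρ
  · intro h
    exact ⟨(a, θ), ⟨ha.le, h⟩, rfl⟩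

theorem radialFn_starRegion {ρ : USphere n → ℝ} (hρ : ∀ θ, 0 < ρ θ) (θ : USphere n) :
    radialFn (starRegion ρ) θ = ρ θ := by
  refine IsGreatest.csSup_eq ⟨(smul_mem_starRegion (hρ θ) θ).2 le_rfl, fun a ha => ?_⟩
  rcases le_or_gt a 0 with h | h
  · exact h.trans (hρ θ).le
  · exact (smul_mem_starRegion h θ).1 ha

theorem exists_smul_uSphere {x : Euc n} (hx : x ≠ 0) :
    ∃ θ : USphere n, x = ‖x‖ • (θ : Euc n) := by
  refine ⟨⟨‖x‖⁻¹ • x, mem_sphere_zero_iff_norm.2 (norm_smul_inv_norm (𝕜 := ℝ) hx)⟩, ?_⟩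
  rw [smul_smul, mul_inv_cancel₀ (norm_ne_zero_iff.2 hx), one_smul]

theorem isStarBody_starRegion (hn : 0 < n) {ρ : USphere n → ℝ} (hc : Continuous ρ)
    (hρ : ∀ θ, 0 < ρ θ) (heven : ∀ θ, ρ (-θ) = ρ θ) : IsStarBody (starRegion ρ) := by
  have : Nonempty (Fin n) := ⟨⟨0, hn⟩⟩
  have hne : Nonempty (USphere n) := (NormedSpace.sphere_nonempty.2 zero_le_one).to_subtype
  refine ⟨?_, ?_, ?_, ?_, ?_⟩
  · obtain ⟨M, hM⟩ := isCompact_univ.exists_bound_of_continuousOn hc.continuousOn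
    have hK : IsCompact {p : ℝ × USphere n | 0 ≤ p.1 ∧ p.1 ≤ ρ p.2} := by
      refine (isCompact_Icc (a := (0 : ℝ)) (b := M)).prod isCompact_univ |>.of_isClosed_subset ?_ ?_
      · exact (isClosed_le continuous_const continuous_fst).inter
          (isClosed_le continuous_fst (hc.comp continuous_snd))
      · exact fun p hp => ⟨⟨hp.1, hp.2.trans ((le_abs_self _).trans (hM p.2 (mem_univ _)))⟩,
          mem_univ _⟩
    exact hK.image (by fun_prop)
  · have h : ∀ x ∈ starRegion ρ, -x ∈ starRegion ρ := by
      rintro _ ⟨⟨r, η⟩, ⟨hr, hrρ⟩, rfl⟩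
      exact ⟨(r, -η), ⟨hr, (heven η).symm ▸ hrρ⟩, by simp⟩
    ext x
    rw [Set.mem_neg]
    exact ⟨fun hx => neg_neg x ▸ h _ hx, h x⟩
  · rw [starConvex_zero_iff]
    rintro _ ⟨⟨r, η⟩, ⟨hr, hrρ⟩, rfl⟩ a ha ha1
    simp only at hr hrρ
    exact ⟨(a * r, η), ⟨mul_nonneg ha hr, (mul_le_of_le_one_left hr ha1).trans hrρ⟩,
      (smul_smul _ _ _).symm⟩
  · obtain ⟨θ₀, -, hmin⟩ := isCompact_univ.exists_isMinOn univ_nonempty hc.continuousOn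
    rw [mem_interior]
    refine ⟨Metric.ball 0 (ρ θ₀), fun x hx => ?_, Metric.isOpen_ball,
      Metric.mem_ball_self (hρ θ₀)⟩
    rcases eq_or_ne x 0 with rfl | h0
    · exact ⟨(0, θ₀), ⟨le_rfl, (hρ _).le⟩, zero_smul _ _⟩
    · obtain ⟨θ, hθ⟩ := exists_smul_uSphere h0
      rw [mem_ball_zero_iff] at hx
      exact ⟨(‖x‖, θ), ⟨norm_nonneg _, hx.le.trans (hmin (mem_univ θ))⟩, hθ.symm⟩
  · rwa [funext (radialFn_starRegion hρ)]

theorem IsStarBody.smul_mem_iff {K : Set (Euc n)} (hK : IsStarBody K) (θ : USphere n) {a : ℝ}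
    (ha : 0 < a) : a • (θ : Euc n) ∈ K ↔ a ≤ radialFn K θ := by
  have hb : BddAbove {a : ℝ | a • (θ : Euc n) ∈ K} := by
    obtain ⟨M, hM⟩ := hK.isCompact.isBounded.exists_norm_le
    refine ⟨M, fun b hb => ?_⟩
    have := hM _ hb
    rw [norm_smul, norm_coe_uSphere, mul_one] at this
    exact (le_abs_self _).trans this
  have hcl : IsClosed {a : ℝ | a • (θ : Euc n) ∈ K} :=
    hK.isCompact.isClosed.preimage (by fun_prop)
  have h0 : (0 : Euc n) ∈ K := interior_subset hK.zero_mem_interior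
  have hne : {a : ℝ | a • (θ : Euc n) ∈ K}.Nonempty := ⟨0, by simpa using h0⟩
  constructor
  · exact fun h => le_csSup hb h
  · intro h
    have hmem : radialFn K θ • (θ : Euc n) ∈ K := hcl.csSup_mem hne hb
    have hr : 0 < radialFn K θ := ha.trans_le h
    have := (starConvex_zero_iff.1 hK.starConvex) hmem (a := a / radialFn K θ) (by positivity)
      ((div_le_one hr).2 h)
    rwa [smul_smul, div_mul_cancel₀ _ hr.ne'] at this

theorem IsStarBody.radialFn_nonneg {K : Set (Euc n)} (hK : IsStarBody K) (θ : USphere n) :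
    0 ≤ radialFn K θ := by
  obtain ⟨ε, hε, h⟩ := Metric.mem_nhds_iff.1 (mem_interior_iff_mem_nhds.1 hK.zero_mem_interior)
  have : (ε / 2) • (θ : Euc n) ∈ K := h (by
    rw [mem_ball_zero_iff, norm_smul, norm_coe_uSphere, Real.norm_of_nonneg (by positivity)]
    linarith)
  exact (by positivity : 0 ≤ ε / 2).trans ((hK.smul_mem_iff θ (by positivity)).1 this)

end StarBodies

/-! ### Volumes of central sections -/

section Volume

/-- The volume of a set in polar coordinates. -/
theorem volume_real_eq_integral_sphere {W : Type*} [NormedAddCommGroup W] [InnerProductSpace ℝ W]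
    [FiniteDimensional ℝ W] [MeasurableSpace W] [BorelSpace W] {d : ℕ}
    (hd : Module.finrank ℝ W = d + 1) {A : Set W} (hA : MeasurableSet A)
    {ρ : Metric.sphere (0 : W) 1 → ℝ} (hρ : Continuous ρ) (hρ0 : ∀ θ, 0 ≤ ρ θ)
    (h : ∀ (θ : Metric.sphere (0 : W) 1) (r : ℝ), 0 < r → (r • (θ : W) ∈ A ↔ r ≤ ρ θ)) :
    (volume : Measure W).real A =
      ∫ θ, 1 / (d + 1) * ρ θ ^ (d + 1) ∂(volume : Measure W).toSphere := by
  have : Nontrivial W := Module.nontrivial_of_finrank_pos (R := ℝ) (hd ▸ Nat.succ_pos _)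
  rw [measureReal_def, ← lintegral_indicator_one hA,
    lintegral_eq_lintegral_sphere_lintegral_Ioi (measurable_one.indicator hA), hd,
    integral_eq_lintegral_of_nonneg_ae (.of_forall fun θ => by
      have := hρ0 θ
      simp only [Pi.zero_apply]
      positivity) (by fun_prop)]
  congr 1
  refine lintegral_congr fun θ => ?_
  have h1 : ∀ r ∈ Ioi (0 : ℝ), ENNReal.ofReal (r ^ (d + 1 - 1)) * A.indicator 1 (r • (θ : W)) =
      (Iic (ρ θ)).indicator (fun r => ENNReal.ofReal (r ^ d)) r := by
    intro r hr
    by_cases hrρ : r ≤ ρ θ <;> simp [indicator, h θ r hr, hrρ]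
  rw [setLIntegral_congr_fun measurableSet_Ioi h1, setLIntegral_indicator measurableSet_Iic,
    Iic_inter_Ioi, ← ofReal_integral_eq_lintegral_ofReal
      (intervalIntegral.intervalIntegrable_pow _).1
      ((ae_restrict_mem measurableSet_Ioc).mono fun r hr => pow_nonneg hr.1.le _),
    ← intervalIntegral.integral_of_le (hρ0 θ), integral_pow]
  simp
  congr 1
  ring

/-- The volume of a central section of `L` is the Radon transform of `ρ_L^{n-1} / (n - 1)`. -/
theorem IsStarBody.volume_section {d : ℕ} {L : Set (Euc (d + 2))} (hL : IsStarBody L)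
    (ξ : USphere (d + 2)) :
    (volume : Measure (perpHyperplane (ξ : Euc (d + 2)))).real
      {x : perpHyperplane (ξ : Euc (d + 2)) | (x : Euc (d + 2)) ∈ L} =
    sphericalRadon (fun θ => 1 / (d + 1) * radialFn L θ ^ (d + 1)) ξ := by
  refine volume_real_eq_integral_sphere (finrank_perpHyperplane ξ) ?_
    (ρ := fun θ => radialFn L (perpSphereIncl (ξ : Euc (d + 2)) θ)) ?_
    (fun θ => hL.radialFn_nonneg _) fun θ r hr => ?_
  · exact (hL.isCompact.isClosed.preimage continuous_subtype_val).measurableSet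
  · refine hL.continuous_radialFn.comp (Continuous.subtype_mk ?_ _)
    fun_prop
  · exact hL.smul_mem_iff (perpSphereIncl (ξ : Euc (d + 2)) θ) hr

end Volume

/-! ### The gauge and the radial function of the barrel -/

section Barrel

variable {m : ℕ}

theorem horizontal_equatorIncl_add (η : Euc m) (z : ℝ) :
    horizontal (equatorIncl m η + z • pole m) = η := by
  ext i
  simp [horizontal, equatorIncl_castSucc, pole]

theorem last_equatorIncl_add (η : Euc m) (z : ℝ) :
    (equatorIncl m η + z • pole m) (Fin.last m) = z := by
  simp [equatorIncl_last, pole]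

theorem inner_equatorIncl_add (η : Euc m) (z : ℝ) (y : Euc (m + 1)) :
    inner ℝ (equatorIncl m η + z • pole m) y =
      inner ℝ η (horizontal y) + z * y (Fin.last m) := by
  rw [inner_add_left, inner_equatorIncl, inner_smul_left, real_inner_comm y, inner_pole]
  simp

theorem mem_barrel_iff (x : Euc (m + 1)) : x ∈ barrel (m + 1) ↔
    ∃ c : Euc m, ‖c‖ ≤ 1 ∧ ‖x - equatorIncl m c‖ ≤ 1 := by
  constructor
  · rintro ⟨b, hb, c, ⟨hc, hc0⟩, rfl⟩
    rw [mem_closedBall_zero_iff] at hb hc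
    have h0 : c (Fin.last m) = 0 := hc0 (Fin.last m) rfl
    have h1 : equatorIncl m (horizontal c) = c := by
      have := equatorIncl_horizontal c
      rwa [h0, zero_smul, add_zero] at this
    refine ⟨horizontal c, ?_, ?_⟩
    · rwa [← (equatorIncl m).norm_map, h1]
    · simpa [h1] using hb
  · rintro ⟨c, hc, hb⟩
    refine ⟨_, mem_closedBall_zero_iff.2 hb, equatorIncl m c, ⟨?_, fun i hi => ?_⟩, by simp⟩
    · rwa [mem_closedBall_zero_iff, (equatorIncl m).norm_map]
    · have : i = Fin.last m := Fin.ext (by simpa using hi)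
      rw [this, equatorIncl_last]

theorem zero_mem_barrel : (0 : Euc (m + 1)) ∈ barrel (m + 1) :=
  (mem_barrel_iff _).2 ⟨0, by simp, by simp⟩

theorem smul_mem_barrel {x : Euc (m + 1)} (hx : x ∈ barrel (m + 1)) {a : ℝ} (h0 : 0 ≤ a)
    (h1 : a ≤ 1) : a • x ∈ barrel (m + 1) := by
  obtain ⟨c, hc, hb⟩ := (mem_barrel_iff _).1 hx
  refine (mem_barrel_iff _).2 ⟨a • c, ?_, ?_⟩
  · rw [norm_smul, Real.norm_of_nonneg h0]
    exact mul_le_one₀ h1 (norm_nonneg _) hc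
  · rw [map_smul, ← smul_sub, norm_smul, Real.norm_of_nonneg h0]
    exact mul_le_one₀ h1 (norm_nonneg _) hb

/-- The support function of the barrel is `‖y‖ + ‖y'‖`. -/
theorem inner_le_of_mem_barrel {x : Euc (m + 1)} (hx : x ∈ barrel (m + 1)) (y : Euc (m + 1)) :
    inner ℝ x y ≤ ‖y‖ + ‖horizontal y‖ := by
  obtain ⟨c, hc, hb⟩ := (mem_barrel_iff _).1 hx
  have h : inner ℝ x y = inner ℝ (x - equatorIncl m c) y + inner ℝ c (horizontal y) := by
    rw [inner_sub_left, inner_equatorIncl]; ring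
  rw [h]
  refine add_le_add ((real_inner_le_norm _ _).trans ?_) ((real_inner_le_norm _ _).trans ?_)
  · exact mul_le_of_le_one_left (norm_nonneg _) hb
  · exact mul_le_of_le_one_left (norm_nonneg _) hc

/-- The gauge of the barrel at `(η, z)`, for a unit vector `η` of the equatorial hyperplane. -/
noncomputable def barrelGauge (z : ℝ) : ℝ := if |z| < 1 then (1 + z ^ 2) / 2 else |z|

theorem barrelGauge_pos (z : ℝ) : 0 < barrelGauge z := by
  unfold barrelGauge
  split_ifs with h
  · positivity
  · exact one_pos.trans_le (not_lt.1 h)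

/-- For `|z| ≥ 1` the ray through `(η, z)` leaves the barrel through the flat top, otherwise through
the unit half-circle centred at `η`. -/
theorem inv_barrelGauge_smul_mem_barrel (η : USphere m) (z : ℝ) :
    (barrelGauge z)⁻¹ • (equatorIncl m η + z • pole m) ∈ barrel (m + 1) := by
  have hη := norm_coe_uSphere η
  rw [mem_barrel_iff, barrelGauge]
  split_ifs with h
  · refine ⟨η, hη.le, ?_⟩
    have e : ((1 + z ^ 2) / 2)⁻¹ • (equatorIncl m η + z • pole m) - equatorIncl m η =
        equatorIncl m (((1 - z ^ 2) / (1 + z ^ 2)) • (η : Euc m)) +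
          (2 * z / (1 + z ^ 2)) • pole m := by
      have h0 : (1 + z ^ 2) ≠ 0 := by positivity
      have e1 : (1 - z ^ 2) / (1 + z ^ 2) = ((1 + z ^ 2) / 2)⁻¹ - 1 := by field_simp; ring
      have e2 : 2 * z / (1 + z ^ 2) = ((1 + z ^ 2) / 2)⁻¹ * z := by field_simp
      rw [map_smul, smul_add, smul_smul, e1, e2, sub_smul, one_smul]
      abel
    rw [e, ← sq_le_one_iff₀ (norm_nonneg _), norm_sq_eq_horizontal, horizontal_equatorIncl_add,
      last_equatorIncl_add, norm_smul, hη, mul_one, Real.norm_eq_abs, sq_abs]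
    refine le_of_eq ?_
    field_simp
    ring
  · have hz : 0 < |z| := one_pos.trans_le (not_lt.1 h)
    refine ⟨|z|⁻¹ • η, ?_, ?_⟩
    · rw [norm_smul, hη, mul_one, norm_inv, norm_abs_eq_norm, Real.norm_eq_abs]
      exact inv_le_one_of_one_le₀ (not_lt.1 h)
    · rw [map_smul, smul_add, add_sub_cancel_left, smul_smul, norm_smul, norm_pole, norm_mul,
        norm_inv, norm_abs_eq_norm, Real.norm_eq_abs, inv_mul_cancel₀ hz.ne', one_mul]

/-- The normal vector of a supporting hyperplane of the barrel at the boundary point in direction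
`(η, z)`. -/
theorem exists_support_barrelGauge (η : USphere m) (z : ℝ) : ∃ y : Euc (m + 1),
    ‖y‖ + ‖horizontal y‖ ≤ 1 ∧ inner ℝ (equatorIncl m η + z • pole m) y = barrelGauge z := by
  have hη := norm_coe_uSphere η
  rw [barrelGauge]
  split_ifs with h
  · have hz : z ^ 2 < 1 := (sq_lt_one_iff_abs_lt_one z).2 h
    refine ⟨equatorIncl m (((1 - z ^ 2) / 2) • (η : Euc m)) + z • pole m, ?_, ?_⟩
    · have h1 : ‖horizontal (equatorIncl m (((1 - z ^ 2) / 2) • (η : Euc m)) + z • pole m)‖ =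
          (1 - z ^ 2) / 2 := by
        rw [horizontal_equatorIncl_add, norm_smul, hη, mul_one, Real.norm_of_nonneg (by linarith)]
      have h2 : ‖equatorIncl m (((1 - z ^ 2) / 2) • (η : Euc m)) + z • pole m‖ =
          (1 + z ^ 2) / 2 := by
        rw [← Real.sqrt_sq (norm_nonneg _), norm_sq_eq_horizontal, h1, last_equatorIncl_add,
          show ((1 - z ^ 2) / 2) ^ 2 + z ^ 2 = ((1 + z ^ 2) / 2) ^ 2 by ring,
          Real.sqrt_sq (by positivity)]
      rw [h1, h2]
      linarith
    · rw [inner_equatorIncl_add, horizontal_equatorIncl_add, last_equatorIncl_add, inner_smul_right,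
        real_inner_self_eq_norm_sq, hη]
      ring
  · have hz : 0 < |z| := one_pos.trans_le (not_lt.1 h)
    refine ⟨equatorIncl m 0 + (z / |z|) • pole m, ?_, ?_⟩
    · rw [horizontal_equatorIncl_add]
      simp [norm_smul, norm_pole, div_self hz.ne']
    · rw [inner_equatorIncl_add, horizontal_equatorIncl_add, last_equatorIncl_add, inner_zero_right, zero_add,
        ← mul_div_assoc, ← sq, ← sq_abs, sq, mul_self_div_self]

theorem smul_mem_barrel_iff (η : USphere m) (z : ℝ) {a : ℝ} (ha : 0 < a) :
    a • (equatorIncl m η + z • pole m) ∈ barrel (m + 1) ↔ a ≤ (barrelGauge z)⁻¹ := by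
  have hg := barrelGauge_pos z
  constructor
  · intro h
    obtain ⟨y, hy, hy2⟩ := exists_support_barrelGauge η z
    have := (inner_le_of_mem_barrel h y).trans hy
    rw [inner_smul_left, hy2] at this
    rw [← one_div, le_div_iff₀ hg]
    exact this
  · intro h
    have := smul_mem_barrel (inv_barrelGauge_smul_mem_barrel η z) (a := a * barrelGauge z)
      (by positivity) (by rwa [← one_div, le_div_iff₀ hg] at h)
    rwa [smul_smul, mul_assoc, mul_inv_cancel₀ hg.ne', mul_one] at this

/-- The radial function of the barrel in direction `ξ`, as a function of `t = |ξ_n| ∈ [0, 1]`. -/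
noncomputable def barrelRadial (t : ℝ) : ℝ := if t < 1 / √2 then 2 * √(1 - t ^ 2) else 1 / t

/-- A formula without case distinction, which shows the continuity. -/
theorem barrelRadial_eq (t : ℝ) : barrelRadial t =
    2 * √(1 - (min t (1 / √2)) ^ 2) * ((1 / √2) / max t (1 / √2)) := by
  have h2 : 0 < 1 / √2 := by positivity
  unfold barrelRadial
  split_ifs with h
  · rw [min_eq_left h.le, max_eq_right h.le, div_self h2.ne', mul_one]
  · have h' := not_lt.1 h
    rw [min_eq_right h', max_eq_left h']
    have e1 : (1 / √2) ^ 2 = 1 / 2 := by rw [div_pow, Real.sq_sqrt (by norm_num)]; norm_num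
    have e2 : √(1 - 1 / 2) = 1 / √2 := by
      rw [show (1 : ℝ) - 1 / 2 = (1 / √2) ^ 2 by rw [e1]; norm_num, Real.sqrt_sq h2.le]
    rw [e1, e2, mul_assoc, ← mul_div_assoc, ← mul_div_assoc, ← sq, e1]
    norm_num

theorem continuous_barrelRadial : Continuous barrelRadial := by
  rw [funext barrelRadial_eq]
  have h2 : 0 < 1 / √2 := by positivity
  refine Continuous.mul (by fun_prop) (Continuous.div (by fun_prop) (by fun_prop) fun t => ?_)
  exact (h2.trans_le (le_max_right _ _)).ne'

theorem barrelRadial_pos {t : ℝ} (ht : 0 ≤ t) : 0 < barrelRadial t := by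
  have h2 : 0 < 1 / √2 := by positivity
  unfold barrelRadial
  split_ifs with h
  · have h1 : 1 / √2 ≤ 1 := (le_abs_self _).trans abs_one_div_sqrt_two_le
    have : 0 < 1 - t ^ 2 := by nlinarith
    positivity
  · have := h2.trans_le (not_lt.1 h)
    positivity

theorem nonempty_uSphere {m : ℕ} (hm : 0 < m) : Nonempty (USphere m) := by
  have : Nonempty (Fin m) := ⟨⟨0, hm⟩⟩
  exact (NormedSpace.sphere_nonempty.2 zero_le_one).to_subtype

theorem lt_one_div_sqrt_two_iff {t : ℝ} (ht : 0 ≤ t) : t < 1 / √2 ↔ t ^ 2 < 1 / 2 := by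
  rw [← pow_lt_pow_iff_left₀ ht (by positivity) two_ne_zero, div_pow,
    Real.sq_sqrt (by norm_num), one_pow]

theorem smul_mem_barrel_iff_le_barrelRadial (ξ : USphere (m + 1)) {a : ℝ} (ha : 0 < a) :
    a • (ξ : Euc (m + 1)) ∈ barrel (m + 1) ↔ a ≤ barrelRadial |height ξ| := by
  rcases (width_nonneg ξ).eq_or_lt with hs | hs
  · have hh : horizontal (ξ : Euc (m + 1)) = 0 := by
      rw [← norm_eq_zero, norm_horizontal, ← hs]
    have hz : |height ξ| = 1 := by
      have := width_sq ξ
      rw [← hs] at this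
      rw [← sq_eq_sq₀ (abs_nonneg _) zero_le_one, sq_abs]
      linarith
    have h1 : ¬ (1 : ℝ) < 1 / √2 := not_lt.2 ((le_abs_self _).trans abs_one_div_sqrt_two_le)
    rw [hz, barrelRadial, if_neg h1, div_one]
    constructor
    · intro h
      have := inner_le_of_mem_barrel h (ξ : Euc (m + 1))
      rwa [hh, norm_zero, add_zero, inner_smul_left, real_inner_self_eq_norm_sq,
        norm_coe_uSphere, one_pow, mul_one] at this
    · intro h
      refine (mem_barrel_iff _).2 ⟨0, by simp, ?_⟩
      rw [map_zero, sub_zero, norm_smul, norm_coe_uSphere, mul_one, Real.norm_of_nonneg ha.le]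
      exact h
  · set s := width ξ with hsdef
    have hη : ‖s⁻¹ • horizontal (ξ : Euc (m + 1))‖ = 1 := by
      rw [norm_smul, norm_horizontal, norm_inv, Real.norm_of_nonneg hs.le,
        inv_mul_cancel₀ hs.ne']
    let η : USphere m := ⟨s⁻¹ • horizontal (ξ : Euc (m + 1)), mem_sphere_zero_iff_norm.2 hη⟩
    have hξ : (ξ : Euc (m + 1)) = s • (equatorIncl m η + (height ξ / s) • pole m) := by
      conv_lhs => rw [← equatorIncl_horizontal (ξ : Euc (m + 1))]
      rw [smul_add, smul_smul, mul_div_cancel₀ _ hs.ne', ← map_smul]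
      simp only [η, smul_smul, mul_inv_cancel₀ hs.ne', one_smul]
      rfl
    rw [hξ, smul_smul, smul_mem_barrel_iff _ _ (mul_pos ha hs)]
    have hsq : s ^ 2 = 1 - height ξ ^ 2 := width_sq ξ
    have hiff : |height ξ / s| < 1 ↔ |height ξ| < 1 / √2 := by
      rw [abs_div, abs_of_pos hs, div_lt_one hs, lt_one_div_sqrt_two_iff (abs_nonneg _), sq_abs,
        ← pow_lt_pow_iff_left₀ (abs_nonneg _) hs.le two_ne_zero, sq_abs, hsq]
      constructor <;> intro h <;> linarith
    have hval : barrelRadial |height ξ| = s⁻¹ * (barrelGauge (height ξ / s))⁻¹ := by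
      unfold barrelRadial barrelGauge
      simp only [hiff]
      split_ifs with h
      · rw [sq_abs]
        change 2 * s = _
        have : (1 + (height ξ / s) ^ 2) / 2 = 1 / (2 * s ^ 2) := by
          field_simp
          linarith
        rw [this]
        field_simp
      · rw [abs_div, abs_of_pos hs]
        field_simp
    rw [hval, ← div_eq_inv_mul, le_div_iff₀ hs]

theorem barrel_eq_starRegion :
    barrel (m + 1) = starRegion fun ξ : USphere (m + 1) => barrelRadial |height ξ| := by
  ext x
  rcases eq_or_ne x 0 with rfl | h0
  · obtain ⟨θ⟩ := nonempty_uSphere m.succ_pos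
    exact iff_of_true zero_mem_barrel
      ⟨(0, θ), ⟨le_rfl, (barrelRadial_pos (abs_nonneg _)).le⟩, zero_smul _ _⟩
  · obtain ⟨θ, hθ⟩ := exists_smul_uSphere h0
    rw [hθ, smul_mem_barrel_iff_le_barrelRadial θ (norm_pos_iff.2 h0),
      smul_mem_starRegion (norm_pos_iff.2 h0)]

theorem radialFn_barrel (ξ : USphere (m + 1)) :
    radialFn (barrel (m + 1)) ξ = barrelRadial |height ξ| := by
  rw [barrel_eq_starRegion, radialFn_starRegion fun _ => barrelRadial_pos (abs_nonneg _)]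

theorem height_neg (ξ : USphere (m + 1)) : height (-ξ) = -height ξ := rfl

theorem isStarBody_barrel : IsStarBody (barrel (m + 1)) := by
  rw [barrel_eq_starRegion]
  exact isStarBody_starRegion m.succ_pos (continuous_barrelRadial.comp continuous_height.abs)
    (fun _ => barrelRadial_pos (abs_nonneg _)) fun θ => by rw [height_neg, abs_neg]

end Barrel

/-! ### Zonal profiles in even dimensions -/

section Profile

/-- The zonal profile `(1 - v²)^{-(2j+3)/2}` for `|v| < 1/√2`, and `κ |v|` for
`1/√2 ≤ |v| ≤ 1`. It is constant for `|v| ≥ 1`, so as to be bounded. -/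
noncomputable def profile (j : ℕ) (κ v : ℝ) : ℝ :=
  if |v| < 1 / √2 then 1 / √(1 - v ^ 2) ^ (2 * j + 3) else κ * min |v| 1

theorem measurable_profile (j : ℕ) (κ : ℝ) : Measurable (profile j κ) := by
  unfold profile
  refine Measurable.ite (measurableSet_lt (by fun_prop) measurable_const) ?_ ?_ <;> fun_prop

theorem one_div_sqrt_one_sub_sq_pow_le {v : ℝ} (hv : |v| ≤ 1 / √2) (p : ℕ) :
    1 / √(1 - v ^ 2) ^ p ≤ √2 ^ p := by
  have h2 : 0 < √2 := by positivity
  have h1 : v ^ 2 ≤ 1 / 2 := by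
    rw [← sq_abs]
    calc |v| ^ 2 ≤ (1 / √2) ^ 2 := pow_le_pow_left₀ (abs_nonneg _) hv 2
      _ = 1 / 2 := by rw [div_pow, Real.sq_sqrt (by norm_num), one_pow]
  have h3 : 1 / √2 ≤ √(1 - v ^ 2) := by
    refine Real.le_sqrt_of_sq_le ?_
    rw [div_pow, Real.sq_sqrt (by norm_num)]
    linarith
  have h4 : 0 < √(1 - v ^ 2) := (by positivity : 0 < 1 / √2).trans_le h3
  rw [← one_div_pow]
  refine pow_le_pow_left₀ (by positivity) ?_ p
  rw [div_le_iff₀ h4]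
  rw [div_le_iff₀ h2] at h3
  linarith

theorem abs_profile_le (j : ℕ) {κ : ℝ} (hκ : 0 ≤ κ) (v : ℝ) :
    |profile j κ v| ≤ √2 ^ (2 * j + 3) + κ := by
  unfold profile
  split_ifs with h
  · rw [abs_of_nonneg (by positivity)]
    linarith [one_div_sqrt_one_sub_sq_pow_le h.le (2 * j + 3)]
  · have h1 : 0 ≤ min |v| 1 := le_min (abs_nonneg _) zero_le_one
    rw [abs_of_nonneg (by positivity)]
    have : κ * min |v| 1 ≤ κ := mul_le_of_le_one_right hκ (min_le_right _ _)
    linarith [(by positivity : 0 ≤ √2 ^ (2 * j + 3))]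

theorem profile_nonneg (j : ℕ) {κ : ℝ} (hκ : 0 ≤ κ) (v : ℝ) : 0 ≤ profile j κ v := by
  unfold profile
  split_ifs with h
  · positivity
  · exact mul_nonneg hκ (le_min (abs_nonneg _) zero_le_one)

theorem profile_neg (j : ℕ) (κ v : ℝ) : profile j κ (-v) = profile j κ v := by
  simp [profile]

theorem intervalIntegrable_profile (j : ℕ) {κ : ℝ} (hκ : 0 ≤ κ) (w a b : ℝ) :
    IntervalIntegrable (fun u => (1 - u ^ 2) ^ j * profile j κ (w * u)) volume a b := by
  refine IntervalIntegrable.continuousOn_mul ?_ (by fun_prop)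
  refine (intervalIntegrable_const (c := √2 ^ (2 * j + 3) + κ)).mono_fun ?_
    (.of_forall fun u => (abs_profile_le j hκ _).trans (le_abs_self _))
  exact ((measurable_profile j κ).comp (by fun_prop)).aestronglyMeasurable

/-- In dimension `n = 2j + 4` the Radon kernel `(1 - u²)^{(n-4)/2}` is a polynomial. -/
theorem sphericalRadon_profile (j : ℕ) {κ : ℝ} (hκ : 0 ≤ κ) (ξ : USphere (2 * j + 2 + 2)) :
    sphericalRadon (fun θ => profile j κ (height θ)) ξ = 2 * sphereArea (2 * j + 2) *
      ∫ u in 0..1, (1 - u ^ 2) ^ j * profile j κ (width ξ * u) := by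
  rw [sphericalRadon_zonal (by omega) ξ (measurable_profile j κ) (abs_profile_le j hκ)]
  change _ * ∫ α, profile j κ (width ξ * Real.sin α) ∂(cosPowMeasure (2 * j + 1)) = _
  rw [integral_cosPowMeasure_succ (2 * j) fun u => profile j κ (width ξ * u),
    mul_comm 2 (sphereArea _), mul_assoc]
  congr 1
  have h1 : ∀ u ∈ Ioo (-1 : ℝ) 1, √(1 - u ^ 2) ^ (2 * j) * profile j κ (width ξ * u) =
      (1 - u ^ 2) ^ j * profile j κ (width ξ * u) := fun u hu => by
    rw [pow_mul, Real.sq_sqrt (by nlinarith [hu.1, hu.2])]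
  rw [setIntegral_congr_fun measurableSet_Ioo h1, ← integral_Ioc_eq_integral_Ioo,
    ← intervalIntegral.integral_of_le (by norm_num),
    ← intervalIntegral.integral_add_adjacent_intervals
      (intervalIntegrable_profile j hκ _ (-1) 0) (intervalIntegrable_profile j hκ _ 0 1)]
  have h2 := intervalIntegral.integral_comp_neg
    (fun u => (1 - u ^ 2) ^ j * profile j κ (width ξ * u)) (a := 0) (b := 1)
  simp only [neg_zero, neg_sq, mul_neg, profile_neg] at h2
  rw [← h2]
  ring

theorem hasDerivAt_div_sqrt {w u : ℝ} (h : w ^ 2 * u ^ 2 < 1) :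
    HasDerivAt (fun u => u / √(1 - (w * u) ^ 2)) (1 / √(1 - (w * u) ^ 2) ^ 3) u := by
  have hp : 0 < 1 - (w * u) ^ 2 := by rw [mul_pow]; linarith
  have hr : 0 < √(1 - (w * u) ^ 2) := Real.sqrt_pos.2 hp
  have h1 : HasDerivAt (fun u => 1 - (w * u) ^ 2) (-(2 * (w * u) * w)) u := by
    have := (((hasDerivAt_id u).const_mul w).pow 2).const_sub 1
    simpa using this
  have h2 := (hasDerivAt_id u).div (h1.sqrt hp.ne') hr.ne'
  refine h2.congr_deriv ?_
  have hsq := Real.sq_sqrt hp.le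
  simp only [id]
  generalize √(1 - (w * u) ^ 2) = r at hr hsq
  field_simp
  rw [hsq]
  ring

/-- The primitive, through the substitution `y = u / √(1 - w² u²)`. -/
theorem hasDerivAt_primitive (j : ℕ) {w u : ℝ} (h : w ^ 2 * u ^ 2 < 1) {q : ℝ → ℝ}
    (hq : ∀ y, HasDerivAt q ((1 - (1 - w ^ 2) * y ^ 2) ^ j) y) :
    HasDerivAt (fun u => q (u / √(1 - (w * u) ^ 2)))
      ((1 - u ^ 2) ^ j * (1 / √(1 - (w * u) ^ 2) ^ (2 * j + 3))) u := by
  have hp : 0 < 1 - (w * u) ^ 2 := by rw [mul_pow]; linarith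
  have hr : 0 < √(1 - (w * u) ^ 2) := Real.sqrt_pos.2 hp
  have hsq := Real.sq_sqrt hp.le
  refine ((hq _).comp u (hasDerivAt_div_sqrt h)).congr_deriv ?_
  have e : 1 - (1 - w ^ 2) * (u / √(1 - (w * u) ^ 2)) ^ 2 =
      (1 - u ^ 2) / √(1 - (w * u) ^ 2) ^ 2 := by
    rw [div_pow, hsq, eq_div_iff hp.ne', sub_mul, mul_assoc, div_mul_cancel₀ _ hp.ne']
    ring
  rw [e, div_pow, ← pow_mul, pow_add]
  field_simp

variable {w κ : ℝ} {q : ℝ → ℝ}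

/-- The part of the integral where the profile is `(1 - v²)^{-(2j+3)/2}`. -/
theorem integral_profile_inner (j : ℕ) (hκ : 0 ≤ κ) (hw : 0 ≤ w) {b : ℝ} (hb : 0 ≤ b)
    (hwb : w * b ≤ 1 / √2) (hq : ∀ y, HasDerivAt q ((1 - (1 - w ^ 2) * y ^ 2) ^ j) y) :
    ∫ u in 0..b, (1 - u ^ 2) ^ j * profile j κ (w * u) = q (b / √(1 - (w * b) ^ 2)) - q 0 := by
  have hlt : ∀ u ∈ Icc 0 b, w ^ 2 * u ^ 2 < 1 := fun u hu => by
    have h1 : w * u ≤ 1 / √2 := (mul_le_mul_of_nonneg_left hu.2 hw).trans hwb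
    have h2 : 0 ≤ w * u := mul_nonneg hw hu.1
    calc w ^ 2 * u ^ 2 = (w * u) ^ 2 := by ring
      _ ≤ (1 / √2) ^ 2 := pow_le_pow_left₀ h2 h1 2
      _ = 1 / 2 := by rw [div_pow, Real.sq_sqrt (by norm_num), one_pow]
      _ < 1 := by norm_num
  rw [intervalIntegral.integral_eq_sub_of_hasDerivAt_of_le hb
    (f := fun u => q (u / √(1 - (w * u) ^ 2))) ?_ ?_ (intervalIntegrable_profile j hκ w 0 b)]
  · simp
  · exact fun u hu => (hasDerivAt_primitive j (hlt u hu) hq).continuousAt.continuousWithinAt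
  · intro u hu
    refine (hasDerivAt_primitive j (hlt u (Ioo_subset_Icc_self hu)) hq).congr_deriv ?_
    congr 1
    rw [profile, if_pos]
    rw [abs_of_nonneg (mul_nonneg hw hu.1.le)]
    rcases hw.eq_or_lt with rfl | hw
    · rw [zero_mul]; positivity
    · exact (mul_lt_mul_of_pos_left hu.2 hw).trans_le hwb

/-- The part of the integral where the profile is linear. -/
theorem integral_profile_outer (j : ℕ) (hκ : 0 ≤ κ) (hw : 0 < w) (hw1 : w ≤ 1) {b : ℝ}
    (hb : 0 ≤ b) (hb1 : b ≤ 1) (hwb : w * b = 1 / √2) :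
    ∫ u in b..1, (1 - u ^ 2) ^ j * profile j κ (w * u) =
      κ * w * (1 - b ^ 2) ^ (j + 1) / (2 * (j + 1)) := by
  have hd : ∀ u, HasDerivAt (fun u : ℝ => -(κ * w * (1 - u ^ 2) ^ (j + 1) / (2 * (j + 1))))
      ((1 - u ^ 2) ^ j * (κ * (w * u))) u := fun u => by
    have h1 : HasDerivAt (fun u : ℝ => 1 - u ^ 2) (-(2 * u)) u := by
      simpa using ((hasDerivAt_id u).pow 2).const_sub 1
    refine ((((h1.pow (j + 1)).const_mul (κ * w)).div_const (2 * (j + 1))).neg).congr_deriv ?_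
    push_cast
    field_simp
  rw [intervalIntegral.integral_eq_sub_of_hasDerivAt_of_le hb1
    (f := fun u : ℝ => -(κ * w * (1 - u ^ 2) ^ (j + 1) / (2 * (j + 1)))) ?_ ?_
    (intervalIntegrable_profile j hκ w b 1)]
  · simp
  · exact fun u hu => (hd u).continuousAt.continuousWithinAt
  · intro u hu
    refine (hd u).congr_deriv ?_
    have h0 : 0 ≤ u := hb.trans hu.1.le
    have h1 : |w * u| = w * u := abs_of_nonneg (by positivity)
    rw [profile, if_neg, h1, min_eq_left]
    · exact mul_le_one₀ hw1 h0 hu.2.le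
    · rw [h1, ← hwb, not_lt]
      exact mul_le_mul_of_nonneg_left hu.1.le hw.le

/-- The Radon transform of the profile near the axis. -/
theorem integral_profile_of_le (j : ℕ) (hκ : 0 ≤ κ) (hw : 0 ≤ w) (hw2 : w ≤ 1 / √2)
    (hq : ∀ y, HasDerivAt q ((1 - (1 - w ^ 2) * y ^ 2) ^ j) y) :
    ∫ u in 0..1, (1 - u ^ 2) ^ j * profile j κ (w * u) = q (1 / √(1 - w ^ 2)) - q 0 := by
  have := integral_profile_inner j hκ hw zero_le_one (by rwa [mul_one]) hq
  rwa [mul_one] at this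

/-- The Radon transform of the profile near the equator. -/
theorem integral_profile_of_lt (j : ℕ) (hκ : 0 ≤ κ) (hw1 : w ≤ 1) (hw2 : 1 / √2 < w)
    (hq : ∀ y, HasDerivAt q ((1 - (1 - w ^ 2) * y ^ 2) ^ j) y) :
    ∫ u in 0..1, (1 - u ^ 2) ^ j * profile j κ (w * u) =
      q (1 / w) - q 0 + κ * w * (1 - 1 / (2 * w ^ 2)) ^ (j + 1) / (2 * (j + 1)) := by
  have h2 : 0 < 1 / √2 := by positivity
  have hw : 0 < w := h2.trans hw2
  set b := 1 / √2 / w with hb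
  have hwb : w * b = 1 / √2 := mul_div_cancel₀ _ hw.ne'
  have hb0 : 0 ≤ b := by positivity
  have hb1 : b ≤ 1 := (div_le_one hw).2 hw2.le
  have hbsq : b ^ 2 = 1 / (2 * w ^ 2) := by
    rw [hb, div_pow, div_pow, Real.sq_sqrt (by norm_num)]
    field_simp
  have hsq : √(1 - (w * b) ^ 2) = 1 / √2 := by
    rw [hwb, ← Real.sqrt_sq h2.le]
    congr 1
    rw [Real.sqrt_sq h2.le, div_pow, Real.sq_sqrt (by norm_num)]
    norm_num
  rw [← intervalIntegral.integral_add_adjacent_intervals (intervalIntegrable_profile j hκ w 0 b)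
    (intervalIntegrable_profile j hκ w b 1), integral_profile_inner j hκ hw.le hb0 hwb.le hq,
    integral_profile_outer j hκ hw hw1 hb0 hb1 hwb, hsq, hbsq]
  congr 3
  rw [hb]
  field_simp

end Profile

/-! ### Inversion formulas, and dimension four -/

section Inversion

theorem one_div_sqrt_two_sq : (1 / √2 : ℝ) ^ 2 = 1 / 2 := by
  rw [div_pow, Real.sq_sqrt (by norm_num), one_pow]

variable {m : ℕ}

theorem sqrt_one_sub_width_sq (ξ : USphere (m + 1)) : √(1 - width ξ ^ 2) = |height ξ| := by
  rw [width_sq, sub_sub_cancel, Real.sqrt_sq_eq_abs]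

theorem abs_height_lt_iff (ξ : USphere (m + 1)) : |height ξ| < 1 / √2 ↔ 1 / √2 < width ξ := by
  rw [lt_one_div_sqrt_two_iff (abs_nonneg _), sq_abs,
    ← pow_lt_pow_iff_left₀ (by positivity) (width_nonneg ξ) two_ne_zero, one_div_sqrt_two_sq,
    width_sq]
  constructor <;> intro h <;> linarith

theorem barrelRadial_of_lt {ξ : USphere (m + 1)} (h : 1 / √2 < width ξ) :
    barrelRadial |height ξ| = 2 * width ξ := by
  rw [barrelRadial, if_pos ((abs_height_lt_iff ξ).2 h), sq_abs]
  rfl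

theorem barrelRadial_of_le {ξ : USphere (m + 1)} (h : width ξ ≤ 1 / √2) :
    barrelRadial |height ξ| = 1 / |height ξ| := by
  rw [barrelRadial, if_neg (fun h2 => ((abs_height_lt_iff ξ).1 h2).not_ge h)]

/-- With `κ = 4` the profile for `j = 0` inverts the Radon transform. -/
theorem integral_profile_zero (ξ : USphere (m + 1)) :
    ∫ u in 0..1, (1 - u ^ 2) ^ 0 * profile 0 4 (width ξ * u) = barrelRadial |height ξ| := by
  have hq : ∀ y : ℝ, HasDerivAt (fun y : ℝ => y) ((1 - (1 - width ξ ^ 2) * y ^ 2) ^ 0) y :=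
    fun y => by
      rw [pow_zero]
      exact hasDerivAt_id' y
  rcases lt_or_ge (1 / √2) (width ξ) with h | h
  · have hw : 0 < width ξ := (by positivity : 0 < 1 / √2).trans h
    rw [integral_profile_of_lt 0 (by norm_num) (width_le_one ξ) h hq, barrelRadial_of_lt h,
      show 1 - 1 / (2 * width ξ ^ 2) = (2 * width ξ ^ 2 - 1) / (2 * width ξ ^ 2) by field_simp]
    push_cast
    field_simp
    ring
  · rw [integral_profile_of_le 0 (by norm_num) (width_nonneg ξ) h hq, barrelRadial_of_le h,
      sqrt_one_sub_width_sq, sub_zero]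

/-- With `κ = 16/3` the profile for `j = 1` inverts the Radon transform. -/
theorem integral_profile_one (ξ : USphere (m + 1)) :
    ∫ u in 0..1, (1 - u ^ 2) ^ 1 * profile 1 (16 / 3) (width ξ * u) =
      2 / 3 * barrelRadial |height ξ| := by
  have hq : ∀ y : ℝ, HasDerivAt (fun y : ℝ => y - (1 - width ξ ^ 2) * y ^ 3 / 3)
      ((1 - (1 - width ξ ^ 2) * y ^ 2) ^ 1) y := fun y => by
    refine ((hasDerivAt_id y).sub
      (((hasDerivAt_pow 3 y).const_mul _).div_const 3)).congr_deriv ?_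
    push_cast
    ring
  rcases lt_or_ge (1 / √2) (width ξ) with h | h
  · have hw : 0 < width ξ := (by positivity : 0 < 1 / √2).trans h
    rw [integral_profile_of_lt 1 (by norm_num) (width_le_one ξ) h hq, barrelRadial_of_lt h,
      show 1 - 1 / (2 * width ξ ^ 2) = (2 * width ξ ^ 2 - 1) / (2 * width ξ ^ 2) by field_simp]
    push_cast
    field_simp
    ring
  · rw [integral_profile_of_le 1 (by norm_num) (width_nonneg ξ) h hq, barrelRadial_of_le h,
      sqrt_one_sub_width_sq]
    have ht : 0 < |height ξ| := (by positivity : 0 < 1 / √2).trans_le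
      (not_lt.1 fun h2 => ((abs_height_lt_iff ξ).1 h2).not_ge h)
    have hw2 : width ξ ^ 2 = 1 - |height ξ| ^ 2 := by rw [sq_abs, width_sq]
    rw [hw2]
    field_simp
    ring

/-- For `j = 2` no `κ` is good: with `κ = 96/15` there remains a multiple of the Radon transform of the
Dirac measure on the parallels of height `1/√2`. -/
theorem integral_profile_two (ξ : USphere (m + 1)) :
    ∫ u in 0..1, (1 - u ^ 2) ^ 2 * profile 2 (96 / 15) (width ξ * u) =
      8 / 15 * barrelRadial |height ξ| +
        4 / 15 * (√(width ξ ^ 2 - (1 / √2) ^ 2) ^ 4 / width ξ ^ 5) := by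
  have hq : ∀ y : ℝ, HasDerivAt (fun y : ℝ => y - 2 * (1 - width ξ ^ 2) * y ^ 3 / 3 +
      (1 - width ξ ^ 2) ^ 2 * y ^ 5 / 5) ((1 - (1 - width ξ ^ 2) * y ^ 2) ^ 2) y := fun y => by
    refine (((hasDerivAt_id y).sub (((hasDerivAt_pow 3 y).const_mul _).div_const 3)).add
      (((hasDerivAt_pow 5 y).const_mul _).div_const 5)).congr_deriv ?_
    push_cast
    ring
  rw [one_div_sqrt_two_sq]
  rcases lt_or_ge (1 / √2) (width ξ) with h | h
  · have hw : 0 < width ξ := (by positivity : 0 < 1 / √2).trans h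
    have h2 : 1 / 2 ≤ width ξ ^ 2 := by
      rw [← one_div_sqrt_two_sq]
      exact pow_le_pow_left₀ (by positivity) h.le 2
    have h4 : √(width ξ ^ 2 - 1 / 2) ^ 4 = (width ξ ^ 2 - 1 / 2) ^ 2 := by
      rw [show 4 = 2 * 2 from rfl, pow_mul, Real.sq_sqrt (by linarith)]
    rw [integral_profile_of_lt 2 (by norm_num) (width_le_one ξ) h hq, barrelRadial_of_lt h, h4,
      show 1 - 1 / (2 * width ξ ^ 2) = (2 * width ξ ^ 2 - 1) / (2 * width ξ ^ 2) by field_simp]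
    push_cast
    field_simp
    ring
  · have h2 : width ξ ^ 2 ≤ 1 / 2 := by
      rw [← one_div_sqrt_two_sq]
      exact pow_le_pow_left₀ (width_nonneg _) h 2
    rw [integral_profile_of_le 2 (by norm_num) (width_nonneg ξ) h hq, barrelRadial_of_le h,
      sqrt_one_sub_width_sq, Real.sqrt_eq_zero_of_nonpos (by linarith)]
    have ht : 0 < |height ξ| := (by positivity : 0 < 1 / √2).trans_le
      (not_lt.1 fun h2 => ((abs_height_lt_iff ξ).1 h2).not_ge h)
    have hw2 : width ξ ^ 2 = 1 - |height ξ| ^ 2 := by rw [sq_abs, width_sq]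
    rw [hw2]
    field_simp
    ring

theorem sphereArea_two : sphereArea 2 = 2 * Real.pi := by
  rw [sphereArea, surfaceMeasure, Measure.toSphere_real_apply_univ, finrank_euclideanSpace_fin,
    measureReal_def, EuclideanSpace.volume_ball_fin_two]
  simp [Real.pi_nonneg]

/-- A formula without case distinction, which shows the continuity. -/
theorem barrelSource_eq {t : ℝ} (ht : 0 ≤ t) : barrelSource t =
    (3 / (4 * Real.pi)) ^ (1 / 3 : ℝ) * (1 / √(1 - min t (1 / √2) ^ 2)) *
      (max t (1 / √2) / (1 / √2)) ^ (1 / 3 : ℝ) := by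
  have h2 : 0 < 1 / √2 := by positivity
  have hpi := Real.pi_pos
  unfold barrelSource
  split_ifs with h
  · rw [min_eq_left h.le, max_eq_right h.le, div_self h2.ne', Real.one_rpow, mul_one]
  · have h' := not_lt.1 h
    rw [min_eq_right h', max_eq_left h', one_div_sqrt_two_sq]
    have e2 : 1 / √(1 - 1 / 2) = (2 * √2) ^ (1 / 3 : ℝ) := by
      have e3 : (2 * √2 : ℝ) = √2 ^ 3 := by
        rw [pow_succ, Real.sq_sqrt (by norm_num)]
      rw [e3, ← Real.rpow_natCast, ← Real.rpow_mul (by positivity)]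
      norm_num
    rw [e2, ← Real.mul_rpow (by positivity) (by positivity),
      ← Real.mul_rpow (by positivity) (by positivity)]
    congr 1
    have := Real.sq_sqrt (show (0 : ℝ) ≤ 2 by norm_num)
    field_simp
    rw [this]
    ring

theorem continuous_barrelSource_abs_height :
    Continuous fun θ : USphere (m + 1) => barrelSource |height θ| := by
  have h2 : 0 < 1 / √2 := by positivity
  simp only [barrelSource_eq (abs_nonneg _)]
  have hh := continuous_height (m := m)
  have hpos : ∀ θ : USphere (m + 1), √(1 - min |height θ| (1 / √2) ^ 2) ≠ 0 := fun θ => by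
    have h3 : min |height θ| (1 / √2) ^ 2 ≤ 1 / 2 := by
      rw [← one_div_sqrt_two_sq]
      exact pow_le_pow_left₀ (le_min (abs_nonneg _) h2.le) (min_le_right _ _) 2
    exact (Real.sqrt_pos.2 (by linarith)).ne'
  refine Continuous.mul (Continuous.mul continuous_const
    (Continuous.div continuous_const (by fun_prop) hpos)) ?_
  exact Continuous.rpow_const (by fun_prop) fun _ => Or.inr (by norm_num)

theorem barrelSource_pos {t : ℝ} (ht : 0 ≤ t) : 0 < barrelSource t := by
  have h2 : 0 < 1 / √2 := by positivity
  have hpi := Real.pi_pos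
  unfold barrelSource
  split_ifs with h
  · have h3 := (lt_one_div_sqrt_two_iff ht).1 h
    have : 0 < 1 - t ^ 2 := by linarith
    positivity
  · have := h2.trans_le (not_lt.1 h)
    positivity

theorem barrelSource_pow_three {t : ℝ} (ht : |t| ≤ 1) :
    1 / 3 * barrelSource |t| ^ 3 = 1 / (4 * Real.pi) * profile 0 4 t := by
  have hpi := Real.pi_pos
  have hr : ∀ x : ℝ, 0 ≤ x → (x ^ (1 / 3 : ℝ)) ^ 3 = x := fun x hx => by
    rw [← Real.rpow_natCast, ← Real.rpow_mul hx]
    norm_num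
  unfold barrelSource profile
  split_ifs with h
  · rw [mul_pow, hr _ (by positivity), one_div_pow, sq_abs]
    simp only [mul_zero, zero_add]
    field_simp
  · rw [hr _ (by positivity), min_eq_left ht]
    field_simp

/-- In dimension four the barrel is an intersection body of a star body. -/
theorem isIntersectionBodyOf_barrel_four :
    IsIntersectionBodyOf (barrel 4) (starRegion fun θ : USphere 4 => barrelSource |height θ|) := by
  have hL : IsStarBody (starRegion fun θ : USphere 4 => barrelSource |height θ|) :=
    isStarBody_starRegion (by norm_num) continuous_barrelSource_abs_height
      (fun _ => barrelSource_pos (abs_nonneg _)) fun θ => by rw [height_neg, abs_neg]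
  refine ⟨isStarBody_barrel, hL, fun ξ => ?_⟩
  have hpi := Real.pi_pos
  rw [hL.volume_section (d := 2) ξ, radialFn_barrel (m := 3)]
  have h1 : (fun θ : USphere 4 => 1 / (((2 : ℕ) : ℝ) + 1) * radialFn
      (starRegion fun θ : USphere 4 => barrelSource |height θ|) θ ^ (2 + 1)) =
      fun θ => 1 / (4 * Real.pi) * profile 0 4 (height θ) := by
    funext θ
    rw [radialFn_starRegion fun _ => barrelSource_pos (abs_nonneg _),
      ← barrelSource_pow_three (abs_height_le_one θ)]
    norm_num
  -- the section formula turns `ρ_L³ / 3` into a multiple of the profile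
  rw [h1]
  have h2 := sphericalRadon_profile 0 (κ := 4) (by norm_num) (ξ : USphere 4)
  have h3 : sphericalRadon (fun θ : USphere 4 => 1 / (4 * Real.pi) * profile 0 4 (height θ)) ξ =
      1 / (4 * Real.pi) * sphericalRadon (fun θ : USphere 4 => profile 0 4 (height θ)) ξ := by
    rw [sphericalRadon, integral_const_mul]; rfl
  have h4 := integral_profile_zero (m := 3) ξ
  rw [h3]
  refine Eq.symm ((congrArg _ h2).trans ?_)
  refine (congrArg (fun x => 1 / (4 * Real.pi) * (2 * sphereArea (2 * 0 + 2) * x)) h4).trans ?_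
  rw [show 2 * 0 + 2 = 2 from rfl, sphereArea_two]
  field_simp
  ring

end Inversion

/-! ### Dimension six -/

section DimensionSix

theorem radialFn_barrel_six (ξ : USphere 6) : radialFn (barrel 6) ξ =
    3 / (4 * sphereArea 4) * sphericalRadon (fun θ : USphere 6 => profile 1 (16 / 3) (height θ)) ξ := by
  have h1 := sphericalRadon_profile 1 (κ := 16 / 3) (by norm_num) (ξ : USphere 6)
  have h2 := integral_profile_one (m := 5) ξ
  have hA := sphereArea_pos (show 0 < 4 by norm_num)
  rw [radialFn_barrel (m := 5)]
  refine Eq.symm ((congrArg _ h1).trans ((congrArg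
    (fun x => 3 / (4 * sphereArea 4) * (2 * sphereArea (2 * 1 + 2) * x)) h2).trans ?_))
  rw [show 2 * 1 + 2 = 4 from rfl]
  field_simp
  norm_num

theorem exists_density_barrel_six : ∃ h₁ h₂ : ℝ → ℝ,
    ContinuousOn h₁ (Icc 0 (1 / √2)) ∧ (∀ t ∈ Icc (0 : ℝ) (1 / √2), 0 ≤ h₁ t) ∧
    ContinuousOn h₂ (Icc (1 / √2) 1) ∧ (∀ t ∈ Icc (1 / √2 : ℝ) 1, 0 ≤ h₂ t) ∧
    ∀ ξ : USphere 6, radialFn (barrel 6) ξ =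
      sphericalRadon (fun θ : USphere 6 =>
        if |(θ : Euc 6) 5| < 1 / √2 then h₁ |(θ : Euc 6) 5| else h₂ |(θ : Euc 6) 5|) ξ := by
  have hA := sphereArea_pos (show 0 < 4 by norm_num)
  have h2 : 0 < 1 / √2 := by positivity
  refine ⟨fun t => 3 / (4 * sphereArea 4) * (1 / √(1 - t ^ 2) ^ 5),
    fun t => 3 / (4 * sphereArea 4) * (16 / 3 * t), ?_, fun t _ => by positivity, by fun_prop,
    fun t ht => by have := h2.trans_le ht.1; positivity, fun ξ => ?_⟩
  · refine ContinuousOn.mul continuousOn_const (ContinuousOn.div continuousOn_const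
      (by fun_prop) fun t ht => ?_)
    have h3 : t ^ 2 ≤ 1 / 2 := by
      rw [← one_div_sqrt_two_sq]
      exact pow_le_pow_left₀ ht.1 ht.2 2
    exact pow_ne_zero _ (Real.sqrt_pos.2 (by linarith)).ne'
  · have h4 : (fun θ : USphere 6 => if |(θ : Euc 6) 5| < 1 / √2
        then 3 / (4 * sphereArea 4) * (1 / √(1 - |(θ : Euc 6) 5| ^ 2) ^ 5)
        else 3 / (4 * sphereArea 4) * (16 / 3 * |(θ : Euc 6) 5|)) =
        fun θ : USphere 6 => 3 / (4 * sphereArea 4) * profile 1 (16 / 3) (height θ) := by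
      funext θ
      change (if |height θ| < _ then 3 / (4 * sphereArea 4) * (1 / √(1 - |height θ| ^ 2) ^ 5)
        else 3 / (4 * sphereArea 4) * (16 / 3 * |height θ|)) = _
      rw [profile, min_eq_left (abs_height_le_one θ), sq_abs]
      split_ifs <;> rfl
    rw [h4, radialFn_barrel_six, sphericalRadon, sphericalRadon, integral_const_mul]

theorem measurePreserving_neg_surfaceMeasure (n : ℕ) :
    MeasurePreserving (fun θ : USphere n => -θ) (surfaceMeasure n) (surfaceMeasure n) := by
  have hm : Measurable fun θ : USphere n => -θ := continuous_neg.measurable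
  refine ⟨hm, ?_⟩
  ext A hA
  rw [Measure.map_apply hm hA, surfaceMeasure, Measure.toSphere_apply' _ (hm hA),
    Measure.toSphere_apply' _ hA]
  congr 1
  have h : (Ioo (0 : ℝ) 1 • ((↑) '' ((fun θ : USphere n => -θ) ⁻¹' A)) : Set (Euc n)) =
      -(Ioo (0 : ℝ) 1 • ((↑) '' A)) := by
    ext x
    rw [Set.mem_neg]
    constructor
    · rintro ⟨c, hc, _, ⟨θ, hθ, rfl⟩, rfl⟩
      exact ⟨c, hc, _, ⟨-θ, hθ, rfl⟩, by simp⟩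
    · rintro ⟨c, hc, _, ⟨θ, hθ, rfl⟩, hx⟩
      refine ⟨c, hc, _, ⟨-θ, by simpa using hθ, rfl⟩, ?_⟩
      rw [← neg_neg x, ← hx]
      simp
  rw [h, Measure.measure_neg]

/-- A star body whose radial function is the Radon transform of a non-negative even zonal density
is an intersection body. -/
theorem isIntersectionBody_of_zonal {d : ℕ} (hd : 3 ≤ d) {K : Set (Euc (d + 2))}
    (hK : IsStarBody K) {H : ℝ → ℝ} (hH : Measurable H) {D : ℝ} (hD : ∀ t, |H t| ≤ D)
    (hH0 : ∀ t, 0 ≤ H t) (heven : ∀ t, H (-t) = H t)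
    (hR : ∀ ξ, radialFn K ξ = sphericalRadon (fun θ => H (height θ)) ξ) :
    IsIntersectionBody K := by
  have hHm : Measurable fun θ : USphere (d + 2) => ENNReal.ofReal (H (height θ)) :=
    (hH.comp continuous_height.measurable).ennreal_ofReal
  refine ⟨hK, (surfaceMeasure (d + 2)).withDensity fun θ => ENNReal.ofReal (H (height θ)), ?_, ?_,
    fun g => ?_⟩
  · refine isFiniteMeasure_withDensity_ofReal ?_
    exact (Integrable.of_bound (hH.comp continuous_height.measurable).aestronglyMeasurable D
      (.of_forall fun θ => hD _)).2
  · have hneg := measurePreserving_neg_surfaceMeasure (d + 2)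
    ext A hA
    rw [Measure.map_apply hneg.measurable hA, withDensity_apply _ (hneg.measurable hA),
      withDensity_apply _ hA, ← hneg.setLIntegral_comp_preimage hA hHm]
    simp only [height_neg, heven]
  · rw [integral_withDensity_eq_integral_toReal_smul hHm (.of_forall fun _ => by simp)]
    have h1 := integral_sphericalRadon_mul_zonal hd g.continuous hH hD
    simp only [ENNReal.toReal_ofReal (hH0 _), smul_eq_mul, hR]
    rw [integral_congr_ae (.of_forall fun θ => mul_comm _ _), ← h1]
    exact integral_congr_ae (.of_forall fun θ => mul_comm _ _)

theorem isIntersectionBody_barrel_six : IsIntersectionBody (barrel 6) := by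
  have hA := sphereArea_pos (show 0 < 4 by norm_num)
  have hc : 0 ≤ 3 / (4 * sphereArea 4) := by positivity
  refine isIntersectionBody_of_zonal (d := 4) (by norm_num) isStarBody_barrel
    (H := fun t => 3 / (4 * sphereArea 4) * profile 1 (16 / 3) t)
    (D := 3 / (4 * sphereArea 4) * (√2 ^ (2 * 1 + 3) + 16 / 3))
    ((measurable_profile _ _).const_mul _) (fun t => ?_)
    (fun t => mul_nonneg hc (profile_nonneg 1 (by norm_num) t))
    (fun t => by rw [profile_neg]) fun ξ => ?_
  · rw [abs_mul, abs_of_nonneg hc]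
    exact mul_le_mul_of_nonneg_left (abs_profile_le 1 (by norm_num) t) hc
  · rw [radialFn_barrel_six, sphericalRadon, sphericalRadon, integral_const_mul]

end DimensionSix

/-! ### Dimension eight -/

section DimensionEight

theorem barrelDensity_eq_profile {t : ℝ} (ht : |t| ≤ 1) :
    barrelDensity |t| = profile 2 (96 / 15) t := by
  unfold barrelDensity profile
  rw [min_eq_left ht, sq_abs]
  split_ifs with h
  · have h1 : t ^ 2 ≤ 1 := (sq_le_one_iff_abs_le_one _).2 ht
    congr 1
    rw [Real.sqrt_eq_rpow, ← Real.rpow_mul_natCast (by linarith)]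
    norm_num
  · rfl

theorem exists_inversion_barrel_eight : ∃ c : ℝ, 0 < c ∧ ∀ g : C(USphere 8, ℝ),
    ∫ ξ, radialFn (barrel 8) ξ * g ξ ∂(surfaceMeasure 8) =
      c * ((∫ θ, sphericalRadon g θ * barrelDensity |(θ : Euc 8) 7| ∂(surfaceMeasure 8)) -
        4 / 15 * ∫ θ, sphericalRadon g θ
          ∂(latitudeDirac 7 (1 / √2) abs_one_div_sqrt_two_le)) := by
  have hA := sphereArea_pos (show 0 < 6 by norm_num)
  -- `16 |S⁵| / 15` is `2 |S⁵|`, from `sphericalRadon_profile`, times the factor `8 / 15` of `ρ_B`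
  refine ⟨15 / (16 * sphereArea 6), by positivity, fun g => ?_⟩
  have hg := g.continuous
  obtain ⟨C, hC⟩ := isCompact_univ.exists_bound_of_continuousOn hg.continuousOn
  set k : USphere 8 → ℝ := fun θ => 2 * sphereArea 6 *
    (√(width θ ^ 2 - (1 / √2) ^ 2) ^ 4 / width θ ^ 5) with hk
  have hsin : Real.sin (Real.pi / 4) = 1 / √2 := by
    rw [Real.sin_pi_div_four]
    have := Real.sq_sqrt (show (0 : ℝ) ≤ 2 by norm_num)
    field_simp
    exact this
  have h1 : ∫ θ, sphericalRadon g θ ∂(latitudeDirac 7 (1 / √2) abs_one_div_sqrt_two_le) =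
      ∫ θ, g θ * k θ ∂(surfaceMeasure 8) :=
    integral_latitudeDirac (d := 6) (by norm_num) hg
      (α := Real.pi / 4) ⟨by linarith [Real.pi_pos], by linarith [Real.pi_pos]⟩
      abs_one_div_sqrt_two_le hsin
  have h2 : ∫ θ, sphericalRadon g θ * barrelDensity |(θ : Euc 8) 7| ∂(surfaceMeasure 8) =
      ∫ θ, g θ * sphericalRadon (fun ζ : USphere 8 => profile 2 (96 / 15) (height ζ)) θ
        ∂(surfaceMeasure 8) := by
    rw [← integral_sphericalRadon_mul_zonal (d := 6) (by norm_num) hg (measurable_profile _ _)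
      (abs_profile_le 2 (by norm_num))]
    refine integral_congr_ae (.of_forall fun θ => ?_)
    exact congrArg _ (barrelDensity_eq_profile (abs_height_le_one θ))
  have h3 : ∀ θ : USphere 8,
      sphericalRadon (fun ζ : USphere 8 => profile 2 (96 / 15) (height ζ)) θ =
        16 * sphereArea 6 / 15 * radialFn (barrel 8) θ + 4 / 15 * k θ := fun θ => by
    refine (sphericalRadon_profile 2 (κ := 96 / 15) (by norm_num) θ).trans ((congrArg
      (fun x => 2 * sphereArea (2 * 2 + 2) * x) (integral_profile_two (m := 7) θ)).trans ?_)
    rw [radialFn_barrel (m := 7), show 2 * 2 + 2 = 6 from rfl, hk]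
    ring
  have hkint : Integrable (fun θ => g θ * k θ) (surfaceMeasure 8) := by
    have hw := (continuous_width (m := 7)).measurable
    refine ((integrable_inv_width (d := 6) (by norm_num)).const_mul
      (C * (2 * sphereArea 6))).mono' ?_ (.of_forall fun θ => ?_)
    · refine (hg.measurable.mul ?_).aestronglyMeasurable
      simp only [hk]
      fun_prop
    · have hnn : 0 ≤ √(width θ ^ 2 - (1 / √2) ^ 2) ^ 4 / width θ ^ 5 :=
        div_nonneg (by positivity) (pow_nonneg (width_nonneg _) _)
      have hA2 : 0 ≤ 2 * sphereArea 6 := by positivity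
      rw [norm_mul, hk, norm_mul, Real.norm_of_nonneg hnn, Real.norm_of_nonneg hA2, mul_assoc C]
      refine mul_le_mul (hC θ (mem_univ _)) (mul_le_mul_of_nonneg_left ?_ hA2)
        (mul_nonneg hA2 hnn) ((norm_nonneg _).trans (hC θ (mem_univ _)))
      exact sqrt_sub_sq_pow_div_le (d := 6) (width_nonneg θ) (by norm_num) _
  have hρ : Integrable (fun θ => radialFn (barrel 8) θ * g θ) (surfaceMeasure 8) :=
    integrable_surfaceMeasure ((isStarBody_barrel (m := 7)).continuous_radialFn.mul hg)
  have h4 : ∫ θ, g θ * sphericalRadon (fun ζ : USphere 8 => profile 2 (96 / 15) (height ζ)) θ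
      ∂(surfaceMeasure 8) = 16 * sphereArea 6 / 15 * ∫ θ, radialFn (barrel 8) θ * g θ
        ∂(surfaceMeasure 8) + 4 / 15 * ∫ θ, g θ * k θ ∂(surfaceMeasure 8) := by
    rw [← integral_const_mul, ← integral_const_mul, ← integral_add (hρ.const_mul _)
      (hkint.const_mul _)]
    refine integral_congr_ae (.of_forall fun θ => ?_)
    simp only [h3]
    ring
  rw [h1, h2, h4]
  field_simp
  ring

end DimensionEight

/-! ### A second difference test -/

section SecondDifferences

/-- The symmetric second difference of step `1/100`. -/
noncomputable def secondDiff (F : ℝ → ℝ) (z : ℝ) : ℝ := F (z + 1 / 100) - 2 * F z + F (z - 1 / 100)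

/-- A combination of second differences detecting that `F''` is not a non-increasing convex function
of `z²`. For such a function the values of `F''` at the nodes `0`, `4/5`, `11/10` satisfy
`F''(0) - 2 F''(4/5) + F''(11/10) ≥ 0`, since `0² + (11/10)² < 2 (4/5)²`; the inequality is strict by
a margin which allows for the step `1/100`. -/
noncomputable def nodeFunctional (F : ℝ → ℝ) : ℝ :=
  secondDiff F 0 - 2 * secondDiff F (4 / 5) + secondDiff F (11 / 10)

theorem nodeFunctional_sum {N : ℕ} (F : Fin N → ℝ → ℝ) :
    nodeFunctional (fun z => ∑ i, F i z) = ∑ i, nodeFunctional (F i) := by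
  simp only [nodeFunctional, secondDiff, Finset.sum_add_distrib, Finset.sum_sub_distrib,
    Finset.mul_sum, mul_add, mul_sub]

theorem nodeFunctional_affine_add (p q : ℝ) (F : ℝ → ℝ) :
    nodeFunctional (fun z => p + q * z + F z / 2) = nodeFunctional F / 2 := by
  simp only [nodeFunctional, secondDiff]
  ring

/-- The coefficients of the nine values of `F` in `nodeFunctional F` have absolute values adding up to
`16`. -/
theorem nodeFunctional_le {F G : ℝ → ℝ} {ε : ℝ} (h : ∀ z, |z| ≤ 12 / 10 → |F z - G z| ≤ ε) :
    nodeFunctional F ≤ nodeFunctional G + 16 * ε := by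
  have h' : ∀ z, |z| ≤ 12 / 10 → F z ≤ G z + ε ∧ G z - ε ≤ F z := fun z hz => by
    have := abs_le.1 (h z hz)
    constructor <;> linarith [this.1, this.2]
  have e : ∀ z : ℝ, -(12 / 10) ≤ z → z ≤ 12 / 10 → F z ≤ G z + ε ∧ G z - ε ≤ F z :=
    fun z h1 h2 => h' z (abs_le.2 ⟨h1, h2⟩)
  have a1 := e (0 + 1 / 100) (by norm_num) (by norm_num)
  have a2 := e 0 (by norm_num) (by norm_num)
  have a3 := e (0 - 1 / 100) (by norm_num) (by norm_num)
  have b1 := e (4 / 5 + 1 / 100) (by norm_num) (by norm_num)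
  have b2 := e (4 / 5) (by norm_num) (by norm_num)
  have b3 := e (4 / 5 - 1 / 100) (by norm_num) (by norm_num)
  have c1 := e (11 / 10 + 1 / 100) (by norm_num) (by norm_num)
  have c2 := e (11 / 10) (by norm_num) (by norm_num)
  have c3 := e (11 / 10 - 1 / 100) (by norm_num) (by norm_num)
  simp only [nodeFunctional, secondDiff]
  linarith [a1.1, a2.2, a3.1, b1.2, b2.1, b3.2, c1.1, c2.2, c3.1]

/-- The second derivative of the gauge is `1` on `(-1, 1)` and `0` on `(1, ∞)`, which is not a convex
function of `z²`. -/
theorem nodeFunctional_barrelGauge : nodeFunctional barrelGauge = -(1 / 100) ^ 2 := by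
  have h1 : ∀ z : ℝ, -1 < z → z < 1 → barrelGauge z = (1 + z ^ 2) / 2 := fun z h1 h2 =>
    if_pos (abs_lt.2 ⟨h1, h2⟩)
  have h2 : ∀ z : ℝ, 1 ≤ z → barrelGauge z = z := fun z hz => by
    rw [barrelGauge, abs_of_nonneg (by linarith), if_neg (not_lt.2 hz)]
  simp only [nodeFunctional, secondDiff]
  rw [h1 (0 + 1 / 100) (by norm_num) (by norm_num), h1 0 (by norm_num) (by norm_num),
    h1 (0 - 1 / 100) (by norm_num) (by norm_num), h1 (4 / 5 + 1 / 100) (by norm_num) (by norm_num),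
    h1 (4 / 5) (by norm_num) (by norm_num), h1 (4 / 5 - 1 / 100) (by norm_num) (by norm_num),
    h2 (11 / 10 + 1 / 100) (by norm_num), h2 (11 / 10) (by norm_num),
    h2 (11 / 10 - 1 / 100) (by norm_num)]
  norm_num

/-- The hat function `2 (δ - |x|)₊`, the second difference of `|x|`. -/
noncomputable def hat (δ x : ℝ) : ℝ := 2 * max (δ - |x|) 0

theorem abs_add_sub_two_mul_abs (x : ℝ) {δ : ℝ} (hδ : 0 ≤ δ) :
    |x + δ| - 2 * |x| + |x - δ| = hat δ x := by
  unfold hat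
  rcases abs_cases (x + δ) with h1 | h1 <;> rcases abs_cases (x - δ) with h2 | h2 <;>
    rcases abs_cases x with h3 | h3 <;> rcases max_cases (δ - |x|) 0 with h4 | h4 <;>
    linarith [h1.1, h1.2, h2.1, h2.2, h3.1, h3.2, h4.1, h4.2]

theorem secondDiff_abs (x b z : ℝ) :
    secondDiff (fun z => |x + z * b|) z = hat (|b| / 100) (x + z * b) := by
  rw [← abs_add_sub_two_mul_abs _ (by positivity), secondDiff]
  rcases abs_cases b with h | h
  · rw [h.1]
    have e1 : x + (z + 1 / 100) * b = x + z * b + b / 100 := by ring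
    have e2 : x + (z - 1 / 100) * b = x + z * b - b / 100 := by ring
    rw [e1, e2]
  · rw [h.1]
    have e1 : x + (z + 1 / 100) * b = x + z * b - -b / 100 := by ring
    have e2 : x + (z - 1 / 100) * b = x + z * b + -b / 100 := by ring
    rw [e1, e2]
    ring

/-- The function `t₊^{q/2}` is non-decreasing and convex for `q ≥ 2`. -/
theorem sqrt_pow_add_sqrt_pow {q : ℕ} (hq : 2 ≤ q) {y₁ y₂ y₃ : ℝ} (h : 2 * y₂ ≤ y₁ + y₃) :
    2 * √y₂ ^ q ≤ √y₁ ^ q + √y₃ ^ q := by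
  have hs : ∀ y : ℝ, √y ^ q = (max y 0) ^ ((q : ℝ) / 2) := fun y => by
    rcases le_total 0 y with hy | hy
    · rw [max_eq_left hy, Real.sqrt_eq_rpow, ← Real.rpow_mul_natCast hy]
      congr 1
      ring
    · rw [max_eq_right hy, Real.sqrt_eq_zero_of_nonpos hy, zero_pow (by omega),
        Real.zero_rpow (by positivity)]
  have hq' : (1 : ℝ) ≤ (q : ℝ) / 2 := by
    have : (2 : ℝ) ≤ q := by exact_mod_cast hq
    linarith
  rw [hs, hs, hs]
  have hc := (convexOn_rpow hq').2 (le_max_right y₁ 0) (le_max_right y₃ 0)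
    (show (0 : ℝ) ≤ 1 / 2 by norm_num) (show (0 : ℝ) ≤ 1 / 2 by norm_num) (by norm_num)
  simp only [smul_eq_mul] at hc
  have hm : max y₂ 0 ≤ 1 / 2 * max y₁ 0 + 1 / 2 * max y₃ 0 := by
    refine max_le ?_ (by positivity)
    linarith [le_max_left y₁ 0, le_max_left y₃ 0]
  have := Real.rpow_le_rpow (le_max_right _ _) hm (by linarith : 0 ≤ (q : ℝ) / 2)
  linarith

theorem nodeFunctional_abs (x b : ℝ) : nodeFunctional (fun z => |x + z * b|) =
    hat (|b| / 100) (x + 0 * b) - 2 * hat (|b| / 100) (x + 4 / 5 * b) +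
      hat (|b| / 100) (x + 11 / 10 * b) := by
  rw [nodeFunctional, secondDiff_abs, secondDiff_abs, secondDiff_abs]

theorem hat_nonneg (δ x : ℝ) : 0 ≤ hat δ x := mul_nonneg zero_le_two (le_max_right _ _)

theorem hat_le {δ : ℝ} (hδ : 0 ≤ δ) (x : ℝ) : hat δ x ≤ 2 * δ :=
  mul_le_mul_of_nonneg_left (max_le (by linarith [abs_nonneg x]) hδ) zero_le_two

theorem continuous_hat (δ : ℝ) : Continuous (hat δ) := by
  unfold hat; fun_prop

theorem integral_sub_two_mul_add {A B C : ℝ → ℝ} (hA : Integrable A) (hB : Integrable B)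
    (hC : Integrable C) :
    ∫ u, (A u - 2 * B u + C u) = (∫ u, A u) - 2 * (∫ u, B u) + ∫ u, C u := by
  rw [integral_add (f := fun u => A u - 2 * B u) (hA.sub (hB.const_mul 2)) hC,
    integral_sub hA (hB.const_mul 2), integral_const_mul]

/-- The averages of `z ↦ |r u + z b|` against `(1 - u²)^{q/2} du` have a second derivative
proportional to `(1 - (b z / r)²)₊^{q/2}`, a non-increasing convex function of `z²`. -/
theorem integral_nodeFunctional_nonneg {q : ℕ} (hq : 2 ≤ q) {r : ℝ} (hr : 0 ≤ r) (b : ℝ) :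
    0 ≤ ∫ u, √(1 - u ^ 2) ^ q * nodeFunctional (fun z => |r * u + z * b|) := by
  set δ := |b| / 100 with hδ
  have hδ0 : 0 ≤ δ := by positivity
  simp only [nodeFunctional_abs, ← hδ]
  rcases hr.eq_or_lt with rfl | hr
  -- for `r = 0` the hat function vanishes at the node `4/5`
  · refine integral_nonneg fun u => mul_nonneg (by positivity) ?_
    have h0 : hat δ (0 * u + 4 / 5 * b) = 0 := by
      rw [hat, max_eq_right, mul_zero]
      rw [zero_mul, zero_add, abs_mul, abs_of_nonneg (by norm_num : (0 : ℝ) ≤ 4 / 5)]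
      linarith [abs_nonneg b]
    rw [h0]
    have := hat_nonneg δ (0 * u + 0 * b)
    have := hat_nonneg δ (0 * u + 11 / 10 * b)
    linarith
  · have hWc : Continuous fun u : ℝ => √(1 - u ^ 2) ^ q := by fun_prop
    have hsupp : HasCompactSupport fun u : ℝ => √(1 - u ^ 2) ^ q :=
      HasCompactSupport.of_support_subset_isCompact isCompact_Icc fun u hu => by
        by_contra h
        exact hu (sqrt_one_sub_sq_pow_eq_zero (by omega) fun h' => h (Ioo_subset_Icc_self h'))
    have hint : ∀ z : ℝ, Integrable fun u => √(1 - u ^ 2) ^ q * hat δ (r * u + z * b) := fun z =>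
      (hWc.mul ((continuous_hat δ).comp (by fun_prop))).integrable_of_hasCompactSupport
        hsupp.mul_right
    -- translating each term puts the `z`-dependence on the weight `(1 - u²)₊^{q/2}`
    have hshift : ∀ z : ℝ, ∫ u, √(1 - u ^ 2) ^ q * hat δ (r * u + z * b) =
        ∫ y, √(1 - (y - z * (b / r)) ^ 2) ^ q * hat δ (r * y) := fun z => by
      rw [← integral_sub_right_eq_self (fun u => √(1 - u ^ 2) ^ q * hat δ (r * u + z * b))
        (z * (b / r))]
      refine integral_congr_ae (.of_forall fun y => ?_)
      have : r * (y - z * (b / r)) + z * b = r * y := by field_simp; ring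
      simp only [this]
    have hint2 : ∀ z : ℝ, Integrable fun y =>
        √(1 - (y - z * (b / r)) ^ 2) ^ q * hat δ (r * y) := fun z => by
      refine ((hint z).comp_sub_right (z * (b / r))).congr (.of_forall fun y => ?_)
      have : r * (y - z * (b / r)) + z * b = r * y := by field_simp; ring
      simp only [this]
    have e1 : ∀ u, √(1 - u ^ 2) ^ q * (hat δ (r * u + 0 * b) - 2 * hat δ (r * u + 4 / 5 * b) +
        hat δ (r * u + 11 / 10 * b)) = √(1 - u ^ 2) ^ q * hat δ (r * u + 0 * b) -
        2 * (√(1 - u ^ 2) ^ q * hat δ (r * u + 4 / 5 * b)) +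
        √(1 - u ^ 2) ^ q * hat δ (r * u + 11 / 10 * b) := fun u => by ring
    simp_rw [e1]
    rw [integral_sub_two_mul_add (hint _) (hint _) (hint _), hshift, hshift, hshift,
      ← integral_sub_two_mul_add (hint2 _) (hint2 _) (hint2 _)]
    refine integral_nonneg fun y => ?_
    have e2 : √(1 - (y - 0 * (b / r)) ^ 2) ^ q * hat δ (r * y) -
        2 * (√(1 - (y - 4 / 5 * (b / r)) ^ 2) ^ q * hat δ (r * y)) +
        √(1 - (y - 11 / 10 * (b / r)) ^ 2) ^ q * hat δ (r * y) =
        (√(1 - (y - 0 * (b / r)) ^ 2) ^ q + √(1 - (y - 11 / 10 * (b / r)) ^ 2) ^ q -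
          2 * √(1 - (y - 4 / 5 * (b / r)) ^ 2) ^ q) * hat δ (r * y) := by ring
    show 0 ≤ _
    rw [e2]
    by_cases hy : δ ≤ |r * y|
    · have : hat δ (r * y) = 0 := by rw [hat, max_eq_right (by linarith), mul_zero]
      rw [this, mul_zero]
    · refine mul_nonneg (sub_nonneg.2 (sqrt_pow_add_sqrt_pow hq ?_)) (hat_nonneg _ _)
      set c := b / r with hc
      have hyc : |y| ≤ |c| / 100 := by
        rw [not_le, abs_mul, abs_of_pos hr, hδ] at hy
        rw [hc, abs_div, abs_of_pos hr, div_div, le_div_iff₀ (by positivity)]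
        rw [lt_div_iff₀ (by norm_num)] at hy
        nlinarith
      have : y * c ≤ c ^ 2 / 100 := by
        calc y * c ≤ |y| * |c| := by rw [← abs_mul]; exact le_abs_self _
          _ ≤ |c| / 100 * |c| := mul_le_mul_of_nonneg_right hyc (abs_nonneg _)
          _ = c ^ 2 / 100 := by rw [← sq_abs c]; ring
      nlinarith [sq_nonneg c]

end SecondDifferences

/-! ### Support functions of zonotopes and of the polar of the barrel -/

section Zonoid

variable {m : ℕ}

/-- The support function of a zonotope. -/
theorem exists_zonotope_support {n N : ℕ} (a b : Fin N → Euc n) (x : Euc n) :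
    (∀ y ∈ ∑ i, segment ℝ (a i) (b i), inner ℝ x y ≤ ∑ i, max (inner ℝ x (a i)) (inner ℝ x (b i))) ∧
    ∃ y ∈ ∑ i, segment ℝ (a i) (b i),
      inner ℝ x y = ∑ i, max (inner ℝ x (a i)) (inner ℝ x (b i)) := by
  constructor
  · intro y hy
    obtain ⟨g, hg, rfl⟩ := Set.mem_fintype_sum _ _ |>.1 hy
    rw [inner_sum]
    refine Finset.sum_le_sum fun i _ => ?_
    obtain ⟨s, t, hs, ht, hst, h⟩ := hg i
    rw [← h, inner_add_right, inner_smul_right, inner_smul_right]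
    calc s * inner ℝ x (a i) + t * inner ℝ x (b i) ≤ s * max (inner ℝ x (a i)) (inner ℝ x (b i)) +
          t * max (inner ℝ x (a i)) (inner ℝ x (b i)) :=
        add_le_add (mul_le_mul_of_nonneg_left (le_max_left _ _) hs)
          (mul_le_mul_of_nonneg_left (le_max_right _ _) ht)
      _ = _ := by rw [← add_mul, hst, one_mul]
  · refine ⟨∑ i, if inner ℝ x (a i) ≤ inner ℝ x (b i) then b i else a i,
      (Set.mem_fintype_sum _ _).2 ⟨_, fun i => ?_, rfl⟩, ?_⟩
    · split_ifs
      · exact right_mem_segment ℝ _ _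
      · exact left_mem_segment ℝ _ _
    · rw [inner_sum]
      refine Finset.sum_congr rfl fun i _ => ?_
      split_ifs with h
      · rw [max_eq_right h]
      · rw [max_eq_left (not_le.1 h).le]

theorem continuous_nodeFunctional_abs (b : ℝ) :
    Continuous fun x : ℝ => nodeFunctional fun z => |x + z * b| := by
  simp only [nodeFunctional_abs]
  have := continuous_hat (|b| / 100)
  fun_prop

theorem abs_nodeFunctional_abs_le (x b : ℝ) :
    |nodeFunctional (fun z => |x + z * b|)| ≤ 8 * (|b| / 100) := by
  have hδ : 0 ≤ |b| / 100 := by positivity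
  rw [nodeFunctional_abs, abs_le]
  constructor <;> linarith [hat_nonneg (|b| / 100) (x + 0 * b), hat_le hδ (x + 0 * b),
    hat_nonneg (|b| / 100) (x + 4 / 5 * b), hat_le hδ (x + 4 / 5 * b),
    hat_nonneg (|b| / 100) (x + 11 / 10 * b), hat_le hδ (x + 11 / 10 * b)]

theorem continuous_nodeFunctional_abs_inner (v : Euc (m + 1)) : Continuous fun η : USphere m =>
    nodeFunctional fun z => |inner ℝ (equatorIncl m η + z • pole m) v| := by
  simp only [inner_equatorIncl_add]
  exact (continuous_nodeFunctional_abs (v (Fin.last m))).comp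
    (continuous_subtype_val.inner continuous_const)

/-- The test for a segment: averaging over `η` replaces `⟨η, v⟩` by `‖v‖ u` with `u` distributed
according to `(1 - u²)^{(m-3)/2} du`. -/
theorem integral_nodeFunctional_abs_inner_nonneg (hm : 5 ≤ m) (v : Euc (m + 1)) :
    0 ≤ ∫ η : USphere m, nodeFunctional (fun z => |inner ℝ (equatorIncl m η + z • pole m) v|)
      ∂surfaceMeasure m := by
  obtain ⟨q, rfl⟩ : ∃ q, m = q + 3 := ⟨m - 3, by omega⟩
  simp only [inner_equatorIncl_add]
  have h := integral_sphere_inner (V := Euc (q + 3)) (d := q + 2) (by omega) (by simp)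
    (horizontal v) (continuous_nodeFunctional_abs (v (Fin.last (q + 3)))).measurable
    (fun x => abs_nodeFunctional_abs_le x _)
  rw [surfaceMeasure, h]
  refine mul_nonneg (sphereArea_pos (by omega)).le ?_
  have h2 := integral_cosPowMeasure_succ q fun u =>
    nodeFunctional fun z => |‖horizontal v‖ * u + z * v (Fin.last (q + 3))|
  refine le_of_le_of_eq ?_ h2.symm
  rw [setIntegral_Ioo_sqrt_one_sub_sq_pow (by omega)]
  exact integral_nodeFunctional_nonneg (by omega) (norm_nonneg _) _

/-- Up to an affine function of `z`, the support function of a segment is half the absolute value of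
a linear functional. -/
theorem nodeFunctional_max_inner (a b : Euc (m + 1)) (η : Euc m) :
    nodeFunctional (fun z => max (inner ℝ (equatorIncl m η + z • pole m) a)
      (inner ℝ (equatorIncl m η + z • pole m) b)) =
    nodeFunctional (fun z => |inner ℝ (equatorIncl m η + z • pole m) (a - b)|) / 2 := by
  rw [← nodeFunctional_affine_add
    ((inner ℝ η (horizontal a) + inner ℝ η (horizontal b)) / 2)
    ((a (Fin.last m) + b (Fin.last m)) / 2)]
  congr 1
  funext z
  rw [inner_sub_right, max_def, inner_equatorIncl_add, inner_equatorIncl_add]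
  split_ifs with h
  · rw [abs_of_nonpos (by linarith)]; ring
  · rw [abs_of_nonneg (by linarith [not_le.1 h])]; ring

/-- The rotation averages of the support function of a zonotope pass the second difference
test. -/
theorem integral_nodeFunctional_zonotope_nonneg (hm : 5 ≤ m) {N : ℕ} (a b : Fin N → Euc (m + 1)) :
    0 ≤ ∫ η : USphere m, nodeFunctional (fun z =>
      ∑ i, max (inner ℝ (equatorIncl m η + z • pole m) (a i))
        (inner ℝ (equatorIncl m η + z • pole m) (b i))) ∂surfaceMeasure m := by
  simp only [nodeFunctional_sum, nodeFunctional_max_inner]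
  rw [integral_finsetSum _ fun i _ =>
    (integrable_surfaceMeasure (continuous_nodeFunctional_abs_inner _)).div_const 2]
  refine Finset.sum_nonneg fun i _ => ?_
  rw [integral_div]
  exact div_nonneg (integral_nodeFunctional_abs_inner_nonneg hm _) zero_le_two

/-- The support function of the polar of the barrel is the gauge of the barrel. -/
theorem polarBody_barrel_support (η : USphere m) (z : ℝ) :
    (∀ y ∈ polarBody (barrel (m + 1)),
      inner ℝ (equatorIncl m η + z • pole m) y ≤ barrelGauge z) ∧
    ∃ y ∈ polarBody (barrel (m + 1)),
      inner ℝ (equatorIncl m η + z • pole m) y = barrelGauge z := by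
  constructor
  · intro y hy
    have h := hy _ (inv_barrelGauge_smul_mem_barrel η z)
    rw [inner_smul_left] at h
    have hp := barrelGauge_pos z
    rw [← mul_le_mul_iff_right₀ (inv_pos.2 hp), inv_mul_cancel₀ hp.ne']
    exact h
  · obtain ⟨y, hy, h⟩ := exists_support_barrelGauge η z
    exact ⟨y, fun x hx => (inner_le_of_mem_barrel hx y).trans hy, h⟩

/-- Support functions of nearby sets are close to each other. -/
theorem support_le_of_hausdorffEDist_lt {n : ℕ} {K Z : Set (Euc n)} {ε : ℝ}
    (h : Metric.hausdorffEDist K Z < ENNReal.ofReal ε) {x : Euc n} (hx : ‖x‖ ≤ 2) {s t : ℝ}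
    (hs : ∃ y ∈ K, inner ℝ x y = s) (ht : ∀ y ∈ Z, inner ℝ x y ≤ t) : s ≤ t + 2 * ε := by
  obtain ⟨y, hy, rfl⟩ := hs
  obtain ⟨w, hw, hd⟩ := Metric.exists_edist_lt_of_hausdorffEDist_lt hy h
  rw [edist_dist, ENNReal.ofReal_lt_ofReal_iff_of_nonneg dist_nonneg, dist_eq_norm] at hd
  have h1 : inner ℝ x y = inner ℝ x w + inner ℝ x (y - w) := by rw [inner_sub_right]; ring
  have h2 : inner ℝ x (y - w) ≤ 2 * ε := (real_inner_le_norm _ _).trans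
    (mul_le_mul hx hd.le (norm_nonneg _) zero_le_two)
  linarith [ht w hw]

/-- The rotation averages of the support functions pass the second difference test for zonotopes, and
fail it for the polar of the barrel; Hausdorff convergence is uniform convergence of support
functions on bounded sets. -/
theorem not_isZonoid_polarBody_barrel (hm : 5 ≤ m) :
    ¬ IsZonoid (polarBody (barrel (m + 1))) := by
  rintro ⟨-, Z, hZ, hlim⟩
  have hε : (0 : ENNReal) < ENNReal.ofReal (1 / 1000000) := ENNReal.ofReal_pos.2 (by norm_num)
  -- support functions within `2 · 10⁻⁶` change the test by at most `32 · 10⁻⁶ < (1/100)²`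
  obtain ⟨k, hk⟩ := (hlim.eventually_lt_const hε).exists
  obtain ⟨N, a, b, hab⟩ := hZ k
  have hsup : ∀ η : USphere m, ∀ z : ℝ, |z| ≤ 12 / 10 →
      |∑ i, max (inner ℝ (equatorIncl m η + z • pole m) (a i))
        (inner ℝ (equatorIncl m η + z • pole m) (b i)) - barrelGauge z| ≤ 2 * (1 / 1000000) := by
    intro η z hz
    have hx : ‖equatorIncl m η + z • pole m‖ ≤ 2 := by
      refine abs_le_of_sq_le_sq' ?_ zero_le_two |>.2
      rw [norm_sq_eq_horizontal, horizontal_equatorIncl_add, last_equatorIncl_add,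
        norm_coe_uSphere, ← sq_abs z]
      nlinarith [abs_nonneg z]
    obtain ⟨h1, h2⟩ := exists_zonotope_support a b (equatorIncl m η + z • pole m)
    obtain ⟨h3, h4⟩ := polarBody_barrel_support η z
    rw [hab] at hk
    rw [abs_le]
    constructor
    · have := support_le_of_hausdorffEDist_lt (by rwa [Metric.hausdorffEDist_comm] at hk) hx h4 h1
      linarith
    · have := support_le_of_hausdorffEDist_lt hk hx h2 h3
      linarith
  have hneg : ∀ η : USphere m, nodeFunctional (fun z =>
      ∑ i, max (inner ℝ (equatorIncl m η + z • pole m) (a i))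
        (inner ℝ (equatorIncl m η + z • pole m) (b i))) ≤ -(1 / 100000) := fun η => by
    have := nodeFunctional_le (hsup η)
    rw [nodeFunctional_barrelGauge] at this
    linarith
  have h0 := integral_nodeFunctional_zonotope_nonneg hm a b
  have hint : Integrable (fun η : USphere m => nodeFunctional (fun z =>
      ∑ i, max (inner ℝ (equatorIncl m η + z • pole m) (a i))
        (inner ℝ (equatorIncl m η + z • pole m) (b i)))) (surfaceMeasure m) := by
    simp only [nodeFunctional_sum, nodeFunctional_max_inner]
    exact integrable_finsetSum _ fun i _ =>
      (integrable_surfaceMeasure (continuous_nodeFunctional_abs_inner _)).div_const 2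
  have h1 := integral_mono hint (integrable_surfaceMeasure continuous_const) hneg
  rw [integral_const, smul_eq_mul] at h1
  have := sphereArea_pos (d := m) (by omega)
  rw [sphereArea] at this
  linarith

end Zonoid

/-! ### Third differences -/

section ThirdDifferences

/-- The third difference `F(x) - 3 F(x+h) + 3 F(x+2h) - F(x+3h)` of step `h`, which is non-negative
where the third derivative is non-positive and `h ≥ 0`. -/
noncomputable def thirdDiff (F : ℝ → ℝ) (h x : ℝ) : ℝ :=
  F x - 3 * F (x + h) + 3 * F (x + 2 * h) - F (x + 3 * h)

/-- A second order expansion by l'Hôpital's rule, for a function with one derivative in a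
neighbourhood. -/
theorem tendsto_div_sq {M M' : ℝ → ℝ} {m : ℝ} (hM : ∀ᶠ x in 𝓝 0, HasDerivAt M (M' x) x)
    (h0 : M 0 = 0) (h0' : M' 0 = 0) (hm : HasDerivAt M' m 0) :
    Tendsto (fun h => M h / h ^ 2) (𝓝[>] 0) (𝓝 (m / 2)) := by
  refine HasDerivAt.lhopital_zero_nhdsGT (f' := M') (g' := fun h => 2 * h)
    (hM.filter_mono nhdsWithin_le_nhds) (.of_forall fun x => by simpa using hasDerivAt_pow 2 x)
    (eventually_mem_nhdsWithin.mono fun x hx => mul_ne_zero two_ne_zero (ne_of_gt hx)) ?_ ?_ ?_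
  · have := hM.self_of_nhds.continuousAt.tendsto
    rw [h0] at this
    exact this.mono_left nhdsWithin_le_nhds
  · have : Continuous fun x : ℝ => x ^ 2 := by fun_prop
    simpa using (this.tendsto 0).mono_left (nhdsWithin_le_nhds (s := Ioi 0))
  · refine (hm.tendsto_slope_zero_right.div_const 2).congr fun t => ?_
    rw [zero_add, h0', sub_zero, smul_eq_mul]
    ring

theorem eventually_hasDerivAt_comp {F F' : ℝ → ℝ} {x₀ : ℝ}
    (hF : ∀ᶠ x in 𝓝 x₀, HasDerivAt F (F' x) x) (s : ℝ) :
    ∀ᶠ h in 𝓝 (0 : ℝ), HasDerivAt (fun h => F (x₀ + s * h)) (s * F' (x₀ + s * h)) h := by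
  have hc : Continuous fun h : ℝ => x₀ + s * h := by fun_prop
  have ht : Tendsto (fun h : ℝ => x₀ + s * h) (𝓝 0) (𝓝 x₀) := by simpa using hc.tendsto 0
  filter_upwards [ht.eventually hF] with h hh
  have hl : HasDerivAt (fun h : ℝ => x₀ + s * h) s h := by
    simpa using ((hasDerivAt_id h).const_mul s).const_add x₀
  have := hh.comp h hl
  rwa [mul_comm] at this

theorem hasDerivAt_comp_zero {F' : ℝ → ℝ} {x₀ a : ℝ} (hF : HasDerivAt F' a x₀) (s : ℝ) :
    HasDerivAt (fun h => F' (x₀ + s * h)) (s * a) 0 := by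
  have hl : HasDerivAt (fun h : ℝ => x₀ + s * h) s 0 := by
    simpa using ((hasDerivAt_id (0 : ℝ)).const_mul s).const_add x₀
  have h1 : HasDerivAt F' a (x₀ + s * 0) := by simpa using hF
  have := h1.comp 0 hl
  rwa [mul_comm] at this

/-- The third differences of a function around a point where the second derivative jumps. -/
theorem tendsto_thirdDiff_div_sq {P A A' B B' : ℝ → ℝ} {x₀ a b : ℝ}
    (hA : ∀ᶠ x in 𝓝 x₀, HasDerivAt A (A' x) x) (hB : ∀ᶠ x in 𝓝 x₀, HasDerivAt B (B' x) x)
    (hA' : HasDerivAt A' a x₀) (hB' : HasDerivAt B' b x₀) (h0 : A x₀ = B x₀) (h1 : A' x₀ = B' x₀)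
    (hPA : ∀ᶠ x in 𝓝 x₀, x < x₀ → P x = A x) (hPB : ∀ᶠ x in 𝓝 x₀, x₀ ≤ x → P x = B x) :
    Tendsto (fun h => thirdDiff P h (x₀ - h) / h ^ 2) (𝓝[>] 0) (𝓝 ((a - b) / 2)) := by
  have key := tendsto_div_sq
    (M := fun h => A (x₀ + -1 * h) - 3 * B x₀ + 3 * B (x₀ + 1 * h) - B (x₀ + 2 * h))
    (M' := fun h => -1 * A' (x₀ + -1 * h) + 3 * (1 * B' (x₀ + 1 * h)) - 2 * B' (x₀ + 2 * h))
    (m := a - b) ?_ ?_ ?_ ?_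
  · refine key.congr' ?_
    have ht : ∀ s : ℝ, Tendsto (fun h : ℝ => x₀ + s * h) (𝓝[>] 0) (𝓝 x₀) := fun s => by
      have hc : Continuous fun h : ℝ => x₀ + s * h := by fun_prop
      simpa using (hc.tendsto 0).mono_left (nhdsWithin_le_nhds (s := Ioi 0))
    filter_upwards [(ht (-1)).eventually hPA, (ht 1).eventually hPB, (ht 2).eventually hPB,
      eventually_mem_nhdsWithin] with h e1 e2 e3 hpos
    have hpos' : 0 < h := hpos
    rw [← e1 (by linarith), ← e2 (by linarith), ← e3 (by linarith),
      ← hPB.self_of_nhds le_rfl, thirdDiff]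
    rw [show x₀ - h + h = x₀ by ring, show x₀ - h + 2 * h = x₀ + 1 * h by ring,
      show x₀ - h + 3 * h = x₀ + 2 * h by ring, show x₀ - h = x₀ + -1 * h by ring]
  · filter_upwards [eventually_hasDerivAt_comp hA (-1), eventually_hasDerivAt_comp hB 1,
      eventually_hasDerivAt_comp hB 2] with h e1 e2 e3
    exact ((e1.sub_const (3 * B x₀)).add (e2.const_mul 3)).sub e3
  · simp only [mul_zero, add_zero, h0]; ring
  · simp only [mul_zero, add_zero, h1]; ring
  · have := (((hasDerivAt_comp_zero hA' (-1)).const_mul (-1)).add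
      (((hasDerivAt_comp_zero hB' 1).const_mul 1).const_mul 3)).sub
      ((hasDerivAt_comp_zero hB' 2).const_mul 2)
    exact this.congr_deriv (by ring)

/-- The sum of two consecutive second differences. -/
theorem tendsto_secondDiff_add_secondDiff {F F' : ℝ → ℝ} {x₀ a : ℝ}
    (hF : ∀ᶠ x in 𝓝 x₀, HasDerivAt F (F' x) x) (hF' : HasDerivAt F' a x₀) :
    Tendsto (fun h => (F (x₀ - h) - F x₀ - F (x₀ + h) + F (x₀ + 2 * h)) / h ^ 2) (𝓝[>] 0)
      (𝓝 (2 * a)) := by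
  have key := tendsto_div_sq
    (M := fun h => F (x₀ + -1 * h) - F x₀ - F (x₀ + 1 * h) + F (x₀ + 2 * h))
    (M' := fun h => -1 * F' (x₀ + -1 * h) - 1 * F' (x₀ + 1 * h) + 2 * F' (x₀ + 2 * h))
    (m := 4 * a) ?_ ?_ ?_ ?_
  · rw [show 4 * a / 2 = 2 * a by ring] at key
    refine key.congr fun h => ?_
    rw [neg_one_mul, one_mul, ← sub_eq_add_neg]
  · filter_upwards [eventually_hasDerivAt_comp hF (-1), eventually_hasDerivAt_comp hF 1,
      eventually_hasDerivAt_comp hF 2] with h e1 e2 e3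
    exact ((e1.sub_const (F x₀)).sub e2).add e3
  · simp only [mul_zero, add_zero]; ring
  · simp only [mul_zero, add_zero]; ring
  · have := (((hasDerivAt_comp_zero hF' (-1)).const_mul (-1)).sub
      ((hasDerivAt_comp_zero hF' 1).const_mul 1)).add
      ((hasDerivAt_comp_zero hF' 2).const_mul 2)
    exact this.congr_deriv (by ring)

end ThirdDifferences

/-! ### The jump of the curvature of the barrel at height `1/√2` -/

section BarrelProfile

theorem hasDerivAt_one_sub_rpow (p : ℝ) {x : ℝ} (hx : x < 1) :
    HasDerivAt (fun x : ℝ => (1 - x) ^ p) (-(p * (1 - x) ^ (p - 1))) x := by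
  have h := ((hasDerivAt_id x).const_sub 1).rpow_const (p := p) (Or.inl (by simp; linarith))
  exact h.congr_deriv (by simp only [id]; ring)

theorem hasDerivAt_rpow_mul_one_sub_rpow (r p : ℝ) {x : ℝ} (h0 : 0 < x) (hx : x < 1) :
    HasDerivAt (fun x : ℝ => x ^ r * (1 - x) ^ p)
      (r * (x ^ (r - 1) * (1 - x) ^ p) - p * (x ^ r * (1 - x) ^ (p - 1))) x := by
  have h := (Real.hasDerivAt_rpow_const (p := r) (Or.inl h0.ne')).mul (hasDerivAt_one_sub_rpow p hx)
  exact h.congr_deriv (by ring)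

/-- The density of the radial function of the barrel in `ℝ^{d+2}` in the variable `x = t²`, up to
the factor `x^{-1/2}`: for `n = d + 2` it is `ρ_B (1 - t²)^{(n-3)/2}`. -/
noncomputable def barrelProfile (d : ℕ) (x : ℝ) : ℝ := √(1 - x) ^ (d - 1) * barrelRadial √x

theorem barrelProfile_of_lt {d : ℕ} (hd : 0 < d) {x : ℝ} (h0 : 0 ≤ x) (hx : x < 1 / 2) :
    barrelProfile d x = 2 * (1 - x) ^ ((d : ℝ) / 2) := by
  rw [barrelProfile, barrelRadial, if_pos, Real.sq_sqrt h0, Real.sqrt_eq_rpow,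
    mul_left_comm, ← pow_succ, Nat.sub_add_cancel hd, ← Real.rpow_mul_natCast (by linarith)]
  · ring_nf
  · rwa [lt_one_div_sqrt_two_iff (Real.sqrt_nonneg _), Real.sq_sqrt h0]

theorem barrelProfile_of_le {d : ℕ} (hd : 0 < d) {x : ℝ} (h0 : 1 / 2 ≤ x) (hx : x < 1) :
    barrelProfile d x = x ^ (-(1 / 2) : ℝ) * (1 - x) ^ ((d : ℝ) / 2 - 1 / 2) := by
  rw [barrelProfile, barrelRadial, if_neg, Real.sqrt_eq_rpow, Real.sqrt_eq_rpow,
    ← Real.rpow_mul_natCast (by linarith), Real.rpow_neg (by linarith), Nat.cast_sub hd,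
    one_div (x ^ (1 / 2 : ℝ)), mul_comm]
  · congr 2
    push_cast
    ring
  · rw [lt_one_div_sqrt_two_iff (Real.sqrt_nonneg _), Real.sq_sqrt (by linarith)]
    exact not_lt.2 h0

theorem continuous_barrelProfile (d : ℕ) : Continuous (barrelProfile d) := by
  unfold barrelProfile
  have := continuous_barrelRadial
  fun_prop

/-- At `x = 1/2` the profile has a continuous derivative, and its second derivative jumps up by
`(1/2)^{d/2 - 3}`. -/
theorem tendsto_thirdDiff_barrelProfile {d : ℕ} (hd : 0 < d) :
    Tendsto (fun h => thirdDiff (barrelProfile d) h (1 / 2 - h) / h ^ 2) (𝓝[>] 0)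
      (𝓝 (-(1 / 2 : ℝ) ^ ((d : ℝ) / 2 - 3) / 2)) := by
  set p : ℝ := (d : ℝ) / 2 with hp
  have hmem : ∀ᶠ x : ℝ in 𝓝 (1 / 2), x ∈ Ioo (0 : ℝ) 1 :=
    isOpen_Ioo.mem_nhds ⟨by norm_num, by norm_num⟩
  have hA : ∀ᶠ x : ℝ in 𝓝 (1 / 2), HasDerivAt (fun x : ℝ => 2 * (1 - x) ^ p)
      (2 * -(p * (1 - x) ^ (p - 1))) x :=
    hmem.mono fun x hx => (hasDerivAt_one_sub_rpow p hx.2).const_mul 2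
  have hB : ∀ᶠ x : ℝ in 𝓝 (1 / 2), HasDerivAt
      (fun x : ℝ => x ^ (-(1 / 2) : ℝ) * (1 - x) ^ (p - 1 / 2))
      (-(1 / 2) * (x ^ (-(1 / 2) - 1 : ℝ) * (1 - x) ^ (p - 1 / 2)) -
        (p - 1 / 2) * (x ^ (-(1 / 2) : ℝ) * (1 - x) ^ (p - 1 / 2 - 1))) x :=
    hmem.mono fun x hx => hasDerivAt_rpow_mul_one_sub_rpow _ _ hx.1 hx.2
  have hA' := ((hasDerivAt_one_sub_rpow (p - 1) (x := 1 / 2) (by norm_num)).const_mul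
    p).neg.const_mul 2
  have hB' := ((hasDerivAt_rpow_mul_one_sub_rpow (-(1 / 2) - 1) (p - 1 / 2) (x := 1 / 2)
    (by norm_num) (by norm_num)).const_mul (-(1 / 2))).sub
    ((hasDerivAt_rpow_mul_one_sub_rpow (-(1 / 2)) (p - 1 / 2 - 1) (x := 1 / 2)
    (by norm_num) (by norm_num)).const_mul (p - 1 / 2))
  have e : (1 - 1 / 2 : ℝ) = 1 / 2 := by norm_num
  have hh : (0 : ℝ) < 1 / 2 := by norm_num
  have e1 : (1 / 2 : ℝ) ^ (p - 1) = (1 / 2) ^ (p - 3) / 4 := by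
    rw [show p - 1 = (p - 3) + (2 : ℕ) by push_cast; ring, Real.rpow_add_natCast hh.ne']
    ring
  have e2 : (1 / 2 : ℝ) ^ (p - 1 - 1) = (1 / 2) ^ (p - 3) / 2 := by
    rw [show p - 1 - 1 = (p - 3) + 1 by ring, Real.rpow_add_one hh.ne']
    ring
  have e3 : (1 / 2 : ℝ) ^ p = (1 / 2) ^ (p - 3) / 8 := by
    rw [show p = (p - 3) + (3 : ℕ) by push_cast; ring, Real.rpow_add_natCast hh.ne']
    ring_nf
  have key := tendsto_thirdDiff_div_sq (P := barrelProfile d) hA hB hA' hB' ?_ ?_ ?_ ?_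
  · convert key using 2
    simp only [e, ← Real.rpow_add hh]
    rw [e2, show -(1 / 2) - 1 - 1 + (p - 1 / 2) = p - 3 by ring,
      show -(1 / 2) - 1 + (p - 1 / 2 - 1) = p - 3 by ring,
      show -(1 / 2) + (p - 1 / 2 - 1 - 1) = p - 3 by ring]
    ring
  · simp only [e, ← Real.rpow_add hh]
    rw [e3, show -(1 / 2) + (p - 1 / 2) = p - 1 by ring, e1]
    ring
  · simp only [e, ← Real.rpow_add hh]
    rw [e1, show -(1 / 2) - 1 + (p - 1 / 2) = p - 1 - 1 by ring,
      show -(1 / 2) + (p - 1 / 2 - 1) = p - 1 - 1 by ring, e2]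
    ring
  · exact hmem.mono fun x hx hx2 => barrelProfile_of_lt hd hx.1.le hx2
  · exact hmem.mono fun x hx hx2 => barrelProfile_of_le hd hx2 hx.2

end BarrelProfile

/-! ### Third differences of truncated powers -/

section ThirdDifferencesOfPowers

theorem hasDerivAt_sqrt_pow {q : ℕ} (hq : 4 ≤ q) (t : ℝ) :
    HasDerivAt (fun t : ℝ => √t ^ q) (q / 2 * √t ^ (q - 2)) t := by
  rcases lt_trichotomy t 0 with ht | rfl | ht
  · rw [Real.sqrt_eq_zero_of_nonpos ht.le, zero_pow (by omega), mul_zero]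
    refine (hasDerivAt_const t (0 : ℝ)).congr_of_eventuallyEq ?_
    filter_upwards [Iio_mem_nhds ht] with s hs
    rw [Real.sqrt_eq_zero_of_nonpos (le_of_lt hs), zero_pow (by omega)]
  · rw [Real.sqrt_zero, zero_pow (by omega), mul_zero, hasDerivAt_iff_isLittleO_nhds_zero]
    refine Asymptotics.IsBigO.trans_isLittleO (g := fun h : ℝ => h ^ 2) ?_
      (Asymptotics.isLittleO_pow_id (by norm_num))
    refine Asymptotics.IsBigO.of_bound 1 ?_
    filter_upwards [Icc_mem_nhds (show (-1 : ℝ) < 0 by norm_num) one_pos] with h hh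
    have hnn : 0 ≤ √h ^ q := pow_nonneg (Real.sqrt_nonneg _) _
    rw [zero_add, Real.sqrt_zero, zero_pow (by omega), smul_zero, sub_zero, sub_zero,
      Real.norm_of_nonneg hnn,
      Real.norm_of_nonneg (sq_nonneg h), one_mul]
    have h1 : √h ≤ 1 := Real.sqrt_le_one.2 hh.2
    refine (pow_le_pow_of_le_one (Real.sqrt_nonneg _) h1 hq).trans ?_
    rcases le_total 0 h with h0 | h0
    · rw [show 4 = 2 * 2 by rfl, pow_mul, Real.sq_sqrt h0]
    · rw [Real.sqrt_eq_zero_of_nonpos h0, zero_pow (by norm_num)]; positivity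
  · refine ((Real.hasDerivAt_sqrt ht.ne').pow q).congr_deriv ?_
    have hs : 0 < √t := Real.sqrt_pos.2 ht
    rw [show q - 1 = (q - 2) + 1 by omega, pow_succ]
    field_simp

/-- The second derivative of `t₊^{q/2}` is non-decreasing for `q ≥ 4`. -/
theorem thirdDiff_sqrt_sub_pow_nonneg {q : ℕ} (hq : 4 ≤ q) {h : ℝ} (y x : ℝ) (hh : 0 ≤ h) :
    0 ≤ thirdDiff (fun x => √(y - x) ^ q) h x := by
  -- the second difference is non-decreasing, because the derivative `(q/2) t₊^{q/2 - 1}` is convex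
  have hmono : Monotone fun t : ℝ => √(t + 2 * h) ^ q - 2 * √(t + h) ^ q + √t ^ q := by
    have hd : ∀ t, HasDerivAt (fun t : ℝ => √(t + 2 * h) ^ q - 2 * √(t + h) ^ q + √t ^ q)
        (q / 2 * √(t + 2 * h) ^ (q - 2) - 2 * (q / 2 * √(t + h) ^ (q - 2)) +
          q / 2 * √t ^ (q - 2)) t := fun t =>
      (((hasDerivAt_sqrt_pow hq _).comp_add_const t (2 * h)).sub
        (((hasDerivAt_sqrt_pow hq _).comp_add_const t h).const_mul 2)).add (hasDerivAt_sqrt_pow hq t)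
    refine monotone_of_deriv_nonneg (fun t => (hd t).differentiableAt) fun t => ?_
    rw [(hd t).deriv]
    have h1 := sqrt_pow_add_sqrt_pow (q := q - 2) (by omega) (y₁ := t + 2 * h) (y₂ := t + h)
      (y₃ := t) (by linarith)
    have h2 : (0 : ℝ) ≤ q / 2 := by positivity
    nlinarith [mul_nonneg h2 (sub_nonneg.2 h1)]
  have h1 := hmono (show y - (x + 3 * h) ≤ y - (x + 2 * h) by linarith)
  simp only at h1
  rw [show y - (x + 3 * h) + 2 * h = y - (x + h) by ring,
    show y - (x + 3 * h) + h = y - (x + 2 * h) by ring,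
    show y - (x + 2 * h) + 2 * h = y - x by ring,
    show y - (x + 2 * h) + h = y - (x + h) by ring] at h1
  rw [thirdDiff]
  linarith

/-- Summation by parts. -/
theorem integral_mul_thirdDiff {F ψ : ℝ → ℝ} (hF : Continuous F) (hψ : Continuous ψ)
    (hs : HasCompactSupport ψ) (h : ℝ) :
    ∫ x, F x * thirdDiff ψ (-h) x = ∫ x, thirdDiff F h x * ψ x := by
  have hi : ∀ a, Integrable fun x => F (x + a) * ψ x := fun a =>
    ((hF.comp (by fun_prop)).mul hψ).integrable_of_hasCompactSupport hs.mul_left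
  have hi' : ∀ a, Integrable fun x => F x * ψ (x + -a) := fun a => by
    refine ((hi a).comp_sub_right a).congr (.of_forall fun x => ?_)
    simp only [sub_eq_add_neg, neg_add_cancel_right]
  have hsh : ∀ a, ∫ x, F x * ψ (x + -a) = ∫ x, F (x + a) * ψ x := fun a => by
    rw [← integral_sub_right_eq_self (fun x => F (x + a) * ψ x) a]
    simp only [sub_eq_add_neg, neg_add_cancel_right]
  have expand : ∀ {A B C D : ℝ → ℝ}, Integrable A → Integrable B → Integrable C → Integrable D →
      ∫ x, (A x - 3 * B x + 3 * C x - D x) =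
        (∫ x, A x) - 3 * (∫ x, B x) + 3 * (∫ x, C x) - ∫ x, D x := by
    intro A B C D hA hB hC hD
    rw [integral_sub (f := fun x => A x - 3 * B x + 3 * C x)
        ((hA.sub (hB.const_mul 3)).add (hC.const_mul 3)) hD,
      integral_add (f := fun x => A x - 3 * B x) (hA.sub (hB.const_mul 3)) (hC.const_mul 3),
      integral_sub hA (hB.const_mul 3), integral_const_mul, integral_const_mul]
  calc ∫ x, F x * thirdDiff ψ (-h) x
      = ∫ x, (F x * ψ (x + -0) - 3 * (F x * ψ (x + -h)) + 3 * (F x * ψ (x + -(2 * h))) -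
          F x * ψ (x + -(3 * h))) := by
        refine integral_congr_ae (.of_forall fun x => ?_)
        simp only [thirdDiff, neg_zero, add_zero, mul_neg]
        ring
    _ = ∫ x, (F (x + 0) * ψ x - 3 * (F (x + h) * ψ x) + 3 * (F (x + 2 * h) * ψ x) -
          F (x + 3 * h) * ψ x) := by
        rw [expand (hi' 0) (hi' h) (hi' _) (hi' _), expand (hi 0) (hi h) (hi _) (hi _), hsh, hsh,
          hsh, hsh]
    _ = _ := by
        refine integral_congr_ae (.of_forall fun x => ?_)
        simp only [thirdDiff, add_zero]
        ring

/-- The substitution `x = s²`. -/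
theorem integral_abs_mul_comp_sq {F : ℝ → ℝ} (hF : ∀ x ≤ 0, F x = 0) :
    ∫ s, |s| * F (s ^ 2) = ∫ x, F x := by
  have h1 := integral_comp_abs (f := fun s => s * F (s ^ 2))
  simp only [sq_abs] at h1
  rw [h1, ← integral_const_mul]
  have h2 := integral_comp_rpow_Ioi F (p := 2) two_ne_zero
  have h3 : ∫ x in Ioi (0 : ℝ), F x = ∫ x, F x :=
    setIntegral_eq_integral_of_forall_compl_eq_zero fun x hx => hF x (not_lt.1 hx)
  rw [← h3, ← h2]
  refine setIntegral_congr_fun measurableSet_Ioi fun s hs => ?_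
  simp only [smul_eq_mul, abs_two, Real.rpow_two]
  norm_num
  ring

end ThirdDifferencesOfPowers

/-! ### A test function in dimension eight and higher -/

section NegativeTest

variable {d : ℕ}

/-- If `φ` is the third difference, with the opposite step, of a non-negative bump, then `|θ_n| φ(θ_n²)` has a
non-negative Radon transform: it is an integral of third differences of truncated powers. -/
theorem sphericalRadon_abs_mul_comp_sq_nonneg (hd : 6 ≤ d) {h : ℝ} (hh : 0 ≤ h) {ψ : ℝ → ℝ}
    (hψ : Continuous ψ) (hψ0 : ∀ x, 0 ≤ ψ x) (hs : HasCompactSupport ψ)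
    (h0 : ∀ x ≤ 0, thirdDiff ψ (-h) x = 0) {C : ℝ}
    (hC : ∀ s : ℝ, |(|s| * thirdDiff ψ (-h) (s ^ 2))| ≤ C) (ξ : USphere (d + 2)) :
    0 ≤ sphericalRadon (fun θ : USphere (d + 2) =>
      |height θ| * thirdDiff ψ (-h) (height θ ^ 2)) ξ := by
  have hφ : Continuous (thirdDiff ψ (-h)) := by unfold thirdDiff; fun_prop
  have hG : Continuous fun s : ℝ => |s| * thirdDiff ψ (-h) (s ^ 2) := by fun_prop
  rw [sphericalRadon_zonal (by omega) ξ hG.measurable hC]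
  refine mul_nonneg (sphereArea_pos (by omega)).le ?_
  obtain ⟨q, rfl⟩ : ∃ q, d = q + 2 := ⟨d - 2, by omega⟩
  set w := √(1 - height ξ ^ 2) with hw
  refine le_of_le_of_eq ?_ (integral_cosPowMeasure_succ q
    fun u => |w * u| * thirdDiff ψ (-h) ((w * u) ^ 2)).symm
  rw [setIntegral_Ioo_sqrt_one_sub_sq_pow (by omega)]
  rcases (Real.sqrt_nonneg (1 - height ξ ^ 2)).eq_or_lt with h1 | h1
  · rw [hw, ← h1]; simp
  rw [← hw] at h1
  have e1 : ∀ u : ℝ, √(1 - u ^ 2) ^ q * (|w * u| * thirdDiff ψ (-h) ((w * u) ^ 2)) =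
      (fun s => w⁻¹ ^ q * (|s| * (fun x => √(w ^ 2 - x) ^ q * thirdDiff ψ (-h) x) (s ^ 2)))
        (w * u) := fun u => by
    have : √(w ^ 2 - (w * u) ^ 2) = w * √(1 - u ^ 2) := by
      rw [show w ^ 2 - (w * u) ^ 2 = w ^ 2 * (1 - u ^ 2) by ring, Real.sqrt_mul (by positivity),
        Real.sqrt_sq h1.le]
    have hwq := (pow_pos h1 q).ne'
    simp only [this, mul_pow w (√(1 - u ^ 2)) q, inv_pow]
    rw [show (w ^ q)⁻¹ * (|w * u| * (w ^ q * √(1 - u ^ 2) ^ q * thirdDiff ψ (-h) ((w * u) ^ 2))) =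
      (w ^ q)⁻¹ * w ^ q * (√(1 - u ^ 2) ^ q * (|w * u| * thirdDiff ψ (-h) ((w * u) ^ 2))) by ring,
      inv_mul_cancel₀ hwq, one_mul]
  rw [integral_congr_ae (.of_forall e1), Measure.integral_comp_mul_left (fun s =>
    w⁻¹ ^ q * (|s| * (fun x => √(w ^ 2 - x) ^ q * thirdDiff ψ (-h) x) (s ^ 2))), integral_const_mul, integral_abs_mul_comp_sq
    (F := fun x => √(w ^ 2 - x) ^ q * thirdDiff ψ (-h) x) (fun x hx => by simp only [h0 x hx, mul_zero]),
    integral_mul_thirdDiff (by fun_prop) hψ hs]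
  refine mul_nonneg (abs_nonneg _) (mul_nonneg (by positivity) (integral_nonneg fun x => ?_))
  exact mul_nonneg (thirdDiff_sqrt_sub_pow_nonneg (by omega) _ _ hh) (hψ0 x)

/-- Integrals of the radial function of the barrel against zonal functions, in the variable `x = t²`. -/
theorem integral_barrelRadial_mul (hd : 2 ≤ d) {h : ℝ} {ψ : ℝ → ℝ}
    (hψ : Continuous ψ) (hs : HasCompactSupport ψ)
    (h0 : ∀ x ≤ 0, thirdDiff ψ (-h) x = 0) {C : ℝ}
    (hC : ∀ s : ℝ, |barrelRadial |s| * (|s| * thirdDiff ψ (-h) (s ^ 2))| ≤ C) :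
    ∫ θ : USphere (d + 2), barrelRadial |height θ| *
      (|height θ| * thirdDiff ψ (-h) (height θ ^ 2)) ∂(surfaceMeasure (d + 2)) =
    sphereArea (d + 1) * ∫ x, thirdDiff (barrelProfile d) h x * ψ x := by
  have hφ : Continuous (thirdDiff ψ (-h)) := by unfold thirdDiff; fun_prop
  have hb := continuous_barrelRadial
  have hG : Continuous fun s : ℝ => barrelRadial |s| * (|s| * thirdDiff ψ (-h) (s ^ 2)) := by
    fun_prop
  refine (integral_surfaceMeasure_zonal (d := d + 1) (by omega) hG.measurable hC).trans ?_
  congr 1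
  obtain ⟨q, rfl⟩ : ∃ q, d = q + 1 := ⟨d - 1, by omega⟩
  refine (integral_cosPowMeasure_succ q
    fun s => barrelRadial |s| * (|s| * thirdDiff ψ (-h) (s ^ 2))).trans ?_
  rw [setIntegral_Ioo_sqrt_one_sub_sq_pow (by omega),
    ← integral_mul_thirdDiff (continuous_barrelProfile _) hψ hs,
    ← integral_abs_mul_comp_sq (F := fun x => barrelProfile (q + 1) x * thirdDiff ψ (-h) x)
      (fun x hx => by simp only [h0 x hx, mul_zero])]
  refine integral_congr_ae (.of_forall fun s => ?_)
  simp only [barrelProfile, Real.sqrt_sq_eq_abs, Nat.add_sub_cancel]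
  ring

/-- A zonal function with non-negative Radon transform whose integral against `ρ_B` is negative is
supplied by a bump near `1/2 - h`, where the third difference of the profile is negative. -/
theorem not_isIntersectionBody_barrel (hd : 6 ≤ d) : ¬ IsIntersectionBody (barrel (d + 2)) := by
  rintro ⟨-, μ, -, -, hμ⟩
  have hJ : -(1 / 2 : ℝ) ^ ((d : ℝ) / 2 - 3) / 2 < 0 := by
    have : (0 : ℝ) < (1 / 2 : ℝ) ^ ((d : ℝ) / 2 - 3) := by positivity
    linarith
  obtain ⟨h, ⟨hneg, hh8⟩, hh⟩ := (((tendsto_thirdDiff_barrelProfile (d := d)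
    (by omega)).eventually_lt_const hJ).and (nhdsWithin_le_nhds
      (Iio_mem_nhds (show (0 : ℝ) < 1 / 8 by norm_num)))).and eventually_mem_nhdsWithin |>.exists
  have hh0 : 0 < h := hh
  have hh8' : h < 1 / 8 := hh8
  have hD : thirdDiff (barrelProfile d) h (1 / 2 - h) < 0 := by
    by_contra hc
    exact absurd hneg (not_lt.2 (div_nonneg (not_lt.1 hc) (sq_nonneg h)))
  have hP := continuous_barrelProfile d
  have hDc : Continuous (thirdDiff (barrelProfile d) h) := by unfold thirdDiff; fun_prop
  obtain ⟨r, hr, hball⟩ := Metric.eventually_nhds_iff_ball.1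
    (hDc.continuousAt.eventually_lt_const hD)
  set x₁ := 1 / 2 - h with hx₁
  -- the support of `ψ`, and its translates by at most `3h`, stay inside `(0, 1)`
  set ε := min r (1 / 8) with hε
  have hε0 : 0 < ε := lt_min hr (by norm_num)
  have hε8 : ε ≤ 1 / 8 := min_le_right _ _
  set ψ : ℝ → ℝ := fun x => max (ε - |x - x₁|) 0 with hψdef
  have hψ : Continuous ψ := by fun_prop
  have hψ0 : ∀ x, 0 ≤ ψ x := fun x => le_max_right _ _
  have hψz : ∀ x, ε ≤ |x - x₁| → ψ x = 0 := fun x hx => max_eq_right (by linarith)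
  have hψl : ∀ x, x ≤ x₁ - ε → ψ x = 0 := fun x hx =>
    hψz x (by rw [abs_sub_comm]; exact le_trans (by linarith) (le_abs_self _))
  have hψr : ∀ x, x₁ + ε ≤ x → ψ x = 0 := fun x hx =>
    hψz x (le_trans (by linarith) (le_abs_self _))
  have hs : HasCompactSupport ψ :=
    HasCompactSupport.of_support_subset_isCompact (isCompact_Icc (a := x₁ - ε) (b := x₁ + ε))
      fun x hx => by
        by_contra hc
        rw [mem_Icc, not_and_or, not_le, not_le] at hc
        exact hx (hc.elim (fun h => hψl x h.le) fun h => hψr x h.le)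
  have h0 : ∀ x ≤ 0, thirdDiff ψ (-h) x = 0 := fun x hx => by
    rw [thirdDiff, hψl x (by linarith), hψl (x + -h) (by linarith), hψl (x + 2 * -h) (by linarith),
      hψl (x + 3 * -h) (by linarith)]
    norm_num
  have h1 : ∀ x, 1 ≤ x → thirdDiff ψ (-h) x = 0 := fun x hx => by
    rw [thirdDiff, hψr x (by linarith), hψr (x + -h) (by linarith), hψr (x + 2 * -h) (by linarith),
      hψr (x + 3 * -h) (by linarith)]
    norm_num
  have hφ : Continuous (thirdDiff ψ (-h)) := by unfold thirdDiff; fun_prop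
  have hG : Continuous fun s : ℝ => |s| * thirdDiff ψ (-h) (s ^ 2) := by fun_prop
  have hGs : HasCompactSupport fun s : ℝ => |s| * thirdDiff ψ (-h) (s ^ 2) :=
    HasCompactSupport.of_support_subset_isCompact (isCompact_Icc (a := -1) (b := 1)) fun s hs => by
      rw [mem_Icc, ← abs_le]
      by_contra hc
      exact hs (by simp only [h1 _ ((one_le_sq_iff_one_le_abs s).2 (not_le.1 hc).le), mul_zero])
  obtain ⟨C, hC⟩ := hGs.exists_bound_of_continuous hG
  have hb := continuous_barrelRadial
  obtain ⟨C', hC'⟩ := (hGs.mul_left (f := fun s => barrelRadial |s|)).exists_bound_of_continuous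
    (by fun_prop)
  have hkey := hμ ⟨fun θ : USphere (d + 2) => |height θ| * thirdDiff ψ (-h) (height θ ^ 2),
    hG.comp continuous_height⟩
  have hpos : 0 ≤ ∫ ξ, sphericalRadon (fun θ : USphere (d + 2) =>
      |height θ| * thirdDiff ψ (-h) (height θ ^ 2)) ξ ∂μ :=
    integral_nonneg fun ξ =>
      sphericalRadon_abs_mul_comp_sq_nonneg hd hh0.le hψ hψ0 hs h0 hC ξ
  have hrad : ∀ ξ : USphere (d + 2), radialFn (barrel (d + 2)) ξ = barrelRadial |height ξ| :=
    fun ξ => radialFn_barrel (m := d + 1) ξ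
  simp only [ContinuousMap.coe_mk, hrad] at hkey
  have hint := integral_barrelRadial_mul (d := d) (by omega) hψ hs h0 hC'
  rw [← hkey, hint] at hpos
  have hlt : 0 < ∫ x, -(thirdDiff (barrelProfile d) h x * ψ x) := by
    refine Continuous.integral_pos_of_hasCompactSupport_nonneg_nonzero (x := x₁) (by fun_prop)
      ?_ (fun x => ?_) ?_
    · exact (hs.mul_left (f := thirdDiff (barrelProfile d) h)).neg
    · by_cases hx : ε ≤ |x - x₁|
      · simp only [hψz x hx, mul_zero, neg_zero]; exact le_rfl
      · have hx2 : thirdDiff (barrelProfile d) h x < 0 := hball x (by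
          rw [Metric.mem_ball, Real.dist_eq]
          exact (not_le.1 hx).trans_le (min_le_left _ _))
        have := mul_nonneg (neg_nonneg.2 hx2.le) (hψ0 x)
        show 0 ≤ _
        linarith
    · have : ψ x₁ = ε := by simp only [hψdef, sub_self, abs_zero, sub_zero, max_eq_left hε0.le]
      rw [this]
      exact neg_ne_zero.2 (mul_ne_zero hD.ne hε0.ne')
  rw [integral_neg] at hlt
  have hA := sphereArea_pos (d := d + 1) (by omega)
  nlinarith

end NegativeTest

/-! ### Abel transforms of continuous functions -/

section AbelTransform

/-- An Abel transform: the integrals of `G(u) (1 - x - u²)₊^{q/2}`. -/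
noncomputable def abelTransform (q : ℕ) (G : ℝ → ℝ) (x : ℝ) : ℝ := ∫ u, G u * √(1 - x - u ^ 2) ^ q

theorem integrable_mul_sqrt_one_sub_sub_sq_pow {q : ℕ} (hq : q ≠ 0) {G : ℝ → ℝ} (hG : Continuous G) (x : ℝ) :
    Integrable fun u => G u * √(1 - x - u ^ 2) ^ q := by
  refine (Continuous.integrable_of_hasCompactSupport (by fun_prop)
    (HasCompactSupport.of_support_subset_isCompact
      (isCompact_Icc (a := -(1 + |x|)) (b := 1 + |x|)) fun u hu => ?_))
  rw [mem_Icc, ← abs_le]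
  by_contra hc
  refine hu ?_
  have h1 : 1 - x - u ^ 2 ≤ 0 := by
    rw [← sq_abs u]
    nlinarith [abs_nonneg x, neg_abs_le x, not_le.1 hc]
  simp only [Real.sqrt_eq_zero_of_nonpos h1, zero_pow hq, mul_zero]

/-- By homogeneity, the Abel transform of a monomial is a power of `1 - x`. -/
theorem abelTransform_pow {q : ℕ} (j : ℕ) {x : ℝ} (hx : x < 1) :
    abelTransform q (fun u => u ^ j) x =
      (∫ u, u ^ j * √(1 - u ^ 2) ^ q) * (1 - x) ^ (((j + q + 1 : ℕ) : ℝ) / 2) := by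
  have hs : 0 < √(1 - x) := Real.sqrt_pos.2 (by linarith)
  have h1 := Measure.integral_comp_mul_left (fun u => u ^ j * √(1 - x - u ^ 2) ^ q) √(1 - x)
  have h2 : ∀ u : ℝ, (√(1 - x) * u) ^ j * √(1 - x - (√(1 - x) * u) ^ 2) ^ q =
      √(1 - x) ^ (j + q) * (u ^ j * √(1 - u ^ 2) ^ q) := fun u => by
    have : √(1 - x - (√(1 - x) * u) ^ 2) = √(1 - x) * √(1 - u ^ 2) := by
      rw [← Real.sqrt_mul (by linarith), mul_pow, Real.sq_sqrt (by linarith)]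
      ring_nf
    rw [this]
    ring
  simp only [h2] at h1
  rw [integral_const_mul, smul_eq_mul, abs_of_pos (inv_pos.2 hs)] at h1
  rw [abelTransform]
  have h3 : (1 - x) ^ (((j + q + 1 : ℕ) : ℝ) / 2) = √(1 - x) ^ (j + q + 1) := by
    rw [Real.sqrt_eq_rpow, ← Real.rpow_mul_natCast (by linarith)]
    ring_nf
  rw [h3, pow_succ, mul_comm, mul_right_comm, h1]
  field_simp

/-- The second derivative of `c (1 - x)^s`, given in the two-step form used for difference
quotients. -/
theorem exists_hasDerivAt_hasDerivAt_one_sub_rpow (c s : ℝ) {F : ℝ → ℝ}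
    (hF : ∀ x < 1, F x = c * (1 - x) ^ s) : ∃ (F' : ℝ → ℝ) (a : ℝ),
    (∀ᶠ x in 𝓝 (1 / 2 : ℝ), HasDerivAt F (F' x) x) ∧ HasDerivAt F' a (1 / 2) := by
  have h1 : ∀ᶠ x in 𝓝 (1 / 2 : ℝ), x < 1 := Iio_mem_nhds (by norm_num)
  refine ⟨_, _, h1.mono fun x hx => ((hasDerivAt_one_sub_rpow s hx).const_mul
    c).congr_of_eventuallyEq (Filter.mem_of_superset (Iio_mem_nhds hx) fun y hy => hF y hy),
    ((hasDerivAt_one_sub_rpow (s - 1) (by norm_num)).const_mul s).neg.const_mul c⟩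

theorem tendsto_thirdDiff_abelTransform_pow {q : ℕ} (j : ℕ) :
    Tendsto (fun h => thirdDiff (abelTransform q fun u => u ^ j) h (1 / 2 - h) / h ^ 2) (𝓝[>] 0)
      (𝓝 0) := by
  obtain ⟨F', a, h1, h2⟩ := exists_hasDerivAt_hasDerivAt_one_sub_rpow _ _
    fun x hx => abelTransform_pow (q := q) j hx
  have := tendsto_thirdDiff_div_sq h1 h1 h2 h2 rfl rfl (.of_forall fun x _ => rfl)
    (.of_forall fun x _ => rfl)
  rwa [sub_self, zero_div] at this

theorem tendsto_thirdDiff_abelTransform_polynomial {q : ℕ} (hq : q ≠ 0) (p : Polynomial ℝ) :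
    Tendsto (fun h => thirdDiff (abelTransform q fun u => p.eval u) h (1 / 2 - h) / h ^ 2) (𝓝[>] 0)
      (𝓝 0) := by
  have h1 : ∀ x, abelTransform q (fun u => p.eval u) x =
      ∑ i ∈ Finset.range (p.natDegree + 1), p.coeff i * abelTransform q (fun u => u ^ i) x := by
    intro x
    simp only [abelTransform, Polynomial.eval_eq_sum_range, Finset.sum_mul, mul_assoc]
    rw [integral_finsetSum _ fun i _ => (integrable_mul_sqrt_one_sub_sub_sq_pow hq (continuous_pow i) x).const_mul _]
    simp only [integral_const_mul]
  have h2 : ∀ h, thirdDiff (abelTransform q fun u => p.eval u) h (1 / 2 - h) / h ^ 2 =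
      ∑ i ∈ Finset.range (p.natDegree + 1), p.coeff i *
        (thirdDiff (abelTransform q fun u => u ^ i) h (1 / 2 - h) / h ^ 2) := fun h => by
    simp only [thirdDiff, h1, Finset.mul_sum, ← Finset.sum_sub_distrib, ← Finset.sum_add_distrib,
      Finset.sum_div]
    exact Finset.sum_congr rfl fun i _ => by ring
  simp only [h2]
  simpa using tendsto_finsetSum (Finset.range (p.natDegree + 1)) fun i _ =>
    (tendsto_thirdDiff_abelTransform_pow (q := q) i).const_mul (p.coeff i)

theorem abelTransform_add {q : ℕ} (hq : q ≠ 0) {G H : ℝ → ℝ} (hG : Continuous G)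
    (hH : Continuous H) (x : ℝ) :
    abelTransform q (fun u => G u + H u) x = abelTransform q G x + abelTransform q H x := by
  simp only [abelTransform, add_mul]
  exact integral_add (integrable_mul_sqrt_one_sub_sub_sq_pow hq hG x) (integrable_mul_sqrt_one_sub_sub_sq_pow hq hH x)

/-- A third difference is a difference of two second differences, which are non-negative for the
convex function `t₊^{q/2}`. -/
theorem abs_thirdDiff_abelTransform_le {q : ℕ} (hq : 2 ≤ q) {G : ℝ → ℝ} (hG : Continuous G)
    {ε : ℝ} (hε : ∀ u ∈ Icc (-1 : ℝ) 1, |G u| ≤ ε) {h : ℝ} (h0 : 0 < h) (h2 : h < 1 / 2) :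
    |thirdDiff (abelTransform q G) h (1 / 2 - h)| ≤
      ε * (abelTransform q (fun u => u ^ 0) (1 / 2 - h) - abelTransform q (fun u => u ^ 0) (1 / 2) -
        abelTransform q (fun u => u ^ 0) (1 / 2 + h) +
        abelTransform q (fun u => u ^ 0) (1 / 2 + 2 * h)) := by
  have hq0 : q ≠ 0 := by omega
  have i := fun x => integrable_mul_sqrt_one_sub_sub_sq_pow hq0 hG x
  have j := fun x => integrable_mul_sqrt_one_sub_sub_sq_pow hq0 (continuous_pow (M := ℝ) 0) x
  have e1 : thirdDiff (abelTransform q G) h (1 / 2 - h) =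
      ∫ u, (G u * √(1 - (1 / 2 - h) - u ^ 2) ^ q - 3 * (G u * √(1 - 1 / 2 - u ^ 2) ^ q) +
        3 * (G u * √(1 - (1 / 2 + h) - u ^ 2) ^ q) -
        G u * √(1 - (1 / 2 + 2 * h) - u ^ 2) ^ q) := by
    rw [integral_sub (f := fun u => G u * √(1 - (1 / 2 - h) - u ^ 2) ^ q -
        3 * (G u * √(1 - 1 / 2 - u ^ 2) ^ q) + 3 * (G u * √(1 - (1 / 2 + h) - u ^ 2) ^ q))
        (((i _).sub ((i _).const_mul 3)).add ((i _).const_mul 3)) (i _),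
      integral_add (f := fun u => G u * √(1 - (1 / 2 - h) - u ^ 2) ^ q -
        3 * (G u * √(1 - 1 / 2 - u ^ 2) ^ q)) ((i _).sub ((i _).const_mul 3)) ((i _).const_mul 3),
      integral_sub (i _) ((i _).const_mul 3), integral_const_mul, integral_const_mul, thirdDiff,
      show 1 / 2 - h + h = 1 / 2 by ring, show 1 / 2 - h + 2 * h = 1 / 2 + h by ring,
      show 1 / 2 - h + 3 * h = 1 / 2 + 2 * h by ring]
    rfl
  have e2 : ∫ u, ε * (u ^ 0 * √(1 - (1 / 2 - h) - u ^ 2) ^ q - u ^ 0 * √(1 - 1 / 2 - u ^ 2) ^ q -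
        u ^ 0 * √(1 - (1 / 2 + h) - u ^ 2) ^ q + u ^ 0 * √(1 - (1 / 2 + 2 * h) - u ^ 2) ^ q) =
      ε * (abelTransform q (fun u => u ^ 0) (1 / 2 - h) - abelTransform q (fun u => u ^ 0) (1 / 2) -
        abelTransform q (fun u => u ^ 0) (1 / 2 + h) +
        abelTransform q (fun u => u ^ 0) (1 / 2 + 2 * h)) := by
    rw [integral_const_mul, integral_add (f := fun u => u ^ 0 * √(1 - (1 / 2 - h) - u ^ 2) ^ q -
        u ^ 0 * √(1 - 1 / 2 - u ^ 2) ^ q - u ^ 0 * √(1 - (1 / 2 + h) - u ^ 2) ^ q)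
        (((j _).sub (j _)).sub (j _)) (j _),
      integral_sub (f := fun u => u ^ 0 * √(1 - (1 / 2 - h) - u ^ 2) ^ q -
        u ^ 0 * √(1 - 1 / 2 - u ^ 2) ^ q) ((j _).sub (j _)) (j _), integral_sub (j _) (j _)]
    rfl
  rw [e1, ← e2, ← Real.norm_eq_abs]
  refine norm_integral_le_of_norm_le (G := ℝ) (((((j (1 / 2 - h)).sub (j (1 / 2))).sub
    (j (1 / 2 + h))).add (j (1 / 2 + 2 * h))).const_mul ε)
    (Filter.Eventually.of_forall fun u => ?_)
  rw [Real.norm_eq_abs]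
  by_cases hu : u ∈ Icc (-1 : ℝ) 1
  -- the left-hand side is a difference of two second differences, the right-hand side their sum
  · have d1 := sqrt_pow_add_sqrt_pow hq (y₁ := 1 - (1 / 2 - h) - u ^ 2) (y₂ := 1 - 1 / 2 - u ^ 2)
      (y₃ := 1 - (1 / 2 + h) - u ^ 2) (by linarith)
    have d2 := sqrt_pow_add_sqrt_pow hq (y₁ := 1 - 1 / 2 - u ^ 2) (y₂ := 1 - (1 / 2 + h) - u ^ 2)
      (y₃ := 1 - (1 / 2 + 2 * h) - u ^ 2) (by linarith)
    simp only [pow_zero, one_mul]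
    generalize √(1 - (1 / 2 - h) - u ^ 2) ^ q = f₀ at *
    generalize √(1 - 1 / 2 - u ^ 2) ^ q = f₁ at *
    generalize √(1 - (1 / 2 + h) - u ^ 2) ^ q = f₂ at *
    generalize √(1 - (1 / 2 + 2 * h) - u ^ 2) ^ q = f₃ at *
    rw [show G u * f₀ - 3 * (G u * f₁) + 3 * (G u * f₂) - G u * f₃ =
      G u * ((f₀ - 2 * f₁ + f₂) - (f₁ - 2 * f₂ + f₃)) by ring, abs_mul]
    refine mul_le_mul (hε u hu) (abs_le.2 ⟨?_, ?_⟩) (abs_nonneg _)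
      ((abs_nonneg _).trans (hε u hu)) <;> linarith
  -- for `|u| > 1` all four truncated powers vanish
  · have hu2 : 1 < u ^ 2 := by
      rw [one_lt_sq_iff_one_lt_abs]
      by_contra hc
      exact hu (abs_le.1 (not_lt.1 hc))
    simp only [pow_zero, one_mul]
    rw [Real.sqrt_eq_zero_of_nonpos (by linarith : 1 - (1 / 2 - h) - u ^ 2 ≤ 0),
      Real.sqrt_eq_zero_of_nonpos (by linarith : 1 - 1 / 2 - u ^ 2 ≤ 0),
      Real.sqrt_eq_zero_of_nonpos (by linarith : 1 - (1 / 2 + h) - u ^ 2 ≤ 0),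
      Real.sqrt_eq_zero_of_nonpos (by linarith : 1 - (1 / 2 + 2 * h) - u ^ 2 ≤ 0), zero_pow hq0]
    simp

/-- The second derivative of the Abel transform of a continuous function does not jump: polynomials
have smooth Abel transforms, and approximate any continuous function. -/
theorem tendsto_thirdDiff_abelTransform {q : ℕ} (hq : 2 ≤ q) {G : ℝ → ℝ} (hG : Continuous G) :
    Tendsto (fun h => thirdDiff (abelTransform q G) h (1 / 2 - h) / h ^ 2) (𝓝[>] 0) (𝓝 0) := by
  have hq0 : q ≠ 0 := by omega
  obtain ⟨F', a, h1, h2⟩ := exists_hasDerivAt_hasDerivAt_one_sub_rpow _ _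
    fun x hx => abelTransform_pow (q := q) 0 hx
  have hΦ := tendsto_secondDiff_add_secondDiff h1 h2
  rw [Metric.tendsto_nhds]
  intro δ hδ
  set ε := δ / (2 * (|2 * a| + 1)) with hε
  have hε0 : 0 < ε := by positivity
  obtain ⟨p, hp⟩ := exists_polynomial_near_of_continuousOn (-1) 1 G hG.continuousOn ε hε0
  have hpc : Continuous fun u => p.eval u := p.continuous
  have hGp : Continuous fun u => G u - p.eval u := hG.sub hpc
  have hr : ∀ u ∈ Icc (-1 : ℝ) 1, |G u - p.eval u| ≤ ε := fun u hu => by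
    rw [abs_sub_comm]; exact (hp u hu).le
  have hlt : 2 * a < |2 * a| + 1 := by linarith [le_abs_self (2 * a)]
  filter_upwards [hΦ.eventually_lt_const hlt, Metric.tendsto_nhds.1
    (tendsto_thirdDiff_abelTransform_polynomial hq0 p) (δ / 2) (half_pos hδ),
    nhdsWithin_le_nhds (Iio_mem_nhds (show (0 : ℝ) < 1 / 2 by norm_num)),
    eventually_mem_nhdsWithin] with h e1 e2 e3 e4
  have h0 : 0 < h := e4
  have hb := abs_thirdDiff_abelTransform_le hq hGp hr h0 e3
  have hadd : thirdDiff (abelTransform q G) h (1 / 2 - h) =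
      thirdDiff (abelTransform q fun u => p.eval u) h (1 / 2 - h) +
        thirdDiff (abelTransform q fun u => G u - p.eval u) h (1 / 2 - h) := by
    have : ∀ x, abelTransform q G x = abelTransform q (fun u => p.eval u) x +
        abelTransform q (fun u => G u - p.eval u) x := fun x => by
      rw [← abelTransform_add hq0 hpc hGp]
      simp only [add_sub_cancel]
    simp only [thirdDiff, this]
    ring
  rw [Real.dist_eq, sub_zero] at e2 ⊢
  rw [hadd, add_div]
  refine (abs_add_le _ _).trans_lt ?_
  have hb2 : |thirdDiff (abelTransform q fun u => G u - p.eval u) h (1 / 2 - h) / h ^ 2| ≤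
      δ / 2 := by
    rw [abs_div, abs_of_pos (by positivity : 0 < h ^ 2)]
    refine (div_le_div_of_nonneg_right hb (by positivity)).trans ?_
    rw [mul_div_assoc]
    refine (mul_le_mul_of_nonneg_left e1.le hε0.le).trans_eq ?_
    rw [hε]
    field_simp
  linarith

end AbelTransform

/-! ### The barrel and sections of star bodies -/

section NoStarBody

variable {d : ℕ}

/-- The integral of `g` over the parallel at height `u`, which is parametrized by the unit sphere of
the equator. -/
noncomputable def parallelIntegral (g : USphere (d + 2) → ℝ) (u : ℝ) : ℝ :=
  ∫ η, g (latitude (Real.arcsin u) η) ∂(surfaceMeasure (d + 1))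

theorem continuous_parallelIntegral {g : USphere (d + 2) → ℝ} (hg : Continuous g) :
    Continuous (parallelIntegral g) := by
  obtain ⟨C, hC⟩ := isCompact_univ.exists_bound_of_continuousOn hg.continuousOn
  refine continuous_of_dominated (bound := fun _ => C) (fun u => ?_)
    (fun u => .of_forall fun η => hC _ (mem_univ _)) (integrable_const _) (.of_forall fun η => ?_)
  · exact (hg.comp (continuous_latitude_right _)).aestronglyMeasurable
  · exact (hg.comp (continuous_latitude_left η)).comp Real.continuous_arcsin

/-- If `ρ_B = Rg`, then averaging over the parallel of height `√x` expresses the profile of the barrel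
as an Abel transform. -/
theorem barrelProfile_eq_abelTransform (hd : 4 ≤ d) {g : USphere (d + 2) → ℝ} (hg : Continuous g)
    (hR : ∀ ξ : USphere (d + 2), barrelRadial |height ξ| = sphericalRadon g ξ) {x : ℝ}
    (h0 : 0 ≤ x) (hx : x < 1) :
    sphereArea (d + 1) * barrelProfile d x =
      sphereArea d * abelTransform (d - 2) (parallelIntegral g) x := by
  have hs1 : √x < 1 := by rw [Real.sqrt_lt' one_pos]; linarith
  have hs0 := Real.sqrt_nonneg x
  have hsin : Real.sin (Real.arcsin √x) = √x := Real.sin_arcsin (by linarith) hs1.le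
  have hcos : Real.cos (Real.arcsin √x) = √(1 - x) := by rw [Real.cos_arcsin, Real.sq_sqrt h0]
  have key := integral_latitude_sphericalRadon (d := d) (by omega) hg (α := Real.arcsin √x)
    ⟨Real.neg_pi_div_two_lt_arcsin.2 (by linarith), Real.arcsin_lt_pi_div_two.2 hs1⟩
  simp only [← hR, height_latitude, hsin, hcos, integral_const, smul_eq_mul, abs_of_nonneg hs0]
    at key
  have e1 : sphereArea (d + 1) * barrelProfile d x =
      √(1 - x) ^ (d - 1) * ((surfaceMeasure (d + 1)).real univ * barrelRadial √x) := by
    rw [sphereArea, barrelProfile]; ring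
  rw [e1, key]
  congr 1
  have hint : Integrable (fun θ : USphere (d + 2) =>
      g θ * (√(width θ ^ 2 - √x ^ 2) ^ (d - 2) / width θ ^ (d - 1))) (surfaceMeasure (d + 2)) := by
    obtain ⟨C, hC⟩ := isCompact_univ.exists_bound_of_continuousOn hg.continuousOn
    refine ((integrable_inv_width (d := d) (by omega)).const_mul C).mono' ?_
      (.of_forall fun θ => ?_)
    · have := (continuous_width (m := d + 1)).measurable
      have := hg.measurable
      exact (by fun_prop : Measurable fun θ : USphere (d + 2) =>
        g θ * (√(width θ ^ 2 - √x ^ 2) ^ (d - 2) / width θ ^ (d - 1))).aestronglyMeasurable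
    · have hw := width_nonneg θ
      rw [norm_mul, Real.norm_of_nonneg (by positivity :
        0 ≤ √(width θ ^ 2 - √x ^ 2) ^ (d - 2) / width θ ^ (d - 1))]
      exact mul_le_mul (hC θ (mem_univ _)) (sqrt_sub_sq_pow_div_le hw (by omega) _) (by positivity)
        ((norm_nonneg _).trans (hC θ (mem_univ _)))
  rw [integral_surfaceMeasure_succ (m := d + 1) (by omega) hint]
  obtain ⟨q, rfl⟩ : ∃ q, d = q + 2 := ⟨d - 2, by omega⟩
  simp only [Nat.add_sub_cancel, show q + 2 - 1 = q + 1 from rfl] at *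
  -- the weights `(1 - u²)^{(d-1)/2}` of the parallels cancel in `f`
  set f : ℝ → ℝ := fun u => parallelIntegral g u *
    (√(√(1 - u ^ 2) ^ 2 - √x ^ 2) ^ q / √(1 - u ^ 2) ^ (q + 1)) with hf
  have e2 : ∫ β, ∫ η, g (latitude β η) * (√(width (latitude β η) ^ 2 - √x ^ 2) ^ q /
      width (latitude β η) ^ (q + 1)) ∂(surfaceMeasure (q + 2 + 1)) ∂(cosPowMeasure (q + 2)) =
      ∫ β, f (Real.sin β) ∂(cosPowMeasure (q + 2)) := by
    rw [integral_cosPowMeasure, integral_cosPowMeasure]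
    refine setIntegral_congr_fun measurableSet_Ioo fun β hβ => ?_
    simp only [width, height_latitude, hf]
    rw [integral_mul_const, parallelIntegral, Real.arcsin_sin hβ.1.le hβ.2.le]
  refine e2.trans ?_
  rw [integral_cosPowMeasure_succ (q + 1) f, abelTransform]
  have hz : ∀ u ∉ Ioo (-1 : ℝ) 1, parallelIntegral g u * √(1 - x - u ^ 2) ^ q = 0 := fun u hu => by
    have : 1 ≤ u ^ 2 := by
      rw [one_le_sq_iff_one_le_abs]
      by_contra h
      exact hu (abs_lt.1 (not_le.1 h))
    rw [Real.sqrt_eq_zero_of_nonpos (by linarith), zero_pow (by omega), mul_zero]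
  rw [← setIntegral_eq_integral_of_forall_compl_eq_zero hz]
  refine setIntegral_congr_fun measurableSet_Ioo fun u hu => ?_
  have hu2 : 0 < 1 - u ^ 2 := by nlinarith [hu.1, hu.2]
  have hpos : 0 < √(1 - u ^ 2) := Real.sqrt_pos.2 hu2
  simp only [hf]
  rw [Real.sq_sqrt hu2.le, Real.sq_sqrt h0, show 1 - u ^ 2 - x = 1 - x - u ^ 2 by ring]
  field_simp

/-- The profile of the barrel would be the Abel transform of a continuous function, which does not
allow the jump of its second derivative at `1/2`. -/
theorem not_isIntersectionBodyOf_barrel (hd : 4 ≤ d) (L : Set (Euc (d + 2))) :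
    ¬ IsIntersectionBodyOf (barrel (d + 2)) L := by
  rintro ⟨-, hL, h⟩
  have hLc := hL.continuous_radialFn
  have hg : Continuous fun θ : USphere (d + 2) => 1 / ((d : ℝ) + 1) * radialFn L θ ^ (d + 1) := by
    fun_prop
  have hR : ∀ ξ : USphere (d + 2), barrelRadial |height ξ| =
      sphericalRadon (fun θ => 1 / ((d : ℝ) + 1) * radialFn L θ ^ (d + 1)) ξ := fun ξ => by
    rw [← radialFn_barrel (m := d + 1) ξ]
    exact (h ξ).trans (hL.volume_section ξ)
  have hA := sphereArea_pos (d := d + 1) (by omega)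
  have h1 := (tendsto_thirdDiff_abelTransform (q := d - 2) (by omega)
    (continuous_parallelIntegral hg)).const_mul (sphereArea d)
  have h2 := (tendsto_thirdDiff_barrelProfile (d := d) (by omega)).const_mul (sphereArea (d + 1))
  have h3 : sphereArea (d + 1) * (-(1 / 2 : ℝ) ^ ((d : ℝ) / 2 - 3) / 2) = sphereArea d * 0 := by
    refine tendsto_nhds_unique (h2.congr' ?_) h1
    filter_upwards [nhdsWithin_le_nhds (Iio_mem_nhds (show (0 : ℝ) < 1 / 8 by norm_num)),
      eventually_mem_nhdsWithin] with t ht8 ht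
    have ht0 : 0 < t := ht
    have ht8' : t < 1 / 8 := ht8
    have e := fun x h0 hx => barrelProfile_eq_abelTransform hd hg hR (x := x) h0 hx
    rw [mul_div_assoc', mul_div_assoc']
    congr 1
    simp only [thirdDiff, mul_add, mul_sub, mul_left_comm _ (3 : ℝ)]
    rw [e _ (by linarith) (by linarith), e _ (by linarith) (by linarith),
      e _ (by linarith) (by linarith), e _ (by linarith) (by linarith)]
  have : (0 : ℝ) < (1 / 2 : ℝ) ^ ((d : ℝ) / 2 - 3) := by positivity
  nlinarith

end NoStarBody

theorem mainTheorem6 :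
    -- in `ℝ⁴` the barrel is the intersection body of an explicit star body
    (∃ L : Set (Euc 4), (∀ θ : USphere 4, radialFn L θ = barrelSource |(θ : Euc 4) 3|) ∧
      IsIntersectionBodyOf (barrel 4) L) ∧
    -- in `ℝ⁶` it is an intersection body: its radial function is the Radon transform of a
    -- non-negative piecewise continuous function
    IsIntersectionBody (barrel 6) ∧
    (∃ h₁ h₂ : ℝ → ℝ,
      ContinuousOn h₁ (Icc 0 (1 / √2)) ∧ (∀ t ∈ Icc (0 : ℝ) (1 / √2), 0 ≤ h₁ t) ∧
      ContinuousOn h₂ (Icc (1 / √2) 1) ∧ (∀ t ∈ Icc (1 / √2 : ℝ) 1, 0 ≤ h₂ t) ∧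
      ∀ ξ : USphere 6, radialFn (barrel 6) ξ =
        sphericalRadon (fun θ : USphere 6 =>
          if |(θ : Euc 6) 5| < 1 / √2 then h₁ |(θ : Euc 6) 5| else h₂ |(θ : Euc 6) 5|) ξ) ∧
    -- it is not an intersection body of a star body in dimensions 6 and higher
    (∀ n : ℕ, 6 ≤ n → ¬ ∃ L : Set (Euc n), IsIntersectionBodyOf (barrel n) L) ∧
    -- the inverse Radon transform in dimension 8 contains a negative Dirac mass
    (∃ c : ℝ, 0 < c ∧ ∀ g : C(USphere 8, ℝ),
      ∫ ξ, radialFn (barrel 8) ξ * g ξ ∂(surfaceMeasure 8) =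
        c * ((∫ θ, sphericalRadon g θ * barrelDensity |(θ : Euc 8) 7| ∂(surfaceMeasure 8)) -
          4 / 15 * ∫ θ, sphericalRadon g θ
            ∂(latitudeDirac 7 (1 / √2) abs_one_div_sqrt_two_le))) ∧
    -- it is not an intersection body in dimensions 8 and higher
    (∀ n : ℕ, 8 ≤ n → ¬ IsIntersectionBody (barrel n)) ∧
    -- its polar is not a zonoid in dimensions 8 and higher
    (∀ n : ℕ, 8 ≤ n → ¬ IsZonoid (polarBody (barrel n))) := by
  refine ⟨⟨_, fun θ => ?_, isIntersectionBodyOf_barrel_four⟩, isIntersectionBody_barrel_six,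
    exists_density_barrel_six, fun n hn => ?_, exists_inversion_barrel_eight, fun n hn => ?_,
    fun n hn => ?_⟩
  · exact radialFn_starRegion (fun _ => barrelSource_pos (abs_nonneg _)) θ
  · obtain ⟨d, rfl⟩ : ∃ d, n = d + 2 := ⟨n - 2, by omega⟩
    rintro ⟨L, hL⟩
    exact not_isIntersectionBodyOf_barrel (by omega) L hL
  · obtain ⟨d, rfl⟩ : ∃ d, n = d + 2 := ⟨n - 2, by omega⟩
    exact not_isIntersectionBody_barrel (by omega)
  · obtain ⟨m, rfl⟩ : ∃ m, n = m + 1 := ⟨n - 1, by omega⟩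
    exact not_isZonoid_polarBody_barrel (by omega)
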